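/- The *LZD parsing* of a string $s$ over an alphabet $\Sigma$ is $s=p_1\cdots p_z$, where each $p_i=p_{i_1}p_{i_2}$, $p_{i_1}$ is the longest prefix of the unparsed part of $s$ that lies in $\{p_1,\dots,p_{i-1}\}\cup\Sigma$, and $p_{i_2}$ is the longest prefix in this set of what remains after $p_{i_1}$ ($p_{i_2}$ is empty if nothing remains). The *LZMW parsing* is $s=p_1\cdots p_z$, where each $p_i$ is the longest prefix of the unparsed part of $s$ that lies in $\{p_jp_{j+1}: 1\le j\le i-2\}\cup\Sigma$. The *naïve LZD (LZMW) parsing algorithm* computes this parsing phrase by phrase, keeping the dictionary in a compacted trie. Each edge label is stored as a pair of positions in $s$. The nodes that represent the phrases $p_1,\dots,p_{i-1}$ (for LZMW, the strings $p_1p_2,\dots,p_{i-2}p_{i-1}$) and the letters seen so far are marked. To find a longest dictionary prefix at a position of $s$, the algorithm descends from the root, comparing letters one by one, as long as the text can be matched, and returns the string of the lowest marked node on the path; if there is none, the letter at this position is new, it is returned, and a marked child of the root is created for it. After $p_i$ has been found, $p_i$ (for LZMW, $p_{i-1}p_i$ if $i\ge 2$) is inserted: the algorithm descends from the root along its longest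 prefix present in the trie, creates at most two nodes, and marks the node that represents it. The running time is the number of letters matched, plus the number of edges inspected, plus one unit for the final node creation and marking in each insertion. **Theorem.** Let $T_{\mathrm{LZD}}(n)$ and $T_{\mathrm{LZMW}}(n)$ be the maximal running times of the naïve LZD and LZMW parsing algorithms on the binary strings $s\in\{0,1\}^n$. Then $$T_{\mathrm{LZD}}(n)=\Omega\!\left(\frac{n^{5/4}}{\log^{1/4} n}\right)\quad\text{and}\quad T_{\mathrm{LZMW}}(n)=\Omega\!\left(\frac{n^{5/4}}{\log^{1/4} n}\right),$$ that is, for each of the two algorithms there are $c>0$ and $N$ such that for every $n\ge N$ some binary string of length $n$ takes time at least $c\,n^{5/4}/\log^{1/4}n$. -/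

import Mathlib

namespace NaiveParsing

/-- A compacted trie, given as the list of edges that leave a node. `nil` is the empty list of edges;
`edge start len marked child sibling` is an edge followed by the remaining edges `sibling` of the same
node. The label of the edge is stored as a pair of positions: it is the factor of length `len` of the
input string that begins at position `start` (positions are counted from `0`). The edge leads to a node
with the list `child` of outgoing edges, and `marked` tells whether that node is marked, that is, whether
the string written on the path from the root to it belongs to the dictionary. -/
inductive Trie where
  | nil : Trie
  | edge (start len : ℕ) (marked : Bool) (child sibling : Trie) : Trie

/-- Letter by letter comparison of the factors of `s` that begin at `i` and at `j`, for at most `l`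
letters: the number of letters matched before the first mismatch. -/
def matchLen {α : Type*} [DecidableEq α] (s : List α) (i j : ℕ) : ℕ → ℕ
  | 0 => 0
  | l + 1 => if s[i]? = s[j]? then matchLen s (i + 1) (j + 1) l + 1 else 0

/-- Descend in the trie as long as the factor `s[pos..e)` can be matched. The first component of the
result is the depth of the lowest marked node on the path (`0` if there is none below the root), the
second one is the time: one unit for every edge inspected and one unit for every letter matched. -/
def Trie.search {α : Type*} [DecidableEq α] (s : List α) : Trie → ℕ → ℕ → ℕ × ℕ
  | .nil, _, _ => (0, 0)
  | .edge start len marked child sibling, pos, e =>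
    if e ≤ pos then (0, 0)
    else
      let k := matchLen s start pos (min len (e - pos))
      if k = 0 then
        let r := Trie.search s sibling pos e
        (r.1, r.2 + 1)
      else if k < len then (0, k + 1)
      else
        let r := Trie.search s child (pos + len) e
        (if 0 < r.1 then len + r.1 else if marked then len else 0, r.2 + len + 1)

/-- Update of the trie, after which it has a marked node representing the nonempty factor `s[pos..e)`:
descend from the root along the longest prefix of this factor that is present, then create at most two
new nodes (splitting an edge if necessary) and mark the node reached. The second component is the time:
one unit for every edge inspected, one unit for every letter matched and one unit for
the creation and marking of nodes at the end. -/
def Trie.insert {α : Type*} [DecidableEq α] (s : List α) : Trie → ℕ → ℕ → Trie × ℕ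
  | .nil, pos, e => (.edge pos (e - pos) true .nil .nil, 1)
  | .edge start len marked child sibling, pos, e =>
    let k := matchLen s start pos (min len (e - pos))
    if k = 0 then
      let r := Trie.insert s sibling pos e
      (.edge start len marked child r.1, r.2 + 1)
    else if k < len then
      if pos + k = e then
        (.edge start k true (.edge (start + k) (len - k) marked child .nil) sibling, k + 2)
      else
        let leaf : Trie := .edge (pos + k) (e - pos - k) true .nil .nil
        (.edge start k false
          (.edge (start + k) (len - k) marked child leaf) sibling, k + 2)
    else if pos + len = e then
      (.edge start len true child sibling, len + 2)
    else
      let r := Trie.insert s child (pos + len) e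
      (.edge start len marked r.1 sibling, r.2 + len + 1)

/-- The longest prefix of `s[pos..n)` that is a letter or is represented by a marked node; `n` is the
length of `s`. If there is no such marked node, then the letter at `pos` occurs for the first time, and a
marked child of the root is created for it. The result is the updated trie, the length of the prefix
(`0` only if `pos` is the end of `s`) and the time. -/
def findElement {α : Type*} [DecidableEq α] (s : List α) (T : Trie) (pos : ℕ) : Trie × ℕ × ℕ :=
  if s.length ≤ pos then (T, 0, 0)
  else
    let r := T.search s pos s.length
    if r.1 = 0 then
      let u := T.insert s pos (pos + 1)
      (u.1, 1, r.2 + u.2)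
    else (T, r.1, r.2)

/-- A state of a naïve parsing algorithm: the position up to which the input has been parsed, the trie,
the phrases found so far as pairs (starting position, length) with the most recent phrase first, and the
time used so far. -/
structure State where
  pos : ℕ
  trie : Trie
  phrases : List (ℕ × ℕ)
  time : ℕ

/-- The initial state; the trie consists of the root only. -/
def State.init : State := ⟨0, .nil, [], 0⟩

/-- One round of the naïve LZD algorithm: find the two elements of the next phrase one after the other,
then insert the phrase into the trie. Nothing happens once the whole input has been parsed. -/
def lzdStep {α : Type*} [DecidableEq α] (s : List α) (σ : State) : State :=
  if s.length ≤ σ.pos then σ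
  else
    let a := findElement s σ.trie σ.pos
    let b := findElement s a.1 (σ.pos + a.2.1)
    let next := σ.pos + a.2.1 + b.2.1
    let u := b.1.insert s σ.pos next
    ⟨next, u.1, (σ.pos, a.2.1 + b.2.1) :: σ.phrases, σ.time + a.2.2 + b.2.2 + u.2⟩

/-- One round of the naïve LZMW algorithm: find the next phrase, then insert the concatenation of the
previous phrase and this one (if there is a previous phrase) into the trie. Nothing happens once the whole
input has been parsed. -/
def lzmwStep {α : Type*} [DecidableEq α] (s : List α) (σ : State) : State :=
  if s.length ≤ σ.pos then σ
  else
    let a := findElement s σ.trie σ.pos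
    let next := σ.pos + a.2.1
    match σ.phrases with
    | [] => ⟨next, a.1, [(σ.pos, a.2.1)], σ.time + a.2.2⟩
    | prev :: rest =>
      let u := a.1.insert s prev.1 next
      ⟨next, u.1, (σ.pos, a.2.1) :: prev :: rest, σ.time + a.2.2 + u.2⟩

/-- The final state of the naïve LZD algorithm on `s`. Every round advances by at least one letter, so
`s.length` rounds suffice. -/
def lzdRun {α : Type*} [DecidableEq α] (s : List α) : State :=
  (lzdStep s)^[s.length] State.init

/-- The final state of the naïve LZMW algorithm on `s`. -/
def lzmwRun {α : Type*} [DecidableEq α] (s : List α) : State :=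
  (lzmwStep s)^[s.length] State.init

/-- The running time of the naïve LZD parsing algorithm on `s`. -/
def lzdTime {α : Type*} [DecidableEq α] (s : List α) : ℕ := (lzdRun s).time

/-- The running time of the naïve LZMW parsing algorithm on `s`. -/
def lzmwTime {α : Type*} [DecidableEq α] (s : List α) : ℕ := (lzmwRun s).time

/-- The largest value of `time` on the binary strings of length `n`. -/
def worstCaseBinary (time : List Bool → ℕ) (n : ℕ) : ℕ :=
  Finset.univ.sup fun v : Fin n → Bool => time (List.ofFn v)

end NaiveParsing

/-! A search is expensive when it walks far along a long dictionary word, fails near the end of that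
word, and returns only a short marked prefix. The construction makes this happen about `k ^ 2` times
at nearly the same places.

For LZD, let v be a word of `k` distinct letters. The dictionary is first filled with the towers y_h
v y_{h+1} v … y_{k-1} v y_k, for `h < k`, of O(k²) letters each. There are `k - 1` rounds, and each
contains a stretch that reads y_0 v y_1 v … y_{k-1} v', with v' a prefix of v, in which y_k never
arrives. At every y_h the search follows the tower of index `h` through all remaining blocks, finds
the tower incomplete, and falls back on y_h v'. The next search starts one block later and compares
the same letters again. A round has O(k²) letters but costs order k³ letter comparisons. The phrases
created by a round must not shorten the following ones, so the cut of v into v' and the remaining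
suffix moves by one letter per round, after a preparatory stretch that creates the new words y_h v'.

LZMW inserts concatenations of neighbouring phrases, which yields many unwanted words. There v is
replaced by columns c_0 b_1 c_1 … b_{k-1} c_{k-1} z_h: the b's separate the two phrases whose
concatenation is wanted from the next one, and the last letter z_h, different in each block, keeps
unwanted words of one block from matching in another.

The letter `i` is coded in binary as `0^i 1`. This is a prefix code, so the parsing of the codes
mirrors the parsing over letters once the codes are in the dictionary. The letters used in the main
part lie between `k` and a multiple of `k`. So O(k³) letters give O(k⁴) bits, and order k⁴ letter
comparisons give order k⁵ time. The resulting bound is of order n^{5/4}; the logarithm in the claim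
is simply discarded.

The weight is carried by `Trie.search_spec` (a search pays for every common prefix of a marked word
and the text), by the two-sided dictionary bound `Trie.Between`, which allows phrases to be found
without describing the trie, and by `At.rowText` and `parse_blocks`, where the time is collected. -/

namespace NaiveParsing

/-! ### Correctness and cost of searches and insertions in the compacted trie -/

section TrieSpec

variable {α : Type*}

/-- The factor of `s` of length `l` that begins at `i` (shorter if `s` ends before). -/
def fac (s : List α) (i l : ℕ) : List α := (s.drop i).take l

theorem fac_zero (s : List α) (i : ℕ) : fac s i 0 = [] := by simp [fac]

theorem fac_succ (s : List α) (i l : ℕ) : fac s i (l + 1) = s[i]?.toList ++ fac s (i + 1) l := by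
  unfold fac
  rcases lt_or_ge i s.length with h | h
  · rw [List.drop_eq_getElem_cons h, List.take_succ_cons]; simp [h]
  · simp [List.drop_eq_nil_of_le h, List.drop_eq_nil_of_le (Nat.le_succ_of_le h), h]

theorem length_fac {s : List α} {i l : ℕ} (h : i + l ≤ s.length) : (fac s i l).length = l := by
  simp [fac]; omega

theorem fac_add (s : List α) (i k l : ℕ) : fac s i (k + l) = fac s i k ++ fac s (i + k) l := by
  simp [fac, List.take_add, List.drop_drop]

theorem drop_eq_fac_append (s : List α) (i l : ℕ) : s.drop i = fac s i l ++ s.drop (i + l) := by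
  rw [fac, ← List.drop_drop, List.take_append_drop]

theorem getElem?_fac (s : List α) {i l k : ℕ} (h : k < l) : (fac s i l)[k]? = s[i + k]? := by
  simp [fac, h]

theorem length_le_of_mismatch {s c w : List α} {i j k l : ℕ} (hc : c <+: fac s i l ++ w)
    (hc' : c <+: s.drop j) (hk : k < l) (hl : i + l ≤ s.length) (h : s[i + k]? ≠ s[j + k]?) :
    c.length ≤ k := by
  by_contra hlt
  push Not at hlt
  apply h
  obtain ⟨d, hd⟩ := hc
  obtain ⟨d', hd'⟩ := hc'
  have h1 : (c ++ d)[k]? = s[i + k]? := by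
    rw [hd, List.getElem?_append_left (by rw [length_fac hl]; exact hk), getElem?_fac s hk]
  have h2 : (c ++ d')[k]? = s[j + k]? := by rw [hd', List.getElem?_drop]
  rw [List.getElem?_append_left hlt] at h1 h2
  rw [← h1, ← h2]

theorem getElem?_fac_append {s : List α} {i l : ℕ} (w : List α) (hl : 0 < l)
    (h : i + l ≤ s.length) : (fac s i l ++ w)[0]? = s[i]? := by
  rw [List.getElem?_append_left (by rw [length_fac h]; exact hl), getElem?_fac s hl, add_zero]

theorem eq_nil_of_head_ne {c w t : List α} (h : w[0]? ≠ t[0]?) (hw : c <+: w) (ht : c <+: t) :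
    c = [] := by
  obtain ⟨d, rfl⟩ := hw
  obtain ⟨d', rfl⟩ := ht
  cases c with
  | nil => rfl
  | cons a c => simp at h

/-- The word `w` is represented by a marked node of the trie. -/
def Trie.Mem (s : List α) : Trie → List α → Prop
  | .nil, _ => False
  | .edge start len marked child sibling, w =>
    (∃ w', w = fac s start len ++ w' ∧ ((w' = [] ∧ marked = true) ∨ Trie.Mem s child w')) ∨
      Trie.Mem s sibling w

/-- None of the edges leaving the node has a label beginning with the letter `c`. -/
def Trie.HeadNe (s : List α) (c : Option α) : Trie → Prop
  | .nil => True
  | .edge start _ _ _ sibling => s[start]? ≠ c ∧ Trie.HeadNe s c sibling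

/-- Edge labels are nonempty factors of `s`; labels of sibling edges begin with distinct letters. -/
def Trie.WF (s : List α) : Trie → Prop
  | .nil => True
  | .edge start len _ child sibling =>
    0 < len ∧ start + len ≤ s.length ∧ Trie.WF s child ∧ Trie.WF s sibling ∧
      Trie.HeadNe s s[start]? sibling

theorem Trie.HeadNe.ne {s : List α} {c : Option α} {T : Trie} (h : T.HeadNe s c) (hT : T.WF s)
    {w : List α} (hw : T.Mem s w) : w[0]? ≠ c := by
  induction T with
  | nil => exact hw.elim
  | edge start len marked child sibling _ ih =>
    obtain ⟨hlen, hs, -, hsib, -⟩ := hT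
    rcases hw with ⟨w', rfl, -⟩ | hw
    · rw [getElem?_fac_append w' hlen hs]; exact h.1
    · exact ih h.2 hsib hw

theorem Trie.Mem.ne_nil {s : List α} {T : Trie} (hT : T.WF s) {w : List α} (hw : T.Mem s w) :
    w ≠ [] := by
  induction T with
  | nil => exact hw.elim
  | edge start len marked child sibling _ ih =>
    obtain ⟨hlen, hs, -, hsib, -⟩ := hT
    rcases hw with ⟨w', rfl, -⟩ | hw
    · intro h
      have := congrArg List.length h
      rw [List.length_append, length_fac hs] at this
      simp at this
      omega
    · exact ih hsib hw

variable [DecidableEq α]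

theorem matchLen_le (s : List α) (i j l : ℕ) : matchLen s i j l ≤ l := by
  induction l generalizing i j with
  | zero => simp [matchLen]
  | succ l ih => simp only [matchLen]; split_ifs <;> simp [ih]

theorem fac_matchLen (s : List α) (i j l : ℕ) :
    fac s i (matchLen s i j l) = fac s j (matchLen s i j l) := by
  induction l generalizing i j with
  | zero => simp [matchLen, fac_zero]
  | succ l ih =>
    simp only [matchLen]
    split_ifs with h
    · rw [fac_succ, fac_succ, h, ih]
    · simp [fac_zero]

theorem matchLen_mismatch (s : List α) (i j l : ℕ) (h : matchLen s i j l < l) :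
    s[i + matchLen s i j l]? ≠ s[j + matchLen s i j l]? := by
  induction l generalizing i j with
  | zero => simp at h
  | succ l ih =>
    simp only [matchLen] at h ⊢
    split_ifs with h' <;> simp only [h', if_true, if_false] at h
    · have := ih (i + 1) (j + 1) (by omega)
      rwa [Nat.add_right_comm i, Nat.add_right_comm j, Nat.add_assoc i, Nat.add_assoc j] at this
    · simpa using h'

theorem Trie.insert_headNe {s : List α} {c : Option α} {T : Trie} {pos e : ℕ}
    (h : T.HeadNe s c) (hc : s[pos]? ≠ c) : (T.insert s pos e).1.HeadNe s c := by
  induction T with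
  | nil => exact ⟨hc, trivial⟩
  | edge start len marked child sibling _ ih =>
    simp only [Trie.insert]
    split_ifs
    · exact ⟨h.1, ih h.2⟩
    all_goals exact ⟨h.1, h.2⟩

/-- The five cases are: first letters differ; the word ends inside the label; word and label diverge
inside the label; the word ends at the node; the word continues below it. In each, splitting the
label at `k` rewrites both sides of the membership statement into the same factors. -/
theorem Trie.insert_spec {s : List α} {T : Trie} (hT : T.WF s) {pos e : ℕ} (hpos : pos < e)
    (he : e ≤ s.length) :
    (T.insert s pos e).1.WF s ∧
      ∀ w, (T.insert s pos e).1.Mem s w ↔ T.Mem s w ∨ w = fac s pos (e - pos) := by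
  induction T generalizing pos with
  | nil =>
    refine ⟨⟨by omega, by omega, trivial, trivial, trivial⟩, fun w => ?_⟩
    simp [Trie.insert, Trie.Mem]
  | edge start len marked child sibling ihc ihs =>
    obtain ⟨hlen, hs, hchild, hsib, hne⟩ := hT
    set k := matchLen s start pos (min len (e - pos)) with hk
    have hkle : k ≤ min len (e - pos) := matchLen_le _ _ _ _
    have hfac : fac s start k = fac s pos k := fac_matchLen _ _ _ _
    have hmis : k < min len (e - pos) → s[start + k]? ≠ s[pos + k]? := matchLen_mismatch _ _ _ _
    simp only [Trie.insert, ← hk]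
    split_ifs with h0 h1 h2 h3
    · obtain ⟨h1, h2⟩ := ihs hsib hpos
      have hm : s[start]? ≠ s[pos]? := by simpa [h0] using hmis (by omega)
      refine ⟨⟨hlen, hs, hchild, h1, Trie.insert_headNe hne hm.symm⟩, fun w => ?_⟩
      simp only [Trie.Mem, h2, or_assoc]
    · refine ⟨⟨by omega, by omega, ⟨by omega, by omega, hchild, trivial, trivial⟩, hsib, hne⟩,
        fun w => ?_⟩
      have hp : fac s pos (e - pos) = fac s start k := by rw [hfac]; congr 1; omega
      have hl : fac s start len = fac s start k ++ fac s (start + k) (len - k) := by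
        rw [← fac_add]; congr 1; omega
      simp only [Trie.Mem, hp, hl, or_false, and_true, List.append_assoc]
      constructor
      · rintro (⟨w', rfl, rfl | ⟨w'', rfl, h⟩⟩ | h)
        · right; simp
        · exact Or.inl (Or.inl ⟨w'', rfl, h⟩)
        · exact Or.inl (Or.inr h)
      · rintro ((⟨w', rfl, h⟩ | h) | rfl)
        · exact Or.inl ⟨_, rfl, Or.inr ⟨w', rfl, h⟩⟩
        · exact Or.inr h
        · exact Or.inl ⟨[], by simp, Or.inl rfl⟩
    -- The letters at which label and word diverge become the first letters of the two sibling
    -- edges, so the mismatch is exactly what well-formedness requires.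
    · have hm := hmis (by omega)
      refine ⟨⟨by omega, by omega, ⟨by omega, by omega, hchild,
        ⟨by omega, by omega, trivial, trivial, trivial⟩, ?_, trivial⟩, hsib, hne⟩, fun w => ?_⟩
      · exact hm.symm
      have hp : fac s pos (e - pos) = fac s start k ++ fac s (pos + k) (e - pos - k) := by
        rw [hfac, ← fac_add]; congr 1; omega
      have hl : fac s start len = fac s start k ++ fac s (start + k) (len - k) := by
        rw [← fac_add]; congr 1; omega
      simp only [Trie.Mem, hp, hl, or_false, and_true, List.append_assoc, Bool.false_eq_true,
        and_false, false_or]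
      constructor
      · rintro (⟨w', rfl, ⟨w'', rfl, h⟩ | ⟨w'', rfl, rfl⟩⟩ | h)
        · exact Or.inl (Or.inl ⟨w'', rfl, h⟩)
        · right; simp
        · exact Or.inl (Or.inr h)
      · rintro ((⟨w', rfl, h⟩ | h) | rfl)
        · exact Or.inl ⟨_, rfl, Or.inl ⟨w', rfl, h⟩⟩
        · exact Or.inr h
        · exact Or.inl ⟨_, rfl, Or.inr ⟨[], by simp, rfl⟩⟩
    · refine ⟨⟨hlen, hs, hchild, hsib, hne⟩, fun w => ?_⟩
      have hp : fac s pos (e - pos) = fac s start len := by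
        rw [show len = k by omega, hfac]; congr 1; omega
      simp only [Trie.Mem, hp, and_true]
      constructor
      · rintro (⟨w', rfl, rfl | h⟩ | h)
        · right; simp
        · exact Or.inl (Or.inl ⟨w', rfl, Or.inr h⟩)
        · exact Or.inl (Or.inr h)
      · rintro ((⟨w', rfl, ⟨rfl, -⟩ | h⟩ | h) | rfl)
        · exact Or.inl ⟨[], rfl, Or.inl rfl⟩
        · exact Or.inl ⟨w', rfl, Or.inr h⟩
        · exact Or.inr h
        · exact Or.inl ⟨[], by simp, Or.inl rfl⟩
    · have hkl : k = len := by omega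
      obtain ⟨h1, h2⟩ := ihc hchild (pos := pos + len) (by omega)
      refine ⟨⟨hlen, hs, h1, hsib, hne⟩, fun w => ?_⟩
      have hp : fac s pos (e - pos) = fac s start len ++ fac s (pos + len) (e - (pos + len)) := by
        rw [← hkl, hfac, ← fac_add]; congr 1; omega
      simp only [Trie.Mem, hp, h2]
      constructor
      · rintro (⟨w', rfl, h | h | rfl⟩ | h)
        · exact Or.inl (Or.inl ⟨w', rfl, Or.inl h⟩)
        · exact Or.inl (Or.inl ⟨w', rfl, Or.inr h⟩)
        · exact Or.inr rfl
        · exact Or.inl (Or.inr h)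
      · rintro ((⟨w', rfl, h | h⟩ | h) | rfl)
        · exact Or.inl ⟨w', rfl, Or.inl h⟩
        · exact Or.inl ⟨w', rfl, Or.inr (Or.inl h)⟩
        · exact Or.inr h
        · exact Or.inl ⟨_, rfl, Or.inr (Or.inr rfl)⟩

/-- Siblings begin with distinct letters, so at most one edge can be followed and the descent is
forced. The third part is the source of all lower bounds on time: the search reads any common prefix
`c` of a marked word and the text, even if it returns something much shorter. -/
theorem Trie.search_spec {s : List α} {T : Trie} (hT : T.WF s) (pos : ℕ) :
    ((T.search s pos s.length).1 ≠ 0 → ∃ w, T.Mem s w ∧ w <+: s.drop pos ∧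
        w.length = (T.search s pos s.length).1) ∧
      (∀ w, T.Mem s w → w <+: s.drop pos → w.length ≤ (T.search s pos s.length).1) ∧
      (∀ w c, T.Mem s w → c <+: w → c <+: s.drop pos →
        c.length ≤ (T.search s pos s.length).2) := by
  induction T generalizing pos with
  | nil => simp [Trie.search, Trie.Mem]
  | edge start len marked child sibling ihc ihs =>
    have hTWF := hT
    obtain ⟨hlen, hs, hchild, hsib, hne⟩ := hT
    set k := matchLen s start pos (min len (s.length - pos)) with hk
    have hkle : k ≤ min len (s.length - pos) := matchLen_le _ _ _ _
    have hfac : fac s start k = fac s pos k := fac_matchLen _ _ _ _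
    have hmis : k < min len (s.length - pos) → s[start + k]? ≠ s[pos + k]? :=
      matchLen_mismatch _ _ _ _
    simp only [Trie.search, ← hk]
    by_cases hend : s.length ≤ pos
    · rw [if_pos hend, List.drop_eq_nil_of_le hend]
      refine ⟨by simp, fun w hw h => ?_, fun w c _ _ h => ?_⟩
      · rw [List.prefix_nil.1 h]; simp
      · rw [List.prefix_nil.1 h]; simp
    rw [if_neg hend]
    by_cases h0 : k = 0
    · rw [if_pos h0]
      obtain ⟨i1, i2, i3⟩ := ihs hsib pos
      have hm : s[start]? ≠ s[pos]? := by simpa [h0] using hmis (by omega)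
      have key : ∀ w' c, c <+: fac s start len ++ w' → c <+: s.drop pos → c = [] := by
        intro w' c h1 h2
        refine eq_nil_of_head_ne ?_ h1 h2
        rw [getElem?_fac_append w' hlen hs, List.getElem?_drop, add_zero]
        exact hm
      refine ⟨fun h => ?_, ?_, ?_⟩
      · obtain ⟨w, hw, h2⟩ := i1 h
        exact ⟨w, Or.inr hw, h2⟩
      · rintro w (⟨w', rfl, -⟩ | hw) h
        · rw [key w' _ List.prefix_rfl h]; simp
        · exact i2 w hw h
      · rintro w c (⟨w', rfl, -⟩ | hw) h h'
        · rw [key w' _ h h']; simp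
        · exact (i3 w c hw h h').trans (Nat.le_succ _)
    rw [if_neg h0]
    by_cases h1 : k < len
    · rw [if_pos h1]
      -- The comparison stops inside the label, by a mismatch or at the end of the text. Words
      -- through this edge share at most `k` letters with the text, and words through siblings share
      -- none because their first letters differ.
      have key : ∀ w c, (Trie.edge start len marked child sibling).Mem s w → c <+: w →
          c <+: s.drop pos → c.length ≤ k := by
        rintro w c (⟨w', rfl, -⟩ | hw) h h'
        · rcases lt_or_ge k (s.length - pos) with h2 | h2
          · exact length_le_of_mismatch h h' h1 hs (hmis (by omega))
          · exact h'.length_le.trans (by simp; omega)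
        · have hsp : s[start]? = s[pos]? := by
            have := congrArg (fun l => l[0]?) hfac
            simpa [getElem?_fac s (Nat.pos_of_ne_zero h0)] using this
          rw [eq_nil_of_head_ne (t := s.drop pos) _ h h']
          · simp
          · rw [List.getElem?_drop, add_zero, ← hsp]
            exact hne.ne hsib hw
      refine ⟨by simp, fun w hw h => ?_, fun w c hw h h' => (key w c hw h h').trans (Nat.le_succ _)⟩
      have h2 := key w w hw List.prefix_rfl h
      rcases hw with ⟨w', rfl, -⟩ | hw
      · rw [List.length_append, length_fac hs] at h2; omega
      · have hsp : s[start]? = s[pos]? := by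
            have := congrArg (fun l => l[0]?) hfac
            simpa [getElem?_fac s (Nat.pos_of_ne_zero h0)] using this
        rw [eq_nil_of_head_ne (t := s.drop pos) _ List.prefix_rfl h]
        · simp
        · rw [List.getElem?_drop, add_zero, ← hsp]
          exact hne.ne hsib hw
    · rw [if_neg h1]
      have hkl : k = len := by omega
      obtain ⟨i1, i2, i3⟩ := ihc hchild (pos + len)
      have hdrop : s.drop pos = fac s start len ++ s.drop (pos + len) := by
        rw [← hkl, hfac, ← drop_eq_fac_append]
      have hsp : s[start]? = s[pos]? := by
        have := congrArg (fun l => l[0]?) hfac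
        simpa [getElem?_fac s (Nat.pos_of_ne_zero h0)] using this
      have hsibnil : ∀ w c, sibling.Mem s w → c <+: w → c <+: s.drop pos → c = [] := by
        intro w c hw h h'
        refine eq_nil_of_head_ne ?_ h h'
        rw [List.getElem?_drop, add_zero, ← hsp]
        exact hne.ne hsib hw
      have hfl := length_fac hs
      refine ⟨fun h => ?_, ?_, ?_⟩
      · dsimp only at h ⊢
        split_ifs at h ⊢ with h2 h3
        · obtain ⟨w, hw, hw2, hw3⟩ := i1 (by omega)
          refine ⟨_, Or.inl ⟨w, rfl, Or.inr hw⟩, ?_, ?_⟩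
          · rw [hdrop]; exact (List.prefix_append_right_inj _).2 hw2
          · rw [List.length_append, hfl, hw3]
        · refine ⟨_, Or.inl ⟨[], rfl, Or.inl ⟨rfl, h3⟩⟩, ?_, ?_⟩
          · rw [hdrop, List.append_nil]; exact List.prefix_append _ _
          · simp [hfl]
        · exact absurd rfl h
      · rintro w (⟨w', rfl, hw'⟩ | hw) h
        · rw [hdrop, List.prefix_append_right_inj] at h
          rw [List.length_append, hfl]
          dsimp only
          rcases hw' with ⟨rfl, hmk⟩ | hw'
          · simp only [hmk, if_true, List.length_nil]
            split_ifs <;> omega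
          -- Depth `0` means that nothing marked was found. Words represented below the node are
          -- nonempty, so this value is unambiguous and the deeper result takes precedence over the
          -- mark of the node itself.
          · have := i2 w' hw' h
            have hpos : 0 < w'.length := List.length_pos_iff.2 (hw'.ne_nil hchild)
            rw [if_pos (by omega)]; omega
        · rw [hsibnil w w hw List.prefix_rfl h]; simp
      · rintro w c (⟨w', rfl, hw'⟩ | hw) h h'
        · dsimp only
          rcases Nat.lt_or_ge c.length len with hl | hl
          · omega
          · have hc : fac s start len <+: c := by
              refine List.prefix_of_prefix_length_le (List.prefix_append _ w') h (by rw [hfl]; exact hl)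
            obtain ⟨c', rfl⟩ := hc
            rw [List.prefix_append_right_inj] at h
            rw [hdrop, List.prefix_append_right_inj] at h'
            rw [List.length_append, hfl]
            have : c'.length ≤ (child.search s (pos + len) s.length).2 := by
              rcases hw' with ⟨rfl, -⟩ | hw'
              · rw [List.prefix_nil.1 h]; simp
              · exact i3 w' c' hw' h h'
            omega
        · rw [hsibnil w c hw h h']; simp

end TrieSpec

/-! ### Single rounds of the algorithms, with the dictionary bounded from both sides -/

section Steps

set_option linter.unusedSectionVars false

variable {α : Type*} [DecidableEq α]

theorem findElement_spec {s : List α} {T : Trie} (hT : T.WF s) {pos : ℕ} {p : List α}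
    (hp : p ≠ []) (hpre : p <+: s.drop pos) (hmem : p.length = 1 ∨ T.Mem s p)
    (hmax : ∀ w, T.Mem s w → w <+: s.drop pos → w.length ≤ p.length) :
    (findElement s T pos).1.WF s ∧ (findElement s T pos).2.1 = p.length ∧
      (∀ w, T.Mem s w → (findElement s T pos).1.Mem s w) ∧
      (∀ w, (findElement s T pos).1.Mem s w → w.length = 1 ∨ T.Mem s w) ∧
      (∀ w c, T.Mem s w → c <+: w → c <+: s.drop pos →
        c.length ≤ (findElement s T pos).2.2) := by
  have hpos : 0 < p.length := List.length_pos_iff.2 hp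
  have hlt : pos < s.length := by
    have := hpre.length_le
    rw [List.length_drop] at this
    omega
  obtain ⟨h1, h2, h3⟩ := T.search_spec hT pos
  unfold findElement
  rw [if_neg (by omega)]
  by_cases h0 : (T.search s pos s.length).1 = 0
  · simp only [h0, if_true]
    obtain ⟨i1, i2⟩ := T.insert_spec hT (Nat.lt_succ_self pos) (show pos + 1 ≤ s.length by omega)
    refine ⟨i1, ?_, fun w hw => (i2 w).2 (Or.inl hw), fun w hw => ?_, fun w c hw h h' => ?_⟩
    · rcases hmem with h | h
      · exact h.symm
      · have := h2 p h hpre; omega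
    · rcases (i2 w).1 hw with h | rfl
      · exact Or.inr h
      · left; rw [length_fac (by omega)]; omega
    · exact (h3 w c hw h h').trans (Nat.le_add_right _ _)
  · simp only [h0, if_false]
    refine ⟨hT, ?_, fun w hw => hw, fun w hw => Or.inr hw, h3⟩
    obtain ⟨w, hw, hw2, hw3⟩ := h1 h0
    have := hmax w hw hw2
    rcases hmem with h | h
    · omega
    · have := h2 p h hpre; omega

/-- The trie is well formed, every word of `Lo` is a letter or marked, every marked word is a letter
or belongs to `Up`. -/
def Trie.Between (s : List α) (T : Trie) (Lo Up : List α → Prop) : Prop :=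
  T.WF s ∧ (∀ w, Lo w → w.length = 1 ∨ T.Mem s w) ∧ (∀ w, T.Mem s w → w.length = 1 ∨ Up w)

/-- No word of `D` that is a prefix of `t` is longer than `p`. -/
def Greedy (D : List α → Prop) (t p : List α) : Prop :=
  ∀ w, D w → w <+: t → w.length ≤ p.length

/-- The lower bound makes `p` available and the upper bound excludes anything longer, so the exact
dictionary need not be known. Words of length one can be ignored on both sides: a single letter is
returned whether or not it is already in the trie. -/
theorem Trie.Between.find {s : List α} {T : Trie} {Lo Up : List α → Prop} (hT : T.Between s Lo Up)
    {pos : ℕ} {p : List α} (hp : p ≠ []) (hpre : p <+: s.drop pos)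
    (hmem : p.length = 1 ∨ Lo p) (hmax : Greedy Up (s.drop pos) p) :
    (findElement s T pos).1.Between s Lo Up ∧ (findElement s T pos).2.1 = p.length ∧
      (∀ w c, Lo w → 2 ≤ w.length → c <+: w → c <+: s.drop pos →
        c.length ≤ (findElement s T pos).2.2) := by
  obtain ⟨hWF, hLo, hUp⟩ := hT
  have hpos : 0 < p.length := List.length_pos_iff.2 hp
  obtain ⟨h1, h2, h3, h4, h5⟩ := findElement_spec hWF hp hpre
    (hmem.elim Or.inl (hLo p)) (fun w hw h => (hUp w hw).elim (fun h => by omega) (hmax w · h))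
  refine ⟨⟨h1, fun w hw => (hLo w hw).imp_right (h3 w), fun w hw => ?_⟩, h2,
    fun w c hw hl => h5 w c ((hLo w hw).resolve_left (by omega))⟩
  exact (h4 w hw).elim Or.inl (hUp w)

theorem Trie.Between.insert {s : List α} {T : Trie} {Lo Up : List α → Prop}
    (hT : T.Between s Lo Up) {pos : ℕ} {p : List α} (hp : p ≠ []) (hpre : p <+: s.drop pos) :
    (T.insert s pos (pos + p.length)).1.Between s (fun w => Lo w ∨ w = p)
      (fun w => Up w ∨ w = p) := by
  obtain ⟨hWF, hLo, hUp⟩ := hT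
  have hpos : 0 < p.length := List.length_pos_iff.2 hp
  have hle := hpre.length_le
  rw [List.length_drop] at hle
  obtain ⟨h1, h2⟩ := T.insert_spec hWF (show pos < pos + p.length by omega)
    (show pos + p.length ≤ s.length by omega)
  have hfac : fac s pos (pos + p.length - pos) = p := by
    rw [fac, Nat.add_sub_cancel_left]; exact (List.prefix_iff_eq_take.1 hpre).symm
  rw [hfac] at h2
  refine ⟨h1, fun w hw => ?_, fun w hw => ?_⟩
  · rcases hw with hw | rfl
    · exact (hLo w hw).imp_right fun h => (h2 w).2 (Or.inl h)
    · exact Or.inr ((h2 _).2 (Or.inr rfl))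
  · rcases (h2 w).1 hw with h | rfl
    · exact (hUp w h).imp_right Or.inl
    · exact Or.inr (Or.inr rfl)

/-- The state `σ` of the LZD algorithm on `s`: it remains to parse `rest`, the dictionary lies between
`Lo` and `Up` up to letters, and the time used is at least `τ`. -/
structure LZDState (s : List α) (σ : State) (rest : List α) (Lo Up : List α → Prop) (τ : ℕ) :
    Prop where
  between : σ.trie.Between s Lo Up
  drop_pos : s.drop σ.pos = rest
  le_time : τ ≤ σ.time

theorem pos_lt_of_drop {s u v : List α} {i : ℕ} (hu : u ≠ []) (h : s.drop i = u ++ v) :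
    i < s.length := by
  by_contra hle
  rw [List.drop_eq_nil_of_le (by omega)] at h
  exact hu (List.append_eq_nil_iff.1 h.symm).1

theorem LZDState.step {s : List α} {σ : State} {u v rest : List α} {Lo Up : List α → Prop}
    {τ κ : ℕ} (h : LZDState s σ (u ++ (v ++ rest)) Lo Up τ) (hu : u ≠ []) (hv : v ≠ [])
    (hu' : u.length = 1 ∨ Lo u) (hv' : v.length = 1 ∨ Lo v)
    (hgu : Greedy Up (u ++ (v ++ rest)) u) (hgv : Greedy Up (v ++ rest) v)
    (hκ : κ = 0 ∨ ∃ w c, Lo w ∧ 2 ≤ w.length ∧ c <+: w ∧ c <+: v ++ rest ∧ κ ≤ c.length) :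
    LZDState s (lzdStep s σ) rest (fun w => Lo w ∨ w = u ++ v) (fun w => Up w ∨ w = u ++ v)
      (τ + κ) := by
  obtain ⟨hT, hd, hτ⟩ := h
  have hlt := pos_lt_of_drop hu hd
  have hd2 : s.drop (σ.pos + u.length) = v ++ rest := by
    rw [← List.drop_drop, hd, List.drop_left]
  have hd3 : s.drop (σ.pos + u.length + v.length) = rest := by
    rw [← List.drop_drop, hd2, List.drop_left]
  obtain ⟨a1, a2, -⟩ := hT.find hu (hd ▸ List.prefix_append _ _) hu' (hd ▸ hgu)
  obtain ⟨b1, b2, b3⟩ := a1.find (pos := σ.pos + u.length) hv (hd2 ▸ List.prefix_append _ _) hv'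
    (hd2 ▸ hgv)
  have c1 := b1.insert (pos := σ.pos) (p := u ++ v) (by simp [hu])
    (by rw [hd, ← List.append_assoc]; exact List.prefix_append _ _)
  rw [List.length_append, ← Nat.add_assoc] at c1
  unfold lzdStep
  rw [if_neg (by omega)]
  dsimp only
  rw [a2, b2]
  refine ⟨c1, hd3, ?_⟩
  -- Only the search for the second element is charged; the other costs are bounded below by `0`.
  have : κ ≤ (findElement s (findElement s σ.trie σ.pos).1 (σ.pos + u.length)).2.2 := by
    rcases hκ with rfl | ⟨w, c, hw, hw2, hcw, hc, hκ⟩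
    · exact Nat.zero_le _
    · exact hκ.trans (b3 w c hw hw2 hcw (hd2 ▸ hc))
  dsimp only
  omega

theorem LZDState.mono {s : List α} {σ : State} {rest : List α} {Lo Up Lo' Up' : List α → Prop}
    {τ τ' : ℕ} (h : LZDState s σ rest Lo Up τ) (hLo : ∀ w, Lo' w → Lo w)
    (hUp : ∀ w, Up w → Up' w) (hτ : τ' ≤ τ) : LZDState s σ rest Lo' Up' τ' :=
  ⟨⟨h.1.1, fun w hw => h.1.2.1 w (hLo w hw), fun w hw => (h.1.2.2 w hw).imp_right (hUp w)⟩, h.2,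
    hτ.trans h.3⟩

theorem LZDState.init (s : List α) : LZDState s State.init s (fun _ => False) (fun _ => False) 0 :=
  ⟨⟨trivial, fun _ h => h.elim, fun _ h => h.elim⟩, by simp [State.init], le_rfl⟩

/-- The state `σ` of the LZMW algorithm on `s`, after the phrase `prev`: it remains to parse `rest`, the
dictionary lies between `Lo` and `Up` up to letters, and the time used is at least `τ`. -/
structure LZMWState (s : List α) (σ : State) (prev rest : List α) (Lo Up : List α → Prop) (τ : ℕ) :
    Prop where
  between : σ.trie.Between s Lo Up
  drop_pos : s.drop σ.pos = rest
  le_time : τ ≤ σ.time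
  phrases : ∃ i l, σ.phrases = (i, prev.length) :: l ∧ i + prev.length = σ.pos ∧
    s.drop i = prev ++ rest

theorem LZMWState.step {s : List α} {σ : State} {prev u rest : List α} {Lo Up : List α → Prop}
    {τ κ : ℕ} (h : LZMWState s σ prev (u ++ rest) Lo Up τ) (hu : u ≠ [])
    (hu' : u.length = 1 ∨ Lo u) (hgu : Greedy Up (u ++ rest) u)
    (hκ : κ = 0 ∨ ∃ w c, Lo w ∧ 2 ≤ w.length ∧ c <+: w ∧ c <+: u ++ rest ∧ κ ≤ c.length) :
    LZMWState s (lzmwStep s σ) u rest (fun w => Lo w ∨ w = prev ++ u)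
      (fun w => Up w ∨ w = prev ++ u) (τ + κ) := by
  obtain ⟨hT, hd, hτ, i, l, hp, hi, hdi⟩ := h
  have hlt := pos_lt_of_drop hu hd
  have hd2 : s.drop (σ.pos + u.length) = rest := by
    rw [← List.drop_drop, hd, List.drop_left]
  obtain ⟨a1, a2, a3⟩ := hT.find hu (hd ▸ List.prefix_append _ _) hu' (hd ▸ hgu)
  have c1 := a1.insert (pos := i) (p := prev ++ u) (by simp [hu])
    (by rw [hdi, ← List.append_assoc]; exact List.prefix_append _ _)
  rw [List.length_append, ← Nat.add_assoc, hi] at c1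
  unfold lzmwStep
  rw [if_neg (by omega)]
  dsimp only
  rw [hp, a2]
  refine ⟨c1, hd2, ?_, σ.pos, _, rfl, rfl, hd⟩
  have : κ ≤ (findElement s σ.trie σ.pos).2.2 := by
    rcases hκ with rfl | ⟨w, c, hw, hw2, hcw, hc, hκ⟩
    · exact Nat.zero_le _
    · exact hκ.trans (a3 w c hw hw2 hcw (hd ▸ hc))
  dsimp only
  omega

theorem LZMWState.mono {s : List α} {σ : State} {prev rest : List α}
    {Lo Up Lo' Up' : List α → Prop} {τ τ' : ℕ} (h : LZMWState s σ prev rest Lo Up τ)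
    (hLo : ∀ w, Lo' w → Lo w) (hUp : ∀ w, Up w → Up' w) (hτ : τ' ≤ τ) :
    LZMWState s σ prev rest Lo' Up' τ' :=
  ⟨⟨h.1.1, fun w hw => h.1.2.1 w (hLo w hw), fun w hw => (h.1.2.2 w hw).imp_right (hUp w)⟩, h.2,
    hτ.trans h.3, h.4⟩

theorem LZMWState.first (a : α) (rest : List α) :
    LZMWState (a :: rest) (lzmwStep (a :: rest) State.init) [a] rest (fun _ => False)
      (fun _ => False) 0 := by
  have hT : (State.init.trie).Between (a :: rest) (fun _ => False) (fun _ => False) :=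
    ⟨trivial, fun _ h => h.elim, fun _ h => h.elim⟩
  obtain ⟨a1, a2, -⟩ := hT.find (pos := 0) (p := [a]) (by simp) (by simp) (Or.inl rfl)
    (fun _ h => h.elim)
  unfold lzmwStep
  rw [if_neg (by simp [State.init])]
  dsimp only
  rw [show State.init.phrases = [] from rfl, show State.init.pos = 0 from rfl, a2]
  exact ⟨a1, by simp, Nat.zero_le _, 0, [], by simp, by simp, by simp⟩

theorem findElement_pos (s : List α) (T : Trie) {pos : ℕ} (h : pos < s.length) :
    0 < (findElement s T pos).2.1 := by
  unfold findElement
  rw [if_neg (by omega)]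
  by_cases h0 : (T.search s pos s.length).1 = 0
  · simp [h0]
  · simp only [h0, if_false]; omega

/-- Each round advances by a letter until the end is reached, so after `s.length` rounds the state
is fixed. As time never decreases, the time seen after any number of rounds bounds the final time
from below. -/
theorem time_le_of_progress {s : List α} {f : State → State} (hle : ∀ σ, σ.time ≤ (f σ).time)
    (hfix : ∀ σ, s.length ≤ σ.pos → f σ = σ) (hprog : ∀ σ, σ.pos < s.length → σ.pos < (f σ).pos)
    (n : ℕ) : (f^[n] State.init).time ≤ (f^[s.length] State.init).time := by
  have mono : Monotone fun n => (f^[n] State.init).time :=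
    monotone_nat_of_le_succ fun n => by
      simp only [Function.iterate_succ_apply']
      exact hle _
  rcases le_total n s.length with h | h
  · exact mono h
  · have hpos : ∀ i, i ≤ s.length → i ≤ (f^[i] State.init).pos := by
      intro i
      induction i with
      | zero => simp
      | succ i ih =>
        intro hi
        have hi' := ih (by omega)
        rw [Function.iterate_succ_apply']
        rcases lt_or_ge (f^[i] State.init).pos s.length with h | h
        · have := hprog _ h; omega
        · rw [hfix _ h]; omega
    obtain ⟨m, rfl⟩ := Nat.exists_eq_add_of_le' h
    rw [Function.iterate_add_apply, Function.iterate_fixed (hfix _ (hpos _ le_rfl))]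

theorem lzd_time_le (s : List α) (n : ℕ) : ((lzdStep s)^[n] State.init).time ≤ lzdTime s := by
  refine time_le_of_progress (fun σ => ?_) (fun σ h => ?_) (fun σ h => ?_) n
  · unfold lzdStep; split_ifs
    · rfl
    · dsimp only; omega
  · simp [lzdStep, h]
  · have := findElement_pos s σ.trie h
    unfold lzdStep; rw [if_neg (by omega)]; dsimp only; omega

theorem lzmw_time_le (s : List α) (n : ℕ) : ((lzmwStep s)^[n] State.init).time ≤ lzmwTime s := by
  refine time_le_of_progress (fun σ => ?_) (fun σ h => ?_) (fun σ h => ?_) n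
  · unfold lzmwStep; split_ifs
    · rfl
    · cases σ.phrases <;> dsimp only <;> omega
  · simp [lzmwStep, h]
  · have := findElement_pos s σ.trie h
    unfold lzmwStep; rw [if_neg (by omega)]
    cases σ.phrases <;> dsimp only <;> omega

end Steps

/-! ### Unary codes for letters -/

/-- The code `0 ^ i 1` of the letter `i`, extended to words. -/
def code (t : List ℕ) : List Bool := t.flatMap fun i => List.replicate i false ++ [true]

theorem code_nil : code [] = [] := rfl

theorem code_cons (i : ℕ) (t : List ℕ) :
    code (i :: t) = List.replicate i false ++ true :: code t := by
  simp [code]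

theorem code_append (t u : List ℕ) : code (t ++ u) = code t ++ code u := by
  simp [code]

theorem replicate_prefix_iff {i j : ℕ} {a b : List Bool} :
    List.replicate i false ++ true :: a <+: List.replicate j false ++ true :: b ↔
      i = j ∧ a <+: b := by
  induction i generalizing j with
  | zero =>
    cases j with
    | zero => simp
    | succ j => simp [List.replicate_succ, List.cons_prefix_cons]
  | succ i ih =>
    cases j with
    | zero => simp [List.replicate_succ, List.cons_prefix_cons]
    | succ j =>
      simp only [List.replicate_succ, List.cons_append, List.cons_prefix_cons, true_and, ih,
        Nat.add_right_cancel_iff]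

/-- No codeword is a prefix of another one. This equivalence transfers greediness from letters to
bits. -/
theorem code_prefix_iff {w t : List ℕ} : code w <+: code t ↔ w <+: t := by
  induction w generalizing t with
  | nil => simp [code_nil]
  | cons i w ih =>
    cases t with
    | nil => simp [code_cons, code_nil]
    | cons j t => rw [code_cons, code_cons, replicate_prefix_iff, ih, List.cons_prefix_cons]

theorem code_ne_nil {w : List ℕ} (hw : w ≠ []) : code w ≠ [] := by
  cases w with
  | nil => exact absurd rfl hw
  | cons i w => simp [code_cons]

theorem length_code_le {w : List ℕ} {b : ℕ} (h : ∀ i ∈ w, i ≤ b) :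
    (code w).length ≤ w.length * (b + 1) := by
  induction w with
  | nil => simp [code_nil]
  | cons i w ih =>
    have := ih fun j hj => h j (List.mem_cons_of_mem _ hj)
    have hi := h i List.mem_cons_self
    rw [code_cons, List.length_append, List.length_replicate, List.length_cons, List.length_cons,
      Nat.add_mul]
    omega

theorem le_length_code {w : List ℕ} {b : ℕ} (h : ∀ i ∈ w, b ≤ i) :
    w.length * b ≤ (code w).length := by
  induction w with
  | nil => simp
  | cons i w ih =>
    have := ih fun j hj => h j (List.mem_cons_of_mem _ hj)
    have hi := h i List.mem_cons_self
    rw [code_cons, List.length_append, List.length_replicate, List.length_cons, List.length_cons,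
      Nat.add_mul]
    omega

theorem two_le_length_code {w : List ℕ} (hw : 2 ≤ w.length) : 2 ≤ (code w).length := by
  match w, hw with
  | i :: j :: w, _ => simp [code_cons]; omega

/-- A binary word of length at least two that never occurs at the boundary of two codes of positive
letters. -/
def Junk (x : List Bool) : Prop := ∀ t : List ℕ, (∀ i ∈ t, 1 ≤ i) → x <+: code t → x.length ≤ 1

/-- The codes of the words in `D`. -/
def Coded (D : List ℕ → Prop) (x : List Bool) : Prop := ∃ w, D w ∧ x = code w

/-- Junk words match at most one bit at the boundary of codes of positive letters, and coded words
compete exactly as they do over the letters. From here on the parsing can be studied over the large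
alphabet. -/
theorem Greedy.code {D : List ℕ → Prop} {p t : List ℕ} (hp : p ≠ []) (ht : ∀ i ∈ p ++ t, 1 ≤ i)
    (h : Greedy D (p ++ t) p) :
    Greedy (fun x => Junk x ∨ Coded D x) (code p ++ code t) (code p) := by
  rintro x (hx | ⟨w, hw, rfl⟩) hpre
  · rw [← code_append] at hpre
    exact (hx _ ht hpre).trans (List.length_pos_iff.2 (code_ne_nil hp))
  · rw [← code_append, code_prefix_iff] at hpre
    exact (code_prefix_iff.2 (List.prefix_of_prefix_length_le hpre (List.prefix_append _ _)
      (h w hw hpre))).length_le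

/-- The LZD algorithm on `s` reaches a position where the code of `rest` remains to be parsed, with a
dictionary that contains the codes of `Lo` and whose relevant words are codes of words in `Up`, after
at least `τ` units of time. -/
def LZDReach (s : List Bool) (rest : List ℕ) (Lo Up : List ℕ → Prop) (τ : ℕ) : Prop :=
  (∀ i ∈ rest, 1 ≤ i) ∧ ∃ n, LZDState s ((lzdStep s)^[n] State.init) (code rest) (Coded Lo)
    (fun x => Junk x ∨ Coded Up x) τ

theorem LZDReach.step {s : List Bool} {u v rest : List ℕ} {Lo Up : List ℕ → Prop} {τ : ℕ}
    (κ : ℕ) (h : LZDReach s (u ++ (v ++ rest)) Lo Up τ) (hu : Lo u) (hv : Lo v) (hu0 : u ≠ [])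
    (hv0 : v ≠ []) (hgu : Greedy Up (u ++ (v ++ rest)) u) (hgv : Greedy Up (v ++ rest) v)
    (hκ : κ = 0 ∨ ∃ w c, Lo w ∧ 2 ≤ w.length ∧ c <+: w ∧ c <+: v ++ rest ∧ κ ≤ (code c).length) :
    LZDReach s rest (fun w => Lo w ∨ w = u ++ v) (fun w => Up w ∨ w = u ++ v) (τ + κ) := by
  obtain ⟨hpos, n, h⟩ := h
  have hpos2 : ∀ i ∈ v ++ rest, 1 ≤ i := fun i hi => hpos i (List.mem_append_right _ hi)
  refine ⟨fun i hi => hpos2 i (List.mem_append_right _ hi), n + 1, ?_⟩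
  rw [Function.iterate_succ_apply']
  rw [code_append, code_append] at h
  have hgu' := hgu.code hu0 hpos
  rw [code_append] at hgu'
  refine (h.step (κ := κ) (code_ne_nil hu0) (code_ne_nil hv0) (Or.inr ⟨u, hu, rfl⟩)
    (Or.inr ⟨v, hv, rfl⟩) hgu' (hgv.code hv0 hpos2) ?_).mono ?_ ?_ le_rfl
  · refine hκ.imp_right fun ⟨w, c, hw, hw2, hcw, hc, hκ⟩ =>
      ⟨code w, code c, ⟨w, hw, rfl⟩, two_le_length_code hw2, code_prefix_iff.2 hcw, ?_, hκ⟩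
    rw [← code_append, code_prefix_iff]; exact hc
  · rintro x ⟨w, hw | rfl, rfl⟩
    · exact Or.inl ⟨w, hw, rfl⟩
    · right; rw [code_append]
  · rintro x ((hx | ⟨w, hw, rfl⟩) | rfl)
    · exact Or.inl hx
    · exact Or.inr ⟨w, Or.inl hw, rfl⟩
    · exact Or.inr ⟨u ++ v, Or.inr rfl, (code_append _ _).symm⟩

theorem LZDReach.mono {s : List Bool} {rest : List ℕ} {Lo Up Lo' Up' : List ℕ → Prop} {τ τ' : ℕ}
    (h : LZDReach s rest Lo Up τ) (hLo : ∀ w, Lo' w → Lo w) (hUp : ∀ w, Up w → Up' w)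
    (hτ : τ' ≤ τ) : LZDReach s rest Lo' Up' τ' := by
  obtain ⟨hpos, n, h⟩ := h
  exact ⟨hpos, n, h.mono (fun x ⟨w, hw, e⟩ => ⟨w, hLo w hw, e⟩)
    (fun x hx => hx.imp_right fun ⟨w, hw, e⟩ => ⟨w, hUp w hw, e⟩) hτ⟩

theorem LZDReach.le_time {s : List Bool} {rest : List ℕ} {Lo Up : List ℕ → Prop} {τ : ℕ}
    (h : LZDReach s rest Lo Up τ) : τ ≤ lzdTime s := by
  obtain ⟨-, n, h⟩ := h
  exact h.le_time.trans (lzd_time_le s n)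

/-- The analogue of `LZDReach` for LZMW, with the previous phrase `prev`. -/
def LZMWReach (s : List Bool) (prev rest : List ℕ) (Lo Up : List ℕ → Prop) (τ : ℕ) : Prop :=
  (∀ i ∈ rest, 1 ≤ i) ∧ ∃ n, LZMWState s ((lzmwStep s)^[n] State.init) (code prev) (code rest)
    (Coded Lo) (fun x => Junk x ∨ Coded Up x) τ

theorem LZMWReach.step {s : List Bool} {prev u rest : List ℕ} {Lo Up : List ℕ → Prop} {τ : ℕ}
    (κ : ℕ) (h : LZMWReach s prev (u ++ rest) Lo Up τ) (hu : Lo u) (hu0 : u ≠ [])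
    (hgu : Greedy Up (u ++ rest) u)
    (hκ : κ = 0 ∨ ∃ w c, Lo w ∧ 2 ≤ w.length ∧ c <+: w ∧ c <+: u ++ rest ∧ κ ≤ (code c).length) :
    LZMWReach s u rest (fun w => Lo w ∨ w = prev ++ u) (fun w => Up w ∨ w = prev ++ u)
      (τ + κ) := by
  obtain ⟨hpos, n, h⟩ := h
  refine ⟨fun i hi => hpos i (List.mem_append_right _ hi), n + 1, ?_⟩
  rw [Function.iterate_succ_apply']
  rw [code_append] at h
  refine (h.step (κ := κ) (code_ne_nil hu0) (Or.inr ⟨u, hu, rfl⟩) (hgu.code hu0 hpos) ?_).mono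
    ?_ ?_ le_rfl
  · refine hκ.imp_right fun ⟨w, c, hw, hw2, hcw, hc, hκ⟩ =>
      ⟨code w, code c, ⟨w, hw, rfl⟩, two_le_length_code hw2, code_prefix_iff.2 hcw, ?_, hκ⟩
    rw [← code_append, code_prefix_iff]; exact hc
  · rintro x ⟨w, hw | rfl, rfl⟩
    · exact Or.inl ⟨w, hw, rfl⟩
    · right; rw [code_append]
  · rintro x ((hx | ⟨w, hw, rfl⟩) | rfl)
    · exact Or.inl hx
    · exact Or.inr ⟨w, Or.inl hw, rfl⟩
    · exact Or.inr ⟨prev ++ u, Or.inr rfl, (code_append _ _).symm⟩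

theorem LZMWReach.mono {s : List Bool} {prev rest : List ℕ} {Lo Up Lo' Up' : List ℕ → Prop}
    {τ τ' : ℕ} (h : LZMWReach s prev rest Lo Up τ) (hLo : ∀ w, Lo' w → Lo w)
    (hUp : ∀ w, Up w → Up' w) (hτ : τ' ≤ τ) : LZMWReach s prev rest Lo' Up' τ' := by
  obtain ⟨hpos, n, h⟩ := h
  exact ⟨hpos, n, h.mono (fun x ⟨w, hw, e⟩ => ⟨w, hLo w hw, e⟩)
    (fun x hx => hx.imp_right fun ⟨w, hw, e⟩ => ⟨w, hUp w hw, e⟩) hτ⟩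

theorem LZMWReach.le_time {s : List Bool} {prev rest : List ℕ} {Lo Up : List ℕ → Prop} {τ : ℕ}
    (h : LZMWReach s prev rest Lo Up τ) : τ ≤ lzmwTime s := by
  obtain ⟨-, n, h⟩ := h
  exact h.le_time.trans (lzmw_time_le s n)

/-! ### Creating the letters -/

/-- The letters `1, …, n`, as one-letter words. -/
def Letters (n : ℕ) (w : List ℕ) : Prop := ∃ i, 1 ≤ i ∧ i ≤ n ∧ w = [i]

/-- The code of `n + 1` is the bit `0` followed by the code of `n`, which is the phrase just
created. So the codes of `1, 2, …` written in a row are each one phrase. -/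
theorem lzd_letters_state (n : ℕ) (t : List ℕ) :
    LZDState (code (List.range' 1 n ++ t)) ((lzdStep (code (List.range' 1 n ++ t)))^[n] State.init)
      (code t) (Coded (Letters n)) (Coded (Letters n)) 0 := by
  induction n generalizing t with
  | zero =>
    refine (LZDState.init _).mono ?_ (fun _ h => h.elim) le_rfl
    rintro w ⟨_, ⟨i, hi⟩, _⟩; omega
  | succ n ih =>
    have h := ih ((n + 1) :: t)
    have e : List.range' 1 n ++ (n + 1) :: t = List.range' 1 (n + 1) ++ t := by
      rw [List.range'_concat]; simp [Nat.add_comm]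
    rw [e] at h
    rw [Function.iterate_succ_apply']
    generalize (lzdStep (code (List.range' 1 (n + 1) ++ t)))^[n] State.init = σ at h ⊢
    have e2 : code ((n + 1) :: t) = [false] ++ (code [n] ++ code t) := by
      simp [code_cons, code_nil, List.replicate_succ]
    have e3 : [false] ++ code [n] = code [n + 1] := by
      simp [code_cons, code_nil, List.replicate_succ]
    have hg : ∀ i, i ≤ n → ¬ code [i] <+: code ((n + 1) :: t) := by
      intro i hi h
      have := (List.cons_prefix_cons.1 (code_prefix_iff.1 h)).1
      omega
    rw [e2] at h hg
    refine (h.step (κ := 0) (by simp) (code_ne_nil (by simp)) (Or.inl rfl) ?_ ?_ ?_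
      (Or.inl rfl)).mono ?_ ?_ le_rfl
    -- The induction starts with the code of `0`, which is the single bit `1` and needs no
    -- dictionary entry.
    · rcases Nat.eq_zero_or_pos n with rfl | hn
      · exact Or.inl rfl
      · exact Or.inr ⟨[n], ⟨n, hn, le_rfl, rfl⟩, rfl⟩
    · rintro x ⟨_, ⟨i, -, hi, rfl⟩, rfl⟩ hx
      exact absurd hx (hg i hi)
    · rintro x ⟨_, ⟨i, -, hi, rfl⟩, rfl⟩ hx
      rw [← code_append, code_prefix_iff] at hx
      have := (List.cons_prefix_cons.1 hx).1
      rw [this]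
    · rintro x ⟨_, ⟨i, h1, hi, rfl⟩, rfl⟩
      rcases Nat.lt_or_ge n i with h | h
      · right; rw [e3]; congr 2; omega
      · exact Or.inl ⟨[i], ⟨i, h1, h, rfl⟩, rfl⟩
    · rintro x (⟨_, ⟨i, h1, hi, rfl⟩, rfl⟩ | rfl)
      · exact ⟨[i], ⟨i, h1, by omega, rfl⟩, rfl⟩
      · exact ⟨[n + 1], ⟨n + 1, by omega, le_rfl, rfl⟩, e3⟩

theorem lzd_letters (n : ℕ) (t : List ℕ) (ht : ∀ i ∈ t, 1 ≤ i) :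
    LZDReach (code (List.range' 1 n ++ t)) t (Letters n) (Letters n) 0 :=
  ⟨ht, n, (lzd_letters_state n t).mono (fun _ h => h) (fun _ h => Or.inr h) le_rfl⟩

/-- Bits `0^i 1 1 0^i 0` for `i < n`; they make LZMW create the letters `1, …, n`. -/
def lzmwIntro (n : ℕ) : List Bool :=
  (List.range n).flatMap fun i =>
    List.replicate i false ++ true :: true :: (List.replicate i false ++ [false])

theorem lzmwIntro_succ (n : ℕ) : lzmwIntro (n + 1) = lzmwIntro n ++
    (List.replicate n false ++ true :: true :: (List.replicate n false ++ [false])) := by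
  simp [lzmwIntro, List.range_succ]

/-- The words that LZMW inserts while it creates the letters `1, …, n`. -/
def IntroDict (n : ℕ) (x : List Bool) : Prop :=
  (∃ i, 1 ≤ i ∧ i ≤ n ∧ x = List.replicate i false ++ true :: []) ∨
  (∃ i, 1 ≤ i ∧ i ≤ n ∧ x = List.replicate 0 false ++ true :: List.replicate i false) ∨
  (∃ i, i < n ∧ x = List.replicate i false ++ true ::
    (List.replicate 0 false ++ true :: List.replicate i false))

/-- Each piece is parsed as `0^n 1`, `1 0^n`, `0`, and the preceding phrase is `0`. The
concatenations of neighbours are `0^{n+1} 1`, the wanted code; `0^n 1 1 0^n`, a by-product; and `1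
0^{n+1}`, needed as the middle phrase of the next piece. -/
theorem lzmw_letters_state (n : ℕ) (t : List Bool) :
    LZMWState (false :: (lzmwIntro n ++ (List.replicate n false ++ true :: t)))
      ((lzmwStep (false :: (lzmwIntro n ++ (List.replicate n false ++ true :: t))))^[3 * n + 1]
        State.init) [false] (List.replicate n false ++ true :: t) (IntroDict n) (IntroDict n) 0 := by
  induction n generalizing t with
  | zero =>
    refine (LZMWState.first false _).mono ?_ (fun _ h => h.elim) le_rfl
    rintro w (⟨i, hi⟩ | ⟨i, hi⟩ | ⟨i, hi⟩) <;> omega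
  | succ n ih =>
    have h := ih (true :: (List.replicate n false ++ false ::
      (List.replicate (n + 1) false ++ true :: t)))
    have e : lzmwIntro n ++ (List.replicate n false ++ true :: (true :: (List.replicate n false ++
        false :: (List.replicate (n + 1) false ++ true :: t)))) =
        lzmwIntro (n + 1) ++ (List.replicate (n + 1) false ++ true :: t) := by
      simp [lzmwIntro_succ]
    rw [e] at h
    rw [show 3 * (n + 1) + 1 = 3 * n + 1 + 1 + 1 + 1 by omega, Function.iterate_succ_apply',
      Function.iterate_succ_apply', Function.iterate_succ_apply']
    generalize (lzmwStep (false :: (lzmwIntro (n + 1) ++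
      (List.replicate (n + 1) false ++ true :: t))))^[3 * n + 1] State.init = σ at h ⊢
    generalize false :: (lzmwIntro (n + 1) ++ (List.replicate (n + 1) false ++ true :: t)) = s
      at h ⊢
    have h1 : LZMWState s σ [false] ((List.replicate n false ++ [true]) ++ ((true ::
        List.replicate n false) ++ ([false] ++ (List.replicate (n + 1) false ++ true :: t))))
        (IntroDict n) (IntroDict n) 0 := by simpa using h
    have h2 := h1.step (κ := 0) (by simp) ?_ ?_ (Or.inl rfl)
    have h3 := h2.step (κ := 0) (by simp) ?_ ?_ (Or.inl rfl)
    have h4 := h3.step (κ := 0) (by simp) (Or.inl rfl) ?_ (Or.inl rfl)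
    · refine h4.mono ?_ ?_ le_rfl
      · rintro x (⟨i, hi, hi', rfl⟩ | ⟨i, hi, hi', rfl⟩ | ⟨i, hi, rfl⟩)
        · rcases Nat.lt_or_ge n i with h | h
          · obtain rfl : i = n + 1 := by omega
            exact Or.inl (Or.inl (Or.inr (by simp [List.replicate_succ])))
          · exact Or.inl (Or.inl (Or.inl (Or.inl ⟨i, hi, h, rfl⟩)))
        · rcases Nat.lt_or_ge n i with h | h
          · obtain rfl : i = n + 1 := by omega
            exact Or.inr (by simp [List.replicate_succ'])
          · exact Or.inl (Or.inl (Or.inl (Or.inr (Or.inl ⟨i, hi, h, rfl⟩))))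
        · rcases Nat.lt_or_ge i n with h | h
          · exact Or.inl (Or.inl (Or.inl (Or.inr (Or.inr ⟨i, h, rfl⟩))))
          · obtain rfl : i = n := by omega
            exact Or.inl (Or.inr (by simp))
      · rintro x (((hx | rfl) | rfl) | rfl)
        · rcases hx with ⟨i, hi, hi', rfl⟩ | ⟨i, hi, hi', rfl⟩ | ⟨i, hi, rfl⟩
          · exact Or.inl ⟨i, hi, by omega, rfl⟩
          · exact Or.inr (Or.inl ⟨i, hi, by omega, rfl⟩)
          · exact Or.inr (Or.inr ⟨i, by omega, rfl⟩)
        · exact Or.inl ⟨n + 1, by omega, le_rfl, by simp [List.replicate_succ]⟩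
        · exact Or.inr (Or.inr ⟨n, by omega, by simp⟩)
        · exact Or.inr (Or.inl ⟨n + 1, by omega, le_rfl, by simp [List.replicate_succ']⟩)
    · have e4 : [false] ++ (List.replicate (n + 1) false ++ true :: t) =
          List.replicate (n + 2) false ++ true :: t := by
        simp [List.replicate_succ]
      rw [e4]
      rintro x (((⟨i, hi, hi', rfl⟩ | ⟨i, hi, hi', rfl⟩ | ⟨i, hi, rfl⟩) | rfl) | rfl) hx
      · have := (replicate_prefix_iff.1 hx).1; omega
      · have := (replicate_prefix_iff.1 hx).1; omega
      · have := (replicate_prefix_iff.1 hx).1; omega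
      · rw [show [false] ++ (List.replicate n false ++ [true]) =
          List.replicate (n + 1) false ++ true :: [] by simp [List.replicate_succ]] at hx
        have := (replicate_prefix_iff.1 hx).1; omega
      · rw [List.append_assoc, List.singleton_append] at hx
        have := (replicate_prefix_iff.1 hx).1; omega
    · rcases Nat.eq_zero_or_pos n with rfl | hn
      · exact Or.inl rfl
      · exact Or.inr (Or.inl (Or.inr (Or.inl ⟨n, hn, le_rfl, rfl⟩)))
    · have e4 : (true :: List.replicate n false) ++ ([false] ++
          (List.replicate (n + 1) false ++ true :: t)) = List.replicate 0 false ++ true ::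
          (List.replicate (n + 1 + (n + 1)) false ++ true :: t) := by
        simp [List.replicate_add]
      rw [e4]
      rintro x ((⟨i, hi, hi', rfl⟩ | ⟨i, hi, hi', rfl⟩ | ⟨i, hi, rfl⟩) | rfl) hx
      · have := (replicate_prefix_iff.1 hx).1; omega
      · simpa using hi'
      · have := (replicate_prefix_iff.1 (replicate_prefix_iff.1 hx).2).1; omega
      · rw [show [false] ++ (List.replicate n false ++ [true]) =
          List.replicate (n + 1) false ++ true :: [] by simp [List.replicate_succ]] at hx
        have := (replicate_prefix_iff.1 hx).1; omega
    · rcases Nat.eq_zero_or_pos n with rfl | hn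
      · exact Or.inl rfl
      · exact Or.inr (Or.inl ⟨n, hn, le_rfl, rfl⟩)
    · rw [List.append_assoc, List.singleton_append]
      rintro x (⟨i, hi, hi', rfl⟩ | ⟨i, hi, hi', rfl⟩ | ⟨i, hi, rfl⟩) hx
      · have := (replicate_prefix_iff.1 hx).1; simp [this]
      · have := (replicate_prefix_iff.1 hx).1; omega
      · have := (replicate_prefix_iff.1 hx).1; omega

theorem junk_true (x : List Bool) : Junk (List.replicate 0 false ++ true :: x) := by
  intro t ht h
  cases t with
  | nil => simp [code_nil] at h
  | cons i t =>
    rw [code_cons, replicate_prefix_iff] at h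
    have := ht i List.mem_cons_self
    omega

theorem junk_code_true (i : ℕ) (x : List Bool) :
    Junk (List.replicate i false ++ true :: (List.replicate 0 false ++ true :: x)) := by
  intro t ht h
  cases t with
  | nil => simp [code_nil] at h
  | cons j t =>
    rw [code_cons, replicate_prefix_iff] at h
    have := ht j List.mem_cons_self
    cases t with
    | nil => simp [code_nil] at h
    | cons l t =>
      rw [code_cons, replicate_prefix_iff] at h
      have := ht l (by simp)
      omega

/-- The closing phrase is the code of `n`, and the bit `0` before it makes the code of `n + 1` enter
the dictionary; hence the larger upper bound. The by-products begin with `1` or contain `11` after a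
codeword, so they are junk. -/
theorem lzmw_letters {n : ℕ} (hn : 0 < n) (t : List ℕ) (ht : ∀ i ∈ t, 1 ≤ i) :
    LZMWReach (false :: (lzmwIntro n ++ code (n :: t))) [n] t (Letters n) (Letters (n + 1)) 0 := by
  refine ⟨ht, 3 * n + 1 + 1, ?_⟩
  have h := lzmw_letters_state n (code t)
  rw [Function.iterate_succ_apply']
  rw [code_cons]
  generalize (lzmwStep (false :: (lzmwIntro n ++ (List.replicate n false ++ true :: code t))))^[3 *
    n + 1] State.init = σ at h ⊢
  generalize false :: (lzmwIntro n ++ (List.replicate n false ++ true :: code t)) = s at h ⊢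
  have h1 : LZMWState s σ [false] ((List.replicate n false ++ [true]) ++ code t)
    (IntroDict n) (IntroDict n) 0 := by simpa using h
  have h2 := h1.step (κ := 0) (by simp) (Or.inr (Or.inl ⟨n, hn, le_rfl, rfl⟩)) ?_ (Or.inl rfl)
  · have e : code [n] = List.replicate n false ++ [true] := by simp [code_cons, code_nil]
    rw [e]
    refine h2.mono ?_ ?_ le_rfl
    · rintro x ⟨_, ⟨i, hi, hi', rfl⟩, rfl⟩
      exact Or.inl (Or.inl ⟨i, hi, hi', by simp [code_cons, code_nil]⟩)
    · rintro x ((⟨i, hi, hi', rfl⟩ | ⟨i, hi, hi', rfl⟩ | ⟨i, hi, rfl⟩) | rfl)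
      · exact Or.inr ⟨[i], ⟨i, hi, by omega, rfl⟩, by simp [code_cons, code_nil]⟩
      · exact Or.inl (junk_true _)
      · exact Or.inl (junk_code_true _ _)
      · exact Or.inr ⟨[n + 1], ⟨n + 1, by omega, le_rfl, rfl⟩,
          by simp [code_cons, code_nil, List.replicate_succ]⟩
  · rw [List.append_assoc, List.singleton_append]
    rintro x (⟨i, hi, hi', rfl⟩ | ⟨i, hi, hi', rfl⟩ | ⟨i, hi, rfl⟩) hx
    · have := (replicate_prefix_iff.1 hx).1; simp [this]
    · have := (replicate_prefix_iff.1 hx).1; omega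
    · have := (replicate_prefix_iff.1 hx).1; omega

/-! ### The slow text for LZD -/

namespace LZD

/-- The suffix of the word `k, k + 1, …, 2 k - 1` from position `a` on. -/
def suf (k a : ℕ) : List ℕ := List.range' (k + a) (k - a)

/-- The prefix of length `a` of the word `k, k + 1, …, 2 k - 1`. -/
def pre (k a : ℕ) : List ℕ := List.range' k a

theorem suf_eq_cons {k a : ℕ} (h : a < k) : suf k a = (k + a) :: suf k (a + 1) := by
  obtain ⟨b, rfl⟩ := Nat.exists_eq_add_of_lt h
  simp only [suf]
  rw [show a + b + 1 - a = b + 1 by omega, show a + b + 1 - (a + 1) = b by omega,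
    List.range'_succ]
  rfl

theorem pre_append_suf {k a : ℕ} (h : a ≤ k) : pre k a ++ suf k a = suf k 0 := by
  simp only [pre, suf, List.range'_append_1, add_zero]
  congr 1
  omega

theorem pre_succ (k a : ℕ) : pre k (a + 1) = pre k a ++ [k + a] := by
  simp [pre, List.range'_concat]

theorem length_suf (k a : ℕ) : (suf k a).length = k - a := by simp [suf]

theorem length_pre (k a : ℕ) : (pre k a).length = a := by simp [pre]

theorem suf_append_prefix {k a b : ℕ} (ha : a < k) (hb : b < k) {e t : List ℕ} :
    suf k a ++ e <+: suf k b ++ t ↔ a = b ∧ e <+: t := by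
  constructor
  · intro h
    have : a = b := by
      rw [suf_eq_cons ha, suf_eq_cons hb, List.cons_append, List.cons_append,
        List.cons_prefix_cons] at h
      omega
    subst this
    exact ⟨rfl, (List.prefix_append_right_inj _).1 h⟩
  · rintro ⟨rfl, h⟩
    exact (List.prefix_append_right_inj _).2 h

theorem suf_append_prefix_cons {k a x : ℕ} (ha : a < k) {e t : List ℕ}
    (h : suf k a ++ e <+: x :: t) : x = k + a := by
  rw [suf_eq_cons ha, List.cons_append, List.cons_prefix_cons] at h
  exact h.1.symm

/-- `d` blocks `y_h v`, the first of them with index `h`; `v` is `suf k 0` and `y_h` is `2 k + h`. -/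
def blocks (k : ℕ) : ℕ → ℕ → List ℕ
  | _, 0 => []
  | h, d + 1 => (2 * k + h) :: (suf k 0 ++ blocks k (h + 1) d)

/-- The blocks `y_h v` up to the index `k - 1`, followed by the letter `y_k`. -/
def tower (k h : ℕ) : List ℕ := blocks k h (k - h) ++ [3 * k]

theorem tower_self (k : ℕ) : tower k k = [3 * k] := by simp [tower, blocks]

theorem tower_of_lt {k h : ℕ} (hh : h < k) :
    tower k h = (2 * k + h) :: (suf k 0 ++ tower k (h + 1)) := by
  simp [tower, show k - h = k - (h + 1) + 1 by omega, blocks]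

theorem tower_head {k h : ℕ} (hh : h ≤ k) : ∃ t, tower k h = (2 * k + h) :: t := by
  rcases hh.eq_or_lt with rfl | hh
  · exact ⟨[], by rw [tower_self]; congr 1; omega⟩
  · exact ⟨_, tower_of_lt hh⟩

theorem blocks_append_tower (k h d : ℕ) (hd : h + d ≤ k) :
    tower k h = blocks k h d ++ tower k (h + d) := by
  induction d generalizing h with
  | zero => simp [blocks]
  | succ d ih =>
    rw [tower_of_lt (by omega), ih (h + 1) (by omega)]
    simp [blocks, show h + 1 + d = h + (d + 1) by omega]

theorem length_blocks (k h d : ℕ) : (blocks k h d).length = d * (k + 1) := by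
  induction d generalizing h with
  | zero => simp [blocks]
  | succ d ih => simp [blocks, ih, length_suf]; ring

theorem mem_suf {k a i : ℕ} (h : i ∈ suf k a) : k ≤ i ∧ i < 2 * k := by
  simp only [suf, List.mem_range'_1] at h
  omega

theorem mem_pre {k a i : ℕ} (h : i ∈ pre k a) : k ≤ i ∧ i < k + a := by
  simpa only [pre, List.mem_range'_1] using h

theorem mem_blocks {k h d i : ℕ} (hi : i ∈ blocks k h d) : k ≤ i ∧ i < 2 * k + h + d := by
  induction d generalizing h with
  | zero => simp [blocks] at hi
  | succ d ih =>
    simp only [blocks, List.mem_cons, List.mem_append] at hi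
    rcases hi with rfl | hi | hi
    · omega
    · have := mem_suf hi; omega
    · have := ih hi; omega

/-- A dictionary; `EV a` consists of the words `e` such that it contains `suf k a ++ e`, `EY h` of
the words `e` such that it contains `y_h :: e`, and `ES` of the letters `g` such that it contains
`g g`. -/
def Dict (k : ℕ) (EV EY : ℕ → List ℕ → Prop) (ES : ℕ → Prop) (w : List ℕ) : Prop :=
  Letters (4 * k) w ∨ (∃ a e, a < k ∧ EV a e ∧ w = suf k a ++ e) ∨
    (∃ h e, h < k ∧ EY h e ∧ w = (2 * k + h) :: e) ∨ (∃ g, 3 * k < g ∧ ES g ∧ w = [g, g])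

/-- The word does not begin with a letter of `suf k 0`. -/
def NoV (k : ℕ) (t : List ℕ) : Prop := ∀ a e, a < k → ¬ suf k a ++ e <+: t

theorem noV_cons {k x : ℕ} (t : List ℕ) (hx : 2 * k ≤ x) : NoV k (x :: t) := by
  intro a e ha h
  have := suf_append_prefix_cons ha h
  omega

section Parse

variable {k : ℕ} {EV EY EV' EY' : ℕ → List ℕ → Prop} {ES ES' : ℕ → Prop}

/-- The letters of v are distinct and differ from all others, so the first letter `k + b` leaves
only the letter itself and extensions of `suf k b` as competitors. -/
theorem greedy_suf {b : ℕ} (hb : b < k) {e₀ t : List ℕ}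
    (h : ∀ e, EV b e → e <+: t → e.length ≤ e₀.length) :
    Greedy (Dict k EV EY ES) (suf k b ++ t) (suf k b ++ e₀) := by
  have hl := length_suf k b
  rintro w (⟨i, -, -, rfl⟩ | ⟨a, e, ha, he, rfl⟩ | ⟨h', e, hh, he, rfl⟩ | ⟨g, hg, -, rfl⟩) hw
  · simp; omega
  · obtain ⟨rfl, h1⟩ := (suf_append_prefix ha hb).1 hw
    have := h e he h1
    simp; omega
  · rw [suf_eq_cons hb, List.cons_append, List.cons_prefix_cons] at hw; omega
  · rw [suf_eq_cons hb, List.cons_append, List.cons_prefix_cons] at hw; omega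

/-- A letter of v is taken alone only if the rest of v, with an extension in the dictionary, does
not follow. This is the reason for controlling what follows each letter, through `NoV` and
separators. -/
theorem greedy_letter {b : ℕ} (hb : b < k) {t : List ℕ}
    (h : ∀ e, EV b e → ¬ suf k (b + 1) ++ e <+: t) :
    Greedy (Dict k EV EY ES) ([k + b] ++ t) [k + b] := by
  rintro w (⟨i, -, -, rfl⟩ | ⟨a, e, ha, he, rfl⟩ | ⟨h', e, hh, he, rfl⟩ | ⟨g, hg, -, rfl⟩) hw
  · simp
  · rw [List.singleton_append] at hw
    have : b = a := by have := suf_append_prefix_cons ha hw; omega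
    subst this
    rw [suf_eq_cons ha, List.cons_append, List.cons_prefix_cons] at hw
    exact absurd hw.2 (h e he)
  · rw [List.singleton_append, List.cons_prefix_cons] at hw; omega
  · rw [List.singleton_append, List.cons_prefix_cons] at hw; omega

theorem greedy_cons {h : ℕ} (hh : h ≤ k) {e₀ t : List ℕ}
    (H : h < k → ∀ e, EY h e → e <+: t → e.length ≤ e₀.length) :
    Greedy (Dict k EV EY ES) ((2 * k + h) :: t) ((2 * k + h) :: e₀) := by
  rintro w (⟨i, -, -, rfl⟩ | ⟨a, e, ha, he, rfl⟩ | ⟨h', e, hh', he, rfl⟩ | ⟨g, hg, -, rfl⟩) hw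
  · simp
  · have := suf_append_prefix_cons ha hw; omega
  · rw [List.cons_prefix_cons] at hw
    obtain rfl : h' = h := by omega
    have := H hh' e he hw.2
    simp; omega
  · rw [List.cons_prefix_cons] at hw; omega

theorem greedy_separator {g : ℕ} (hg : 3 * k < g) {t : List ℕ} (ht : ¬ ES g) :
    Greedy (Dict k EV EY ES) ([g] ++ t) [g] := by
  rintro w (⟨i, -, -, rfl⟩ | ⟨a, e, ha, he, rfl⟩ | ⟨h', e, hh', he, rfl⟩ | ⟨g', hg', h, rfl⟩) hw
  · simp
  · have := suf_append_prefix_cons ha hw; omega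
  · rw [List.singleton_append, List.cons_prefix_cons] at hw; omega
  · rw [List.singleton_append, List.cons_prefix_cons] at hw
    rw [hw.1] at h
    exact absurd h ht

theorem dict_letter {x : ℕ} (h1 : 1 ≤ x) (h2 : x ≤ 4 * k) : Dict k EV EY ES [x] :=
  Or.inl ⟨x, h1, h2, rfl⟩

theorem dict_suf {a : ℕ} {e : List ℕ} (ha : a < k) (h : EV a e) : Dict k EV EY ES (suf k a ++ e) :=
  Or.inr (Or.inl ⟨a, e, ha, h, rfl⟩)

theorem dict_cons {h : ℕ} {e : List ℕ} (hh : h < k) (H : EY h e) :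
    Dict k EV EY ES ((2 * k + h) :: e) :=
  Or.inr (Or.inr (Or.inl ⟨h, e, hh, H, rfl⟩))

theorem dict_mono (hV : ∀ a e, a < k → EV a e → EV' a e) (hY : ∀ h e, h < k → EY h e → EY' h e)
    (hS : ∀ g, ES g → ES' g) {w : List ℕ} (hw : Dict k EV EY ES w) : Dict k EV' EY' ES' w := by
  rcases hw with hw | ⟨a, e, ha, he, rfl⟩ | ⟨h', e, hh', he, rfl⟩ | ⟨g', hg', h, rfl⟩
  · exact Or.inl hw
  · exact dict_suf ha (hV _ _ ha he)
  · exact dict_cons hh' (hY _ _ hh' he)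
  · exact Or.inr (Or.inr (Or.inr ⟨g', hg', hS _ h, rfl⟩))

/-- `LZDReach` with a dictionary of the form `Dict`. -/
def At (k : ℕ) (s : List Bool) (rest : List ℕ) (EV EY : ℕ → List ℕ → Prop) (ES : ℕ → Prop)
    (τ : ℕ) : Prop :=
  LZDReach s rest (Dict k EV EY ES) (Dict k EV EY ES) τ

theorem At.congr {s : List Bool} {rest : List ℕ} {τ : ℕ} (H : At k s rest EV EY ES τ)
    (hV : ∀ a e, a < k → (EV' a e ↔ EV a e)) (hY : ∀ h e, h < k → (EY' h e ↔ EY h e))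
    (hS : ∀ g, ES' g ↔ ES g) : At k s rest EV' EY' ES' τ :=
  LZDReach.mono H
    (fun _ => dict_mono (fun a e ha => (hV a e ha).1) (fun a e ha => (hY a e ha).1)
      fun g => (hS g).1)
    (fun _ => dict_mono (fun a e ha => (hV a e ha).2) (fun a e ha => (hY a e ha).2)
      fun g => (hS g).2) le_rfl

/-- The condition under which a search that returns `v` at a position followed by `v ++ rest` takes
time at least `κ`. -/
def Cost (D : List ℕ → Prop) (t : List ℕ) (κ : ℕ) : Prop :=
  κ = 0 ∨ ∃ w c, D w ∧ 2 ≤ w.length ∧ c <+: w ∧ c <+: t ∧ κ ≤ (code c).length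

/-- An LZD round inserts its own phrase and no by-products, so the lower and the upper bound can
remain equal throughout. -/
theorem At.step_suf {s : List Bool} {u v rest e₀ : List ℕ} {τ b : ℕ} (κ : ℕ)
    (H : At k s (u ++ (v ++ rest)) EV EY ES τ) (hb : b < k) (huv : u ++ v = suf k b ++ e₀)
    (hu : Dict k EV EY ES u) (hv : Dict k EV EY ES v) (hu0 : u ≠ []) (hv0 : v ≠ [])
    (hgu : Greedy (Dict k EV EY ES) (u ++ (v ++ rest)) u)
    (hgv : Greedy (Dict k EV EY ES) (v ++ rest) v)
    (hκ : Cost (Dict k EV EY ES) (v ++ rest) κ)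
    (hV : ∀ a e, a < k → (EV' a e ↔ EV a e ∨ a = b ∧ e = e₀)) :
    At k s rest EV' EY ES (τ + κ) := by
  refine (LZDReach.step κ H hu hv hu0 hv0 hgu hgv hκ).mono ?_ ?_ le_rfl
  · rintro w (hw | ⟨a, e, ha, he, rfl⟩ | ⟨h', e, hh', he, rfl⟩ | ⟨g', hg', h, rfl⟩)
    · exact Or.inl (Or.inl hw)
    · rcases (hV a e ha).1 he with he | ⟨rfl, rfl⟩
      · exact Or.inl (dict_suf ha he)
      · exact Or.inr huv.symm
    · exact Or.inl (dict_cons hh' he)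
    · exact Or.inl (Or.inr (Or.inr (Or.inr ⟨g', hg', h, rfl⟩)))
  · rintro w (hw | rfl)
    · exact dict_mono (fun a e ha he => (hV a e ha).2 (Or.inl he)) (fun _ _ _ h => h)
        (fun _ h => h) hw
    · rw [huv]; exact dict_suf hb ((hV _ _ hb).2 (Or.inr ⟨rfl, rfl⟩))

theorem At.step_cons {s : List Bool} {u v rest e₀ : List ℕ} {τ b : ℕ}
    (H : At k s (u ++ (v ++ rest)) EV EY ES τ) (hb : b < k) (huv : u ++ v = (2 * k + b) :: e₀)
    (hu : Dict k EV EY ES u) (hv : Dict k EV EY ES v) (hu0 : u ≠ []) (hv0 : v ≠ [])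
    (hgu : Greedy (Dict k EV EY ES) (u ++ (v ++ rest)) u)
    (hgv : Greedy (Dict k EV EY ES) (v ++ rest) v)
    (hY : ∀ h e, h < k → (EY' h e ↔ EY h e ∨ h = b ∧ e = e₀)) :
    At k s rest EV EY' ES τ := by
  refine (LZDReach.step 0 H hu hv hu0 hv0 hgu hgv (Or.inl rfl)).mono ?_ ?_ le_rfl
  · rintro w (hw | ⟨a, e, ha, he, rfl⟩ | ⟨h', e, hh', he, rfl⟩ | ⟨g', hg', h, rfl⟩)
    · exact Or.inl (Or.inl hw)
    · exact Or.inl (dict_suf ha he)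
    · rcases (hY h' e hh').1 he with he | ⟨rfl, rfl⟩
      · exact Or.inl (dict_cons hh' he)
      · exact Or.inr huv.symm
    · exact Or.inl (Or.inr (Or.inr (Or.inr ⟨g', hg', h, rfl⟩)))
  · rintro w (hw | rfl)
    · exact dict_mono (fun _ _ _ h => h) (fun a e ha he => (hY a e ha).2 (Or.inl he))
        (fun _ h => h) hw
    · rw [huv]; exact dict_cons hb ((hY _ _ hb).2 (Or.inr ⟨rfl, rfl⟩))

/-- A separator must be fresh: were `g g` already present, it would be the first element alone and
the phrase would swallow the text after it. -/
theorem At.step_separator {s : List Bool} {rest : List ℕ} {τ g : ℕ}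
    (H : At k s (g :: g :: rest) EV EY ES τ) (hg : 3 * k < g) (hg' : g ≤ 4 * k) (hES : ¬ ES g) :
    At k s rest EV EY (fun g' => ES g' ∨ g' = g) τ := by
  have hgl : Dict k EV EY ES [g] := dict_letter (by omega) hg'
  refine (LZDReach.step (u := [g]) (v := [g]) 0 H hgl hgl (by simp) (by simp)
    (greedy_separator hg hES) (greedy_separator hg hES) (Or.inl rfl)).mono ?_ ?_ le_rfl
  · rintro w (hw | ⟨a, e, ha, he, rfl⟩ | ⟨h', e, hh', he, rfl⟩ | ⟨g', hg', h | rfl, rfl⟩)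
    · exact Or.inl (Or.inl hw)
    · exact Or.inl (dict_suf ha he)
    · exact Or.inl (dict_cons hh' he)
    · exact Or.inl (Or.inr (Or.inr (Or.inr ⟨g', hg', h, rfl⟩)))
    · exact Or.inr rfl
  · rintro w (hw | rfl)
    · exact dict_mono (fun _ _ _ h => h) (fun _ _ _ h => h) (fun _ h => Or.inl h) hw
    · exact Or.inr (Or.inr (Or.inr ⟨g, hg, Or.inr rfl, rfl⟩))

/-! ### The suffixes of `suf k 0` -/

/-- The text whose phrases are `suf k a` for `a < n`, in decreasing order of `a`. -/
def sufText (k : ℕ) : ℕ → List ℕ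
  | 0 => []
  | n + 1 => suf k n ++ sufText k n

/-- `suf k n` is the letter `k + n` followed by the suffix created just before it. -/
theorem At.sufText {s : List Bool} {rest : List ℕ} {n : ℕ} (hn : n < k)
    (H : At k s (sufText k n ++ rest) (fun a e => e = [] ∧ n ≤ a) (fun _ _ => False)
      (fun _ => False) 0) :
    At k s rest (fun _ e => e = []) (fun _ _ => False) (fun _ => False) 0 := by
  induction n with
  | zero => exact At.congr H (fun a e _ => by simp) (fun _ _ _ => Iff.rfl) fun _ => Iff.rfl
  | succ n ih =>
    refine ih (by omega) ?_
    have e1 : LZD.sufText k (n + 1) ++ rest =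
        [k + n] ++ (suf k (n + 1) ++ (LZD.sufText k n ++ rest)) := by
      rw [LZD.sufText, suf_eq_cons (show n < k by omega)]; simp
    rw [e1] at H
    refine At.step_suf 0 H (b := n) (e₀ := []) (by omega) ?_ (dict_letter (by omega) (by omega)) ?_
      (by simp) ?_ ?_ ?_ (Or.inl rfl) ?_
    · rw [suf_eq_cons (show n < k by omega)]; simp
    · have := dict_suf (k := k) (EV := fun a e => e = [] ∧ n + 1 ≤ a) (EY := fun _ _ => False)
        (ES := fun _ => False) hn ⟨rfl, le_rfl⟩
      simpa using this
    · rw [suf_eq_cons hn]; simp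
    · exact greedy_letter (by omega) fun e he => by omega
    · have := greedy_suf (k := k) (EV := fun a e => e = [] ∧ n + 1 ≤ a) (EY := fun _ _ => False)
        (ES := fun _ => False) hn (e₀ := []) (t := LZD.sufText k n ++ rest)
        (fun e he _ => by simp [he.1])
      simpa using this
    · intro a e ha
      constructor
      · rintro ⟨rfl, h⟩
        rcases h.eq_or_lt with rfl | h
        · exact Or.inr ⟨rfl, rfl⟩
        · exact Or.inl ⟨rfl, h⟩
      · rintro (⟨rfl, h⟩ | ⟨rfl, rfl⟩)
        · exact ⟨rfl, by omega⟩
        · exact ⟨rfl, le_rfl⟩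

/-! ### The towers -/

/-- The text whose phrases are `suf k 0 ++ tower k (h + 1)` and `tower k h` for `h < n`, in
decreasing order of `h`. -/
def towerText (k : ℕ) : ℕ → List ℕ
  | 0 => []
  | h + 1 => suf k 0 ++ tower k (h + 1) ++ (2 * k + h) :: (suf k 0 ++ tower k (h + 1)) ++
      towerText k h

theorem tower_prefix {h h' : ℕ} (hh : h ≤ k) (hh' : h' ≤ k) {e t : List ℕ}
    (H : tower k h ++ e <+: tower k h' ++ t) : h = h' := by
  obtain ⟨r, hr⟩ := tower_head hh
  obtain ⟨r', hr'⟩ := tower_head hh'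
  rw [hr, hr', List.cons_append, List.cons_append, List.cons_prefix_cons] at H
  omega

/-- Words that extend `suf k a` when the towers with index at least `n` have been created. -/
def TowerV (k n a : ℕ) (e : List ℕ) : Prop :=
  e = [] ∨ a = 0 ∧ ∃ h, n < h ∧ h ≤ k ∧ e = tower k h

/-- Words that extend `y_h` when the towers with index at least `n` have been created. -/
def TowerY (k n h : ℕ) (e : List ℕ) : Prop := n ≤ h ∧ e = suf k 0 ++ tower k (h + 1)

theorem dict_tower {h : ℕ} (hk : 0 < k) (hh : h ≤ k)
    (hY : h < k → EY h (suf k 0 ++ tower k (h + 1))) : Dict k EV EY ES (tower k h) := by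
  rcases hh.eq_or_lt with rfl | hh
  · rw [tower_self]; exact dict_letter (by omega) (by omega)
  · rw [tower_of_lt hh]; exact dict_cons hh (hY hh)

/-- The next tower is y_h followed by v and the previous tower. As a phrase has two elements only, v
and the previous tower are joined first, and y_h is put in front by a second phrase. -/
theorem At.towerText {s : List Bool} {rest : List ℕ} {n : ℕ} (hk : 0 < k) (hn : n ≤ k)
    (H : At k s (towerText k n ++ rest) (TowerV k n) (TowerY k n) (fun _ => False) 0) :
    At k s rest (TowerV k 0) (TowerY k 0) (fun _ => False) 0 := by
  induction n with
  | zero => exact H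
  | succ h ih =>
    refine ih (by omega) ?_
    obtain ⟨t, ht⟩ := tower_head hn
    have e1 : LZD.towerText k (h + 1) ++ rest = suf k 0 ++ (tower k (h + 1) ++ ([2 * k + h] ++
        ((suf k 0 ++ tower k (h + 1)) ++ (LZD.towerText k h ++ rest)))) := by
      simp [LZD.towerText]
    rw [e1] at H
    have hne : suf k 0 ≠ [] := by rw [suf_eq_cons hk]; simp
    have H2 : At k s ([2 * k + h] ++ ((suf k 0 ++ tower k (h + 1)) ++
        (LZD.towerText k h ++ rest))) (TowerV k h) (TowerY k (h + 1)) (fun _ => False) 0 := by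
      refine At.step_suf 0 H (b := 0) (e₀ := tower k (h + 1)) hk rfl ?_
        (dict_tower hk hn fun _ => ⟨le_rfl, rfl⟩) hne (by simp [ht]) ?_ ?_ (Or.inl rfl) ?_
      · simpa using dict_suf (k := k) (EV := TowerV k (h + 1)) (EY := TowerY k (h + 1))
          (ES := fun _ => False) hk (Or.inl rfl)
      · rw [← List.append_nil (suf k 0), List.append_assoc]
        refine greedy_suf hk ?_
        rintro e (rfl | ⟨-, h', h1, h2, rfl⟩) he
        · simp
        · rw [List.nil_append, ← List.append_nil (tower k h')] at he
          have := tower_prefix h2 hn he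
          omega
      · rw [ht]
        refine greedy_cons hn ?_
        rintro hlt e ⟨-, rfl⟩ he
        rw [tower_of_lt hlt, List.cons.injEq] at ht
        rw [← ht.2]
      · rintro a e -
        constructor
        · rintro (rfl | ⟨rfl, h', h1, h2, rfl⟩)
          · exact Or.inl (Or.inl rfl)
          · rcases Nat.lt_or_ge (h + 1) h' with h3 | h3
            · exact Or.inl (Or.inr ⟨rfl, h', h3, h2, rfl⟩)
            · exact Or.inr ⟨rfl, by congr 1; omega⟩
        · rintro ((rfl | ⟨rfl, h', h1, h2, rfl⟩) | ⟨rfl, rfl⟩)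
          · exact Or.inl rfl
          · exact Or.inr ⟨rfl, h', by omega, h2, rfl⟩
          · exact Or.inr ⟨rfl, h + 1, by omega, hn, rfl⟩
    refine At.step_cons H2 (b := h) (e₀ := suf k 0 ++ tower k (h + 1)) (by omega) rfl
      (dict_letter (by omega) (by omega)) (dict_suf hk (Or.inr ⟨rfl, h + 1, by omega, hn, rfl⟩))
      (by simp) (by simp [hne]) ?_ ?_ ?_
    · refine greedy_cons (by omega) ?_
      rintro - e ⟨h1, -⟩; omega
    · rw [List.append_assoc]
      refine greedy_suf hk ?_
      rintro e (rfl | ⟨-, h', h1, h2, rfl⟩) he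
      · simp
      · rw [← List.append_nil (tower k h')] at he
        rw [tower_prefix h2 hn he]
    · intro h' e _
      constructor
      · rintro ⟨h1, rfl⟩
        rcases h1.eq_or_lt with rfl | h1
        · exact Or.inr ⟨rfl, rfl⟩
        · exact Or.inl ⟨h1, rfl⟩
      · rintro (⟨h1, rfl⟩ | ⟨rfl, rfl⟩)
        · exact ⟨by omega, rfl⟩
        · exact ⟨le_rfl, rfl⟩

/-! ### The rounds -/

/-- Words that extend `suf k a` when the phrases `suf k a ++ y_h :: pre k a` with `(a, h)`
lexicographically smaller than `(b, g)` have been created. -/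
def RoundV (k b g a : ℕ) (e : List ℕ) : Prop :=
  TowerV k 0 a e ∨ 1 ≤ a ∧ ∃ h, h < k ∧ (a < b ∨ a = b ∧ h < g) ∧ e = (2 * k + h) :: pre k a

/-- Words that extend `y_h` when the phrases `y_h :: pre k a` with `(a, h)` lexicographically smaller
than `(b, g)` have been created. -/
def RoundY (k b g h : ℕ) (e : List ℕ) : Prop :=
  TowerY k 0 h e ∨ ∃ a, (a < b ∨ a = b ∧ h < g) ∧ e = pre k a

/-- The text whose phrases are `y_i :: pre k (a + 1)` for `h ≤ i < h + c`. -/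
def preText (k a : ℕ) : ℕ → ℕ → List ℕ
  | _, 0 => []
  | h, c + 1 => (2 * k + h) :: pre k a ++ ([k + a] ++ preText k a (h + 1) c)

/-- The text whose phrases are `suf k a ++ y_i :: pre k a` for `h ≤ i < h + c`. -/
def rowText (k a : ℕ) : ℕ → ℕ → List ℕ
  | _, 0 => []
  | h, c + 1 => suf k a ++ ((2 * k + h) :: pre k a ++ rowText k a (h + 1) c)

/-- Each y_h `pre k a` is lengthened by the single letter `k + a`. The letter stays single because
the next y or, at the end, `rest` does not continue v. -/
theorem At.preText {s : List Bool} {rest : List ℕ} {a h c τ : ℕ} (ha : a + 1 < k) (hc : h + c = k)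
    (hrest : NoV k rest)
    (H : At k s (preText k a h c ++ rest) (RoundV k (a + 1) 0) (RoundY k (a + 1) h)
      (fun g => g ≤ 3 * k + a) τ) :
    At k s rest (RoundV k (a + 1) 0) (RoundY k (a + 2) 0) (fun g => g ≤ 3 * k + a) τ := by
  induction c generalizing h with
  | zero =>
    refine At.congr H (fun _ _ _ => Iff.rfl) (fun h' e hh' => ?_) (fun _ => Iff.rfl)
    refine or_congr Iff.rfl (exists_congr fun a' => and_congr ?_ Iff.rfl)
    omega
  | succ c ih =>
    refine ih (h := h + 1) (by omega) ?_
    have hnov : NoV k (LZD.preText k a (h + 1) c ++ rest) := by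
      cases c with
      | zero => exact hrest
      | succ c => exact noV_cons _ (by omega)
    have e1 : LZD.preText k a h (c + 1) ++ rest = ((2 * k + h) :: pre k a) ++
        ([k + a] ++ (LZD.preText k a (h + 1) c ++ rest)) := by
      simp [LZD.preText]
    rw [e1] at H
    refine At.step_cons H (b := h) (e₀ := pre k (a + 1)) (by omega) ?_
      (dict_cons (show h < k by omega) (Or.inr ⟨a, by omega, rfl⟩)) (dict_letter (by omega) (by omega))
      (by simp) (by simp) ?_ ?_ ?_
    · simp [pre_succ]
    · refine greedy_cons (by omega) ?_
      rintro - e (⟨-, rfl⟩ | ⟨a', h1, rfl⟩) he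
      -- The tower is the only dangerous competitor: after `pre k a` and the letter `k + a` it
      -- continues with `suf k (a + 1)`, which the following text does not.
      · change _ <+: pre k a ++ _ at he
        rw [← pre_append_suf (show a ≤ k by omega), List.append_assoc,
          List.prefix_append_right_inj, suf_eq_cons (show a < k by omega), List.cons_append,
          List.singleton_append, List.cons_prefix_cons] at he
        exact absurd he.2 (hnov _ _ ha)
      · rw [length_pre, length_pre]; omega
    · exact greedy_letter (by omega) fun e _ => hnov _ _ ha
    · intro h' e _
      constructor
      · rintro (h1 | ⟨a', h1, rfl⟩)
        · exact Or.inl (Or.inl h1)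
        · by_cases h2 : a' = a + 1 ∧ h' = h
          · exact Or.inr ⟨h2.2, by rw [h2.1]⟩
          · exact Or.inl (Or.inr ⟨a', by omega, rfl⟩)
      · rintro ((h1 | ⟨a', h1, rfl⟩) | ⟨rfl, rfl⟩)
        · exact Or.inl h1
        · exact Or.inr ⟨a', by omega, rfl⟩
        · exact Or.inr ⟨a + 1, by omega, rfl⟩

/-- The cuts between phrases disappear here: the `suf k a` that opens a phrase completes the `pre k
a` that closes the preceding one to v. Hence the text seen from y_h looks like a tower. -/
theorem rowText_eq {a h c : ℕ} (ha : a ≤ k) (t : List ℕ) :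
    (2 * k + h) :: pre k a ++ (rowText k a (h + 1) c ++ t) =
      blocks k h c ++ ((2 * k + (h + c)) :: pre k a ++ t) := by
  induction c generalizing h with
  | zero => simp [blocks, rowText]
  | succ c ih =>
    have := ih (h := h + 1)
    rw [show h + 1 + c = h + (c + 1) by omega] at this
    simp only [blocks, rowText, List.cons_append, List.append_assoc] at this ⊢
    rw [this, ← pre_append_suf ha, List.append_assoc]

/-- The first element is `suf k (a + 1)`, whose extensions present so far continue with an earlier
y. The second is found by a search that follows the tower of index `h` up to the incomplete v at the
end of the row and then falls back on y_h `pre k (a + 1)`. -/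
theorem At.rowText {s : List Bool} {rest : List ℕ} {a h c τ : ℕ} (ha : a + 1 < k) (hc : h + c = k)
    (hrest : NoV k rest) {ES : ℕ → Prop}
    (H : At k s (rowText k (a + 1) h c ++ rest) (RoundV k (a + 1) h) (RoundY k (a + 2) 0) ES τ) :
    At k s rest (RoundV k (a + 2) 0) (RoundY k (a + 2) 0) ES
      (τ + ∑ i ∈ Finset.range c, i * (k + 1) * k) := by
  induction c generalizing h τ with
  | zero =>
    refine At.congr H (fun a' e ha' => ?_) (fun _ _ _ => Iff.rfl) (fun _ => Iff.rfl)
    refine or_congr Iff.rfl (and_congr Iff.rfl (exists_congr fun h' => and_congr_right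
      fun hh' => and_congr ?_ Iff.rfl))
    omega
  | succ c ih =>
    -- The earliest y has most blocks in front of it, so the largest term of the sum is paid first.
    rw [Finset.sum_range_succ, Nat.add_comm (∑ i ∈ Finset.range c, i * (k + 1) * k), ← Nat.add_assoc]
    refine ih (h := h + 1) (by omega) ?_
    have e1 : LZD.rowText k (a + 1) h (c + 1) ++ rest = suf k (a + 1) ++
        (((2 * k + h) :: pre k (a + 1)) ++ (LZD.rowText k (a + 1) (h + 1) c ++ rest)) := by
      simp [LZD.rowText]
    rw [e1] at H
    have htow := blocks_append_tower k h c (by omega)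
    have hne : suf k (a + 1) ≠ [] := by rw [suf_eq_cons ha]; simp
    refine At.step_suf _ H (b := a + 1) (e₀ := (2 * k + h) :: pre k (a + 1)) ha rfl ?_
      (dict_cons (show h < k by omega) (Or.inr ⟨a + 1, by omega, rfl⟩)) hne (by simp) ?_ ?_ ?_ ?_
    · simpa using dict_suf (k := k) (EV := RoundV k (a + 1) h) (EY := RoundY k (a + 2) 0)
        (ES := ES) ha (Or.inl (Or.inl rfl))
    · rw [← List.append_nil (suf k (a + 1)), List.append_assoc]
      refine greedy_suf ha ?_
      rintro e ((rfl | ⟨h1, -⟩) | ⟨-, h', h1, h2, rfl⟩) he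
      · simp
      · omega
      · rw [List.nil_append, List.cons_append, List.cons_prefix_cons] at he
        omega
    · refine greedy_cons (by omega) ?_
      rintro hh e (⟨-, rfl⟩ | ⟨a', h1, rfl⟩) he
      -- If the whole tower matched, removing the `c` common blocks and y_{k-1} `pre k (a + 1)`
      -- would leave `suf k (a + 1)` at the beginning of `rest`.
      · have he' : tower k h <+: (2 * k + h) :: pre k (a + 1) ++
            (LZD.rowText k (a + 1) (h + 1) c ++ rest) := by
          rw [tower_of_lt hh]
          exact List.cons_prefix_cons.2 ⟨rfl, he⟩
        rw [rowText_eq ha.le, htow, List.prefix_append_right_inj, tower_of_lt (by omega),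
          List.cons_append, List.cons_prefix_cons, ← pre_append_suf ha.le, List.append_assoc,
          List.prefix_append_right_inj] at he'
        exact absurd he'.2 (hrest _ _ ha)
      · rw [length_pre, length_pre]; omega
    -- The letters certainly matched are `c` full blocks of `k + 1` letters, each coded by at least
    -- `k` bits.
    · refine Or.inr ⟨tower k h, blocks k h c, dict_tower (by omega) (by omega) fun _ =>
        Or.inl ⟨Nat.zero_le _, rfl⟩, ?_, ?_, ?_, ?_⟩
      · rw [tower_of_lt (by omega), suf_eq_cons (show 0 < k by omega)]
        simp
      · rw [htow]; exact List.prefix_append _ _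
      · rw [rowText_eq ha.le]; exact List.prefix_append _ _
      · rw [← length_blocks k h c]
        exact le_length_code fun i hi => (mem_blocks hi).1
    · intro a' e _
      constructor
      · rintro (h1 | ⟨h1, h', h2, h3, rfl⟩)
        · exact Or.inl (Or.inl h1)
        · by_cases h4 : a' = a + 1 ∧ h' = h
          · exact Or.inr ⟨h4.1, by rw [h4.1, h4.2]⟩
          · exact Or.inl (Or.inr ⟨h1, h', h2, by omega, rfl⟩)
      · rintro ((h1 | ⟨h1, h', h2, h3, rfl⟩) | ⟨rfl, rfl⟩)
        · exact Or.inl h1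
        · exact Or.inr ⟨h1, h', h2, by omega, rfl⟩
        · exact Or.inr ⟨by omega, h, by omega, by omega, rfl⟩

/-- The text of the rounds `a, a + 1, …, a + c - 1`. -/
def roundText (k : ℕ) : ℕ → ℕ → List ℕ
  | _, 0 => []
  | a, c + 1 => preText k a 0 k ++ (3 * k + a + 1) :: (3 * k + a + 1) ::
      (rowText k (a + 1) 0 k ++ roundText k (a + 1) c)

/-- Moving the cut by one letter makes the rounds independent: `suf k (a + 1)` has no extensions in
the dictionary when its row begins. Without the separator between the two stretches, the last letter
`k + a` would be read together with the `suf k (a + 1)` that opens the row. -/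
theorem At.roundText {s : List Bool} {rest : List ℕ} {a c τ : ℕ} (hc : a + c + 1 = k)
    (hrest : NoV k rest)
    (H : At k s (roundText k a c ++ rest) (RoundV k (a + 1) 0) (RoundY k (a + 1) 0)
      (fun g => g ≤ 3 * k + a) τ) :
    τ + c * ∑ i ∈ Finset.range k, i * (k + 1) * k ≤ lzdTime s := by
  induction c generalizing a τ with
  | zero => simpa using H.le_time
  | succ c ih =>
    have hnov : NoV k (LZD.roundText k (a + 1) c ++ rest) := by
      cases c with
      | zero => exact hrest
      | succ c =>
        obtain ⟨k, rfl⟩ : ∃ k', k = k' + 1 := ⟨k - 1, by omega⟩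
        exact noV_cons _ (by omega)
    have e1 : LZD.roundText k a (c + 1) ++ rest = LZD.preText k a 0 k ++ ((3 * k + a + 1) ::
        (3 * k + a + 1) :: (LZD.rowText k (a + 1) 0 k ++
          (LZD.roundText k (a + 1) c ++ rest))) := by
      simp [LZD.roundText]
    rw [e1] at H
    have H2 := At.preText (by omega) (by omega) (noV_cons _ (by omega)) H
    have H3 := At.step_separator H2 (by omega) (by omega) (by omega)
    have H4 := At.rowText (by omega) (by omega) hnov H3
    have := ih (by omega) (H4.congr (fun _ _ _ => Iff.rfl) (fun _ _ _ => Iff.rfl)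
      (ES' := fun g => g ≤ 3 * k + (a + 1)) fun g => by omega)
    rw [Nat.add_mul, one_mul]
    omega

end Parse

/-- A text for which the LZD algorithm is slow. -/
def text (k : ℕ) : List ℕ :=
  List.range' 1 (4 * k) ++ (sufText k (k - 1) ++ (towerText k k ++ roundText k 0 (k - 1)))

/-- The closing letter `p` is free except that it must not belong to v, so that the last row fails
like the others; it will serve as padding. -/
theorem le_lzdTime {k p : ℕ} (hk : 2 ≤ k) (hp : 2 * k ≤ p)
    (hpos : ∀ i ∈ text k, 1 ≤ i) :
    (k - 1) * ∑ i ∈ Finset.range k, i * (k + 1) * k ≤ lzdTime (code (text k ++ [p])) := by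
  have e1 : text k ++ [p] = List.range' 1 (4 * k) ++
      (sufText k (k - 1) ++ (towerText k k ++ (roundText k 0 (k - 1) ++ [p]))) := by
    simp [text]
  have hpos' : ∀ i ∈ sufText k (k - 1) ++ (towerText k k ++ (roundText k 0 (k - 1) ++ [p])),
      1 ≤ i := by
    intro i hi
    have : i ∈ text k ++ [p] := by rw [e1]; exact List.mem_append_right _ hi
    rcases List.mem_append.1 this with h | h
    · exact hpos i h
    · rw [List.mem_singleton.1 h]; omega
  have H0 := lzd_letters (4 * k) _ hpos'
  rw [← e1] at H0
  have H1 := At.sufText (k := k) (show k - 1 < k by omega) (H0.mono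
    (Lo' := Dict k (fun a e => e = [] ∧ k - 1 ≤ a) (fun _ _ => False) fun _ => False)
    (Up' := Dict k (fun a e => e = [] ∧ k - 1 ≤ a) (fun _ _ => False) fun _ => False)
    ?_ (fun _ h => Or.inl h) le_rfl)
  · have H2 := At.towerText (k := k) (by omega) le_rfl (At.congr (EV' := TowerV k k)
      (EY' := TowerY k k) H1 ?_ ?_ fun _ => Iff.rfl)
    · have H3 := At.roundText (k := k) (a := 0) (c := k - 1) (rest := [p]) (by omega)
        (noV_cons _ hp) (H2.mono ?_ ?_ le_rfl)
      · simpa using H3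
      · rintro w (hw | ⟨a, e, ha, h | ⟨h1, h, h2, h3, rfl⟩, rfl⟩ |
          ⟨h, e, hh, h1 | ⟨a, h1, rfl⟩, rfl⟩ | ⟨g', hg', h, rfl⟩)
        · exact Or.inl hw
        · exact dict_suf ha h
        · omega
        · exact dict_cons hh h1
        -- Before the first round the only words y_h `pre k a` required are the letters y_h
        -- themselves, with `a = 0`.
        · obtain rfl : a = 0 := by omega
          exact dict_letter (by omega) (by omega)
        · omega
      · exact fun w => dict_mono (fun _ _ _ => Or.inl) (fun _ _ _ => Or.inl) fun _ => False.elim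
    · rintro a e -
      constructor
      · rintro (rfl | ⟨-, h, h1, h2, -⟩)
        · rfl
        · omega
      · exact Or.inl
    · rintro h e hh
      constructor
      · rintro ⟨h1, -⟩; omega
      · exact False.elim
  · rintro w (hw | ⟨a, e, ha, ⟨rfl, h⟩, rfl⟩ | ⟨h, e, hh, h1, rfl⟩ | ⟨g', hg', h, rfl⟩)
    · exact hw
    -- The shortest suffix is the letter `2 k - 1`, which starts the construction of the others.
    · rw [suf_eq_cons ha, show a + 1 = k by omega]
      exact ⟨k + a, by omega, by omega, by simp [suf]⟩
    · exact h1.elim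
    · exact h.elim

/-! ### Letters and length of the LZD text -/

theorem mem_tower {k h i : ℕ} (hh : h ≤ k) (hi : i ∈ tower k h) : k ≤ i ∧ i ≤ 3 * k := by
  rcases List.mem_append.1 hi with hi | hi
  · have := mem_blocks hi; omega
  · rw [List.mem_singleton.1 hi]; omega

theorem mem_sufText {k n i : ℕ} (hi : i ∈ sufText k n) : k ≤ i ∧ i < 2 * k := by
  induction n with
  | zero => simp [sufText] at hi
  | succ n ih =>
    rcases List.mem_append.1 hi with hi | hi
    · exact mem_suf hi
    · exact ih hi

theorem mem_towerText {k n i : ℕ} (hn : n ≤ k) (hi : i ∈ towerText k n) : k ≤ i ∧ i ≤ 3 * k := by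
  induction n with
  | zero => simp [towerText] at hi
  | succ n ih =>
    simp only [towerText, List.mem_append, List.mem_cons] at hi
    rcases hi with ((hi | hi) | rfl | hi | hi) | hi
    · have := mem_suf hi; omega
    · exact mem_tower hn hi
    · omega
    · have := mem_suf hi; omega
    · exact mem_tower hn hi
    · exact ih (by omega) hi

theorem mem_preText {k a h c i : ℕ} (ha : a < k) (hc : h + c ≤ k) (hi : i ∈ preText k a h c) :
    k ≤ i ∧ i ≤ 3 * k := by
  induction c generalizing h with
  | zero => simp [preText] at hi
  | succ c ih =>
    simp only [preText, List.mem_append, List.mem_cons, List.not_mem_nil, or_false] at hi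
    rcases hi with (rfl | hi) | rfl | hi
    · omega
    · have := mem_pre hi; omega
    · omega
    · exact ih (by omega) hi

theorem mem_rowText {k a h c i : ℕ} (ha : a < k) (hc : h + c ≤ k) (hi : i ∈ rowText k a h c) :
    k ≤ i ∧ i ≤ 3 * k := by
  induction c generalizing h with
  | zero => simp [rowText] at hi
  | succ c ih =>
    simp only [rowText, List.mem_append, List.mem_cons] at hi
    rcases hi with hi | (rfl | hi) | hi
    · have := mem_suf hi; omega
    · omega
    · have := mem_pre hi; omega
    · exact ih (by omega) hi

theorem mem_roundText {k a c i : ℕ} (hc : a + c + 1 ≤ k) (hi : i ∈ roundText k a c) :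
    k ≤ i ∧ i ≤ 4 * k := by
  induction c generalizing a with
  | zero => simp [roundText] at hi
  | succ c ih =>
    simp only [roundText, List.mem_append, List.mem_cons] at hi
    rcases hi with hi | rfl | rfl | hi | hi
    · have := mem_preText (by omega) (by omega) hi; omega
    · omega
    · omega
    · have := mem_rowText (by omega) (by omega) hi; omega
    · exact ih (by omega) hi

theorem mem_text {k i : ℕ} (hk : 1 ≤ k) (hi : i ∈ text k) : 1 ≤ i ∧ i ≤ 4 * k := by
  simp only [text, List.mem_append, List.mem_range'_1] at hi
  rcases hi with hi | hi | hi | hi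
  · omega
  · have := mem_sufText hi; omega
  · have := mem_towerText le_rfl hi; omega
  · have := mem_roundText (by omega) hi; omega

theorem length_tower_le (k h : ℕ) : (tower k h).length ≤ k * (k + 1) + 1 := by
  rw [tower, List.length_append, length_blocks, List.length_singleton]
  gcongr
  omega

theorem length_sufText_le (k n : ℕ) : (sufText k n).length ≤ n * k := by
  induction n with
  | zero => simp [sufText]
  | succ n ih =>
    rw [sufText, List.length_append, length_suf, Nat.add_mul]
    omega

theorem length_towerText_le (k n : ℕ) :
    (towerText k n).length ≤ n * (2 * (k + (k * (k + 1) + 1)) + 1) := by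
  induction n with
  | zero => simp [towerText]
  | succ n ih =>
    have := length_tower_le k (n + 1)
    simp only [towerText, List.length_append, List.length_cons, length_suf, Nat.add_mul n]
    omega

theorem length_preText {k a : ℕ} (h c : ℕ) : (preText k a h c).length = c * (a + 2) := by
  induction c generalizing h with
  | zero => simp [preText]
  | succ c ih =>
    simp only [preText, List.length_append, List.length_cons, length_pre, ih, List.length_nil]
    ring

theorem length_rowText {k a : ℕ} (ha : a ≤ k) (h c : ℕ) :
    (rowText k a h c).length = c * (k + 1) := by
  induction c generalizing h with
  | zero => simp [rowText]
  | succ c ih =>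
    simp only [rowText, List.length_append, List.length_cons, length_pre, length_suf, ih,
      Nat.add_mul c]
    omega

theorem length_roundText_le {k a c : ℕ} (hc : a + c + 1 ≤ k) :
    (roundText k a c).length ≤ c * (2 * (k * (k + 1)) + 2) := by
  induction c generalizing a with
  | zero => simp [roundText]
  | succ c ih =>
    have h1 := ih (a := a + 1) (by omega)
    have h2 : k * (a + 2) ≤ k * (k + 1) := Nat.mul_le_mul_left _ (by omega)
    simp only [roundText, List.length_append, List.length_cons, length_preText,
      length_rowText (show a + 1 ≤ k by omega), Nat.add_mul c]
    omega

/-- The towers need O(k) phrases of O(k²) letters and the rounds O(k) stretches of O(k²) letters;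
suffixes and initial letters are of lower order. Every letter costs at most `4 k + 1` bits. -/
theorem length_code_text_le {k : ℕ} (hk : 1 ≤ k) : (code (text k)).length ≤ 100 * k ^ 4 := by
  have h1 := length_sufText_le k (k - 1)
  have h2 := length_towerText_le k k
  have h3 := length_roundText_le (k := k) (a := 0) (c := k - 1) (by omega)
  have h4 : (k - 1) * k ≤ k * k := Nat.mul_le_mul_right _ (by omega)
  have h5 : (k - 1) * (2 * (k * (k + 1)) + 2) ≤ k * (2 * (k * (k + 1)) + 2) :=
    Nat.mul_le_mul_right _ (by omega)
  have h6 : (text k).length ≤ 20 * k ^ 3 := by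
    simp only [text, List.length_append, List.length_range']
    nlinarith [Nat.mul_le_mul hk hk, Nat.mul_le_mul hk (Nat.mul_le_mul hk hk),
      Nat.mul_le_mul (Nat.mul_le_mul hk hk) (le_refl k),
      Nat.mul_le_mul hk (le_refl (k * k))]
  calc (code (text k)).length ≤ (text k).length * (4 * k + 1) :=
        length_code_le fun i hi => (mem_text hk hi).2
    _ ≤ 20 * k ^ 3 * (5 * k) := Nat.mul_le_mul h6 (by omega)
    _ = 100 * k ^ 4 := by ring

end LZD

/-- The product equals (k-1)²k²(k+1)/2. Replacing both factors `k - 1` by `k / 2` costs a factor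
`4`, which together with the `2` of the sum gives `8`. -/
theorem pow_five_le_sum {k : ℕ} (hk : 2 ≤ k) :
    k ^ 5 ≤ 8 * ((k - 1) * ∑ i ∈ Finset.range k, i * (k + 1) * k) := by
  obtain ⟨j, rfl⟩ : ∃ j, k = j + 1 := ⟨k - 1, by omega⟩
  have h := Finset.sum_range_id_mul_two (j + 1)
  rw [← Finset.sum_mul, ← Finset.sum_mul]
  rw [Nat.add_sub_cancel] at h ⊢
  have h1 : j + 1 ≤ 2 * j := by omega
  calc (j + 1) ^ 5 ≤ (j + 1) ^ 5 + (j + 1) ^ 4 := Nat.le_add_right _ _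
    _ = (j + 1) * (j + 1) * ((j + 1) * (j + 1) * (j + 2)) := by ring
    _ ≤ (2 * j) * (2 * j) * ((j + 1) * (j + 1) * (j + 2)) := by gcongr
    _ = 4 * (j * (((j + 1) * j) * (j + 1 + 1) * (j + 1))) := by ring
    _ = 8 * (j * ((∑ i ∈ Finset.range (j + 1), i) * (j + 1 + 1) * (j + 1))) := by
      rw [← h]; ring

/-- The final letter `p` has a code of `p + 1` bits and fills the string up to length exactly `n`.
The slack between `100 k ^ 4` and `200 k ^ 4` makes `p` large enough. -/
theorem exists_lzdTime {k n : ℕ} (hk : 2 ≤ k) (hn : 200 * k ^ 4 ≤ n) :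
    ∃ s : List Bool, s.length = n ∧ k ^ 5 ≤ 8 * lzdTime s := by
  have h1 := LZD.length_code_text_le (show 1 ≤ k by omega)
  have h2 : k ≤ k ^ 4 := Nat.le_self_pow (by norm_num) k
  refine ⟨code (LZD.text k ++ [n - (code (LZD.text k)).length - 1]), ?_, ?_⟩
  · rw [code_append, List.length_append, code_cons, code_nil]
    simp only [List.length_append, List.length_replicate, List.length_cons, List.length_nil]
    omega
  · refine (pow_five_le_sum hk).trans (Nat.mul_le_mul_left _ (LZD.le_lzdTime hk (by omega)
      fun i hi => (LZD.mem_text (by omega) hi).1))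

/-! ### The slow text for LZMW -/

namespace LZMW

/-- The word `c_r b_{r+1} c_{r+1} … b_{r+d} c_{r+d}`; here `c_r` is `k + r` and `b_r` is `2 k + r`. -/
def midAux (k : ℕ) : ℕ → ℕ → List ℕ
  | r, 0 => [k + r]
  | r, d + 1 => (k + r) :: (2 * k + (r + 1)) :: midAux k (r + 1) d

/-- The word `c_r b_{r+1} c_{r+1} … b_{k-1} c_{k-1} z_h`; here `z_h` is `5 k + h`. -/
def col (k r h : ℕ) : List ℕ := midAux k r (k - 1 - r) ++ [5 * k + h]

/-- The word `c_0 b_1 c_1 b_2 … c_{r-1} b_r`. -/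
def pre (k : ℕ) : ℕ → List ℕ
  | 0 => []
  | r + 1 => pre k r ++ [k + r, 2 * k + (r + 1)]

theorem col_last (k h : ℕ) : col k (k - 1) h = [k + (k - 1), 5 * k + h] := by
  simp [col, midAux]

theorem col_of_lt {k r : ℕ} (hr : r + 1 < k) (h : ℕ) :
    col k r h = (k + r) :: (2 * k + (r + 1)) :: col k (r + 1) h := by
  simp [col, show k - 1 - r = k - 1 - (r + 1) + 1 by omega, midAux]

theorem col_eq_cons {k r : ℕ} (hr : r < k) (h : ℕ) :
    ∃ x t, col k r h = (k + r) :: x :: t ∧ (x = 2 * k + (r + 1) ∧ r + 1 < k ∨ x = 5 * k + h) := by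
  rcases Nat.lt_or_ge (r + 1) k with h1 | h1
  · exact ⟨_, _, col_of_lt h1 h, Or.inl ⟨rfl, h1⟩⟩
  · obtain rfl : r = k - 1 := by omega
    exact ⟨_, _, col_last k h, Or.inr rfl⟩

theorem pre_append_col {k r : ℕ} (hr : r < k) (h : ℕ) : pre k r ++ col k r h = col k 0 h := by
  induction r with
  | zero => rfl
  | succ r ih => rw [← ih (by omega), col_of_lt hr, pre]; simp

theorem length_col {k r : ℕ} (hr : r < k) (h : ℕ) : (col k r h).length = 2 * (k - r) := by
  have : ∀ d r, (midAux k r d).length = 2 * d + 1 := by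
    intro d
    induction d with
    | zero => intro r; rfl
    | succ d ih => intro r; simp [midAux, ih]; ring
  rw [col, List.length_append, this, List.length_singleton]
  omega

theorem length_pre (k r : ℕ) : (pre k r).length = 2 * r := by
  induction r with
  | zero => rfl
  | succ r ih => simp [pre, ih]; ring

/-- The first letter c_r determines `r`, and the last letter z_h determines `h`. -/
theorem col_append_prefix {k r r' h h' : ℕ} (hr : r < k) (hr' : r' < k) {e t : List ℕ} :
    col k r h ++ e <+: col k r' h' ++ t ↔ r = r' ∧ h = h' ∧ e <+: t := by
  constructor
  · intro H
    have : r = r' := by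
      obtain ⟨x, t1, e1, -⟩ := col_eq_cons hr h
      obtain ⟨x', t2, e2, -⟩ := col_eq_cons hr' h'
      simp only [e1, e2, List.cons_append, List.cons_prefix_cons] at H
      omega
    subst this
    rw [col, col, List.append_assoc, List.append_assoc, List.prefix_append_right_inj,
      List.singleton_append, List.singleton_append, List.cons_prefix_cons] at H
    exact ⟨rfl, by omega, H.2⟩
  · rintro ⟨rfl, rfl, h⟩
    exact (List.prefix_append_right_inj _).2 h

/-- `d` blocks `y_h c_0 b_1 c_1 … c_{k-1} z_h`, the first of them with index `h`; here `y_h` is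
`3 k + h`. -/
def blocks (k : ℕ) : ℕ → ℕ → List ℕ
  | _, 0 => []
  | h, d + 1 => (3 * k + h) :: (col k 0 h ++ blocks k (h + 1) d)

/-- The blocks up to the index `k - 1`, followed by the letter `y_k`. -/
def tower (k h : ℕ) : List ℕ := blocks k h (k - h) ++ [4 * k]

theorem tower_self (k : ℕ) : tower k k = [4 * k] := by simp [tower, blocks]

theorem tower_of_lt {k h : ℕ} (hh : h < k) :
    tower k h = (3 * k + h) :: (col k 0 h ++ tower k (h + 1)) := by
  simp [tower, show k - h = k - (h + 1) + 1 by omega, blocks]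

theorem tower_head {k h : ℕ} (hh : h ≤ k) : ∃ t, tower k h = (3 * k + h) :: t := by
  rcases hh.eq_or_lt with rfl | hh
  · exact ⟨[], by rw [tower_self]; congr 1; omega⟩
  · exact ⟨_, tower_of_lt hh⟩

theorem length_blocks {k : ℕ} (hk : 0 < k) (h d : ℕ) :
    (blocks k h d).length = d * (2 * k + 1) := by
  induction d generalizing h with
  | zero => simp [blocks]
  | succ d ih => simp [blocks, ih, length_col hk]; ring

/-- The words with a given beginning that a dictionary may contain. -/
structure Params where
  /-- The dictionary may contain `c_r b_{r+1}`. -/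
  pair : ℕ → Prop
  /-- The dictionary may contain words beginning with `b_r c_j`, `j ≠ r`. -/
  cross : ℕ → Prop
  /-- The dictionary may contain `col k r h ++ e`. -/
  col : ℕ → ℕ → List ℕ → Prop
  /-- The dictionary may contain words beginning with `c_r y_h`. -/
  colY : ℕ → ℕ → Prop
  /-- The dictionary may contain `b_r :: col k r h`. -/
  link : ℕ → ℕ → Prop
  /-- The dictionary may contain `y_h :: e`. -/
  row : ℕ → List ℕ → Prop
  /-- The dictionary may contain words beginning with `z_h`. -/
  last : ℕ → Prop

/-- The words that a dictionary described by `P` may contain. -/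
inductive Dict (k : ℕ) (P : Params) : List ℕ → Prop
  | letter (x : ℕ) : Dict k P [x]
  | pair (r : ℕ) : r + 1 < k → P.pair r → Dict k P [k + r, 2 * k + (r + 1)]
  | cross (r j : ℕ) (e : List ℕ) : r < k → j < k → j ≠ r → P.cross r →
      Dict k P ((2 * k + r) :: (k + j) :: e)
  | col (r h : ℕ) (e : List ℕ) : r < k → h < k → P.col r h e → Dict k P (col k r h ++ e)
  | colY (r h : ℕ) (e : List ℕ) : r < k → h < k → P.colY r h →
      Dict k P ((k + r) :: (3 * k + h) :: e)
  | link (r h : ℕ) : r < k → h < k → P.link r h → Dict k P ((2 * k + r) :: col k r h)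
  | row (h : ℕ) (e : List ℕ) : h ≤ k → P.row h e → Dict k P ((3 * k + h) :: e)
  | last (h : ℕ) (e : List ℕ) : h < k → P.last h → Dict k P ((5 * k + h) :: e)
  | first (e : List ℕ) : Dict k P (6 * k :: e)

theorem Dict.mono {k : ℕ} {P Q : Params} (h1 : ∀ r, P.pair r → Q.pair r)
    (h2 : ∀ r, P.cross r → Q.cross r)
    (h3 : ∀ r h e, r < k → h < k → P.col r h e → Q.col r h e)
    (h4 : ∀ r h, h < k → P.colY r h → Q.colY r h)
    (h5 : ∀ r h, h < k → P.link r h → Q.link r h) (h6 : ∀ h e, h ≤ k → P.row h e → Q.row h e)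
    (h7 : ∀ h, P.last h → Q.last h) (w : List ℕ) (hw : Dict k P w) : Dict k Q w := by
  cases hw with
  | letter x => exact .letter x
  | pair r hr h => exact .pair r hr (h1 _ h)
  | cross r j e hr hj hne h => exact .cross r j e hr hj hne (h2 _ h)
  | col r h e hr hh H => exact .col r h e hr hh (h3 _ _ _ hr hh H)
  | colY r h e hr hh H => exact .colY r h e hr hh (h4 _ _ hh H)
  | link r h hr hh H => exact .link r h hr hh (h5 _ _ hh H)
  | row h e hh H => exact .row h e hh (h6 _ _ hh H)
  | last h e hh H => exact .last h e hh (h7 _ H)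
  | first e => exact .first e

/-! ### Longest dictionary prefixes, by first letter -/

section Greedy

variable {k : ℕ} {P : Params}

theorem greedy_c {r : ℕ} (hr : r < k) {t p : List ℕ} (hp : p ≠ [])
    (h1 : r + 1 < k → P.pair r → [2 * k + (r + 1)] <+: t → 2 ≤ p.length)
    (h2 : ∀ h e, h < k → P.col r h e → col k r h ++ e <+: (k + r) :: t →
      (col k r h ++ e).length ≤ p.length)
    (h3 : ∀ h e, h < k → P.colY r h → ¬ (3 * k + h) :: e <+: t) :
    Greedy (Dict k P) ((k + r) :: t) p := by
  intro w hw hpre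
  have hp' : 1 ≤ p.length := List.length_pos_iff.2 hp
  cases hw with
  | letter x => exact hp'
  | pair r' hr' h =>
    rw [List.cons_prefix_cons] at hpre
    obtain rfl : r' = r := by omega
    exact h1 hr' h hpre.2
  | cross r j e hr hj hne h => rw [List.cons_prefix_cons] at hpre; omega
  | col r' h e hr' hh H =>
    obtain ⟨x, t1, e1, -⟩ := col_eq_cons hr' h
    have h4 := hpre
    rw [e1, List.cons_append, List.cons_prefix_cons] at h4
    obtain rfl : r' = r := by omega
    exact h2 h e hh H hpre
  | colY r' h e hr' hh H =>
    rw [List.cons_prefix_cons] at hpre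
    obtain rfl : r' = r := by omega
    exact absurd hpre.2 (h3 h e hh H)
  | link r h hr hh H => rw [List.cons_prefix_cons] at hpre; omega
  | row h e hh H => rw [List.cons_prefix_cons] at hpre; omega
  | last h e hh H => rw [List.cons_prefix_cons] at hpre; omega
  | first e => rw [List.cons_prefix_cons] at hpre; omega

theorem greedy_col {r h : ℕ} (hr : r < k) {e₀ t : List ℕ}
    (H : ∀ e, P.col r h e → e <+: t → e.length ≤ e₀.length) :
    Greedy (Dict k P) (col k r h ++ t) (col k r h ++ e₀) := by
  obtain ⟨x, t1, e1, hx⟩ := col_eq_cons hr h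
  have hl : 2 ≤ (col k r h).length := by rw [e1]; simp
  have := greedy_c (P := P) (t := x :: (t1 ++ t)) (p := col k r h ++ e₀) hr (by rw [e1]; simp)
    (fun _ _ _ => by rw [List.length_append]; omega) ?_ ?_
  · rw [e1] at this ⊢; exact this
  · intro h' e hh' he hpre
    have h4 : col k r h' ++ e <+: col k r h ++ t := by rw [e1]; exact hpre
    obtain ⟨-, rfl, h5⟩ := (col_append_prefix hr hr).1 h4
    simpa using H e he h5
  · intro h' e hh' _ hpre
    rw [List.cons_prefix_cons] at hpre
    omega

theorem greedy_b {r : ℕ} (hr : r < k) {t : List ℕ}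
    (h1 : ∀ j e, j < k → j ≠ r → P.cross r → ¬ (k + j) :: e <+: t)
    (h2 : ∀ h, h < k → P.link r h → ¬ col k r h <+: t) :
    Greedy (Dict k P) ([2 * k + r] ++ t) [2 * k + r] := by
  intro w hw hpre
  rw [List.singleton_append] at hpre
  cases hw with
  | letter x => exact le_rfl
  | pair r' hr' h => rw [List.cons_prefix_cons] at hpre; omega
  | cross r' j e hr hj hne h =>
    rw [List.cons_prefix_cons] at hpre
    obtain rfl : r' = r := by omega
    exact absurd hpre.2 (h1 j e hj hne h)
  | col r' h e hr' hh H =>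
    obtain ⟨x, t1, e1, -⟩ := col_eq_cons hr' h
    rw [e1, List.cons_append, List.cons_prefix_cons] at hpre
    omega
  | colY r' h e hr' hh H => rw [List.cons_prefix_cons] at hpre; omega
  | link r' h hr hh H =>
    rw [List.cons_prefix_cons] at hpre
    obtain rfl : r' = r := by omega
    exact absurd hpre.2 (h2 h hh H)
  | row h e hh H => rw [List.cons_prefix_cons] at hpre; omega
  | last h e hh H => rw [List.cons_prefix_cons] at hpre; omega
  | first e => rw [List.cons_prefix_cons] at hpre; omega

theorem greedy_y {h : ℕ} (hh : h ≤ k) (hk : 0 < k) {e₀ t : List ℕ}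
    (H : ∀ e, P.row h e → e <+: t → e.length ≤ e₀.length) :
    Greedy (Dict k P) ((3 * k + h) :: t) ((3 * k + h) :: e₀) := by
  intro w hw hpre
  cases hw with
  | letter x => simp
  | pair r' hr' h => rw [List.cons_prefix_cons] at hpre; omega
  | cross r' j e hr hj hne h => rw [List.cons_prefix_cons] at hpre; omega
  | col r' h e hr' hh H =>
    obtain ⟨x, t1, e1, -⟩ := col_eq_cons hr' h
    rw [e1, List.cons_append, List.cons_prefix_cons] at hpre
    omega
  | colY r' h e hr' hh H => rw [List.cons_prefix_cons] at hpre; omega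
  | link r' h hr hh H => rw [List.cons_prefix_cons] at hpre; omega
  | row h' e hh' H' =>
    rw [List.cons_prefix_cons] at hpre
    obtain rfl : h' = h := by omega
    simpa using H e H' hpre.2
  | last h e hh H => rw [List.cons_prefix_cons] at hpre; omega
  | first e => rw [List.cons_prefix_cons] at hpre; omega

theorem greedy_z {h : ℕ} (hh : h < k) {t : List ℕ} (H : ¬ P.last h) :
    Greedy (Dict k P) ([5 * k + h] ++ t) [5 * k + h] := by
  intro w hw hpre
  rw [List.singleton_append] at hpre
  cases hw with
  | letter x => simp
  | pair r' hr' h => rw [List.cons_prefix_cons] at hpre; omega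
  | cross r' j e hr hj hne h => rw [List.cons_prefix_cons] at hpre; omega
  | col r' h e hr' hh H =>
    obtain ⟨x, t1, e1, -⟩ := col_eq_cons hr' h
    rw [e1, List.cons_append, List.cons_prefix_cons] at hpre
    omega
  | colY r' h e hr' hh H => rw [List.cons_prefix_cons] at hpre; omega
  | link r' h hr hh H => rw [List.cons_prefix_cons] at hpre; omega
  | row h' e hh' H' => rw [List.cons_prefix_cons] at hpre; omega
  | last h' e hh H' =>
    rw [List.cons_prefix_cons] at hpre
    obtain rfl : h' = h := by omega
    exact absurd H' H
  | first e => rw [List.cons_prefix_cons] at hpre; omega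

end Greedy

/-- Every LZMW phrase inserts a word, often a useless one. The lower bound is therefore only known
to grow and to contain the new word, while the upper bound may be coarse: it need only be fine
enough for the greedy choices still to come. -/
theorem advance {s : List Bool} {prev u rest : List ℕ} {Lo Up : List ℕ → Prop} {τ : ℕ}
    (κ : ℕ) (Up' : List ℕ → Prop) (H : LZMWReach s prev (u ++ rest) Lo Up τ) (hu : Lo u)
    (hu0 : u ≠ []) (hg : Greedy Up (u ++ rest) u)
    (hκ : κ = 0 ∨ ∃ w c, Lo w ∧ 2 ≤ w.length ∧ c <+: w ∧ c <+: u ++ rest ∧ κ ≤ (code c).length)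
    (hUp : ∀ w, Up w → Up' w) (hnew : Up' (prev ++ u)) :
    ∃ Lo' : List ℕ → Prop, (∀ w, Lo w → Lo' w) ∧ Lo' (prev ++ u) ∧
      LZMWReach s u rest Lo' Up' (τ + κ) :=
  ⟨fun w => Lo w ∨ w = prev ++ u, fun _ => Or.inl, Or.inr rfl,
    (LZMWReach.step κ H hu hu0 hg hκ).mono (fun _ h => h)
      (fun w hw => hw.elim (hUp w) fun h => h ▸ hnew) le_rfl⟩

/-! ### The pairs `c_r b_{r+1}` -/

/-- The text `c_{n-1} b_n … c_0 b_1`. -/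
def pairText (k : ℕ) : ℕ → List ℕ
  | 0 => []
  | n + 1 => [k + n, 2 * k + (n + 1)] ++ pairText k n

/-- The dictionary after the pairs `c_r b_{r+1}` with `r ≥ n`. -/
def pairParams (n : ℕ) : Params where
  pair r := n ≤ r
  cross r := n < r
  col _ _ _ := False
  colY _ _ := False
  link _ _ := False
  row _ _ := False
  last _ := False

/-- With decreasing indices the by-products are b_r c_j with `j ≠ r`; they are harmless later, where
b_r is followed by c_r. -/
theorem parse_pairText {k : ℕ} {s : List Bool} {prev rest : List ℕ} {Lo : List ℕ → Prop} {τ n : ℕ}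
    (hn : n < k) (hL : ∀ i, 1 ≤ i → i ≤ 6 * k → Lo [i])
    (hpair : ∀ r, n ≤ r → r + 1 < k → Lo [k + r, 2 * k + (r + 1)])
    (hprev : prev = [6 * k] ∨ n + 1 < k ∧ prev = [2 * k + (n + 1)])
    (H : LZMWReach s prev (pairText k n ++ rest) Lo (Dict k (pairParams n)) τ) :
    ∃ Lo' prev', (∀ w, Lo w → Lo' w) ∧ (∀ r, r + 1 < k → Lo' [k + r, 2 * k + (r + 1)]) ∧
      (prev' = [6 * k] ∨ prev' = [2 * k + 1]) ∧
      LZMWReach s prev' rest Lo' (Dict k (pairParams 0)) τ := by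
  induction n generalizing prev Lo with
  | zero =>
    exact ⟨Lo, prev, fun _ h => h, fun r => hpair r (Nat.zero_le _), hprev.imp_right And.right, H⟩
  | succ n ih =>
    have e1 : pairText k (n + 1) ++ rest =
        [k + n] ++ ([2 * k + (n + 1)] ++ (pairText k n ++ rest)) := by simp [pairText]
    rw [e1] at H
    have ⟨Lo1, hLo1, _, H1⟩ := advance 0
      (Dict k { pairParams (n + 1) with cross := fun r => n + 1 < r }) H
      (hL _ (by omega) (by omega)) (by simp) ?_ (Or.inl rfl) ?_ ?_
    · have ⟨Lo2, hLo2, hnew, H2⟩ := advance 0 (Dict k (pairParams n)) H1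
        (hLo1 _ (hL _ (by omega) (by omega))) (by simp) ?_ (Or.inl rfl) ?_ ?_
      · have ⟨Lo3, p3, h1, h2, h3, h4⟩ := ih (by omega)
          (fun i h h' => hLo2 _ (hLo1 _ (hL i h h')))
          (fun r hr hr' => ?_) (Or.inr ⟨hn, rfl⟩) H2
        · exact ⟨Lo3, p3, fun w hw => h1 w (hLo2 w (hLo1 w hw)), h2, h3, h4⟩
        · rcases hr.eq_or_lt with rfl | hr
          · simpa using hnew
          · exact hLo2 _ (hLo1 _ (hpair r hr hr'))
      · refine greedy_b (by omega) (fun j e hj hne h => ?_) fun h _ => False.elim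
        exact absurd h (lt_irrefl _)
      · refine Dict.mono (fun r => ?_) (fun r => ?_) (fun _ _ _ _ _ h => h) (fun _ _ _ h => h)
          (fun _ _ _ h => h) (fun _ _ _ h => h) (fun _ h => h)
        · exact fun h : n + 1 ≤ r => show n ≤ r by omega
        · exact fun h : n + 1 < r => show n < r by omega
      · exact .pair n hn le_rfl
    · refine greedy_c (by omega) (by simp) (fun _ h => ?_) (fun _ _ _ => False.elim)
        (fun _ _ _ => False.elim)
      exact absurd h (Nat.not_succ_le_self n)
    · exact Dict.mono (fun r h => h) (fun r h => h) (fun _ _ _ _ _ h => h) (fun _ _ _ h => h)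
          (fun _ _ _ h => h) (fun _ _ _ h => h) (fun _ h => h)
    · rcases hprev with rfl | ⟨h1, rfl⟩
      · exact .first _
      · exact .cross (n + 1 + 1) n [] h1 (by omega) (by omega) (Nat.lt_succ_self (n + 1))

/-! ### The columns -/

/-- The word begins with a letter `c_j`. -/
def CHead (k : ℕ) (e : List ℕ) : Prop := ∃ j t, j < k ∧ e = (k + j) :: t

/-- The word begins with a letter `y_j`. -/
def YHead (k : ℕ) (e : List ℕ) : Prop := ∃ j t, j < k ∧ e = (3 * k + j) :: t

/-- The text `col k (n - 1) h … col k 0 h`. -/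
def stepText (k h : ℕ) : ℕ → List ℕ
  | 0 => []
  | n + 1 => col k n h ++ stepText k h n

/-- The dictionary after the columns `col k r h'` with `h' < h` and with `h' = h`, `r ≥ n`. -/
def colParams (k h n : ℕ) : Params where
  pair _ := True
  cross _ := True
  col r h' e := (h' < h ∨ h' = h ∧ n ≤ r) ∧ e = [] ∨
    (h' < h ∨ h' = h ∧ n + 1 ≤ r) ∧ 1 ≤ r ∧ CHead k e
  colY _ _ := False
  link _ _ := False
  row _ _ := False
  last h' := h' < h ∨ h' = h ∧ n < k

/-- A column is built from its end: the pair c_n b_{n+1} and the existing `col k (n + 1) h` are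
neighbouring phrases, and their concatenation is `col k n h`. The by-products are columns followed
by some c. -/
theorem parse_stepText {k : ℕ} {s : List Bool} {prev rest : List ℕ} {Lo : List ℕ → Prop}
    {τ h n : ℕ} (hk : 2 ≤ k) (hh : h < k) (hn : n < k)
    (hpair : ∀ r, r + 1 < k → Lo [k + r, 2 * k + (r + 1)])
    (hcol : ∀ r, n ≤ r → r < k → Lo (col k r h))
    (hprev : n + 1 < k ∧ prev = col k (n + 1) h ∨ n + 1 = k ∧ prev = [5 * k + h])
    (H : LZMWReach s prev (stepText k h n ++ rest) Lo (Dict k (colParams k h n)) τ) :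
    ∃ Lo' : List ℕ → Prop, (∀ w, Lo w → Lo' w) ∧ (∀ r, r < k → Lo' (col k r h)) ∧
      LZMWReach s (col k 1 h) rest Lo' (Dict k (colParams k h 0)) τ := by
  induction n generalizing prev Lo with
  | zero =>
    rcases hprev with ⟨-, rfl⟩ | ⟨h1, -⟩
    · exact ⟨Lo, fun _ h => h, fun r => hcol r (Nat.zero_le _), H⟩
    · omega
  | succ n ih =>
    have e1 : stepText k h (n + 1) ++ rest = [k + n, 2 * k + (n + 1)] ++
        (col k (n + 1) h ++ (stepText k h n ++ rest)) := by
      rw [stepText, col_of_lt hn]; simp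
    rw [e1] at H
    have e2 := col_of_lt hn h
    have ⟨Lo1, hLo1, _, H1⟩ := advance 0 (Dict k (colParams k h (n + 1))) H
      (hpair n hn) (by simp) ?_ (Or.inl rfl) (fun _ h => h) ?_
    · have ⟨Lo2, hLo2, hnew, H2⟩ := advance 0 (Dict k (colParams k h n)) H1
        (hLo1 _ (hcol _ le_rfl hn)) (by simp [col]) ?_ (Or.inl rfl) ?_ ?_
      · have ⟨Lo3, h1, h2, h3⟩ := ih (by omega)
          (fun r hr => hLo2 _ (hLo1 _ (hpair r hr)))
          (fun r hr hr' => ?_) (Or.inl ⟨hn, rfl⟩) H2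
        · exact ⟨Lo3, fun w hw => h1 w (hLo2 w (hLo1 w hw)), h2, h3⟩
        · rcases hr.eq_or_lt with rfl | hr
          · rw [e2]; simpa using hnew
          · exact hLo2 _ (hLo1 _ (hcol r hr hr'))
      · have := greedy_col (k := k) (P := colParams k h (n + 1)) (h := h) hn (e₀ := [])
          (t := stepText k h n ++ rest) ?_
        · simpa using this
        · rintro e (⟨-, rfl⟩ | ⟨h1, -⟩) -
          · simp
          · omega
      · refine Dict.mono (fun r h => h) (fun r h => h) (fun r h' e _ _ => ?_) (fun _ _ _ h => h)
          (fun _ _ _ h => h) (fun _ _ _ h => h) (fun h' => ?_)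
        · simp only [colParams]
          rintro (⟨h1, h2⟩ | ⟨h1, h2⟩)
          · exact Or.inl ⟨by omega, h2⟩
          · exact Or.inr ⟨by omega, h2⟩
        · simp only [colParams]; omega
      · have : Dict k (colParams k h n) (col k n h ++ []) :=
          .col n h [] (by omega) hh (Or.inl ⟨Or.inr ⟨rfl, le_rfl⟩, rfl⟩)
        rw [e2] at this
        simpa using this
    · refine greedy_c (by omega) (by simp) (fun _ _ _ => by simp) (fun h' e hh' h1 h2 => ?_)
        (fun _ _ _ => False.elim)
      have h3 : col k n h' ++ e <+: col k n h ++ (stepText k h n ++ rest) := by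
        rw [e2]; exact h2
      have h4 := (col_append_prefix (by omega) (by omega)).1 h3
      rcases h1 with ⟨h1, -⟩ | ⟨h1, -⟩ <;> omega
    · rcases hprev with ⟨h1, rfl⟩ | ⟨h1, rfl⟩
      · exact .col _ _ _ h1 hh (Or.inr ⟨Or.inr ⟨rfl, le_rfl⟩, by omega, n, _, by omega, rfl⟩)
      · exact .last _ _ hh (Or.inr ⟨rfl, hn⟩)

/-- The text of the columns with indices `h, …, h + d - 1`. -/
def colText (k : ℕ) : ℕ → ℕ → List ℕ
  | _, 0 => []
  | h, d + 1 => stepText k h k ++ colText k (h + 1) d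

theorem parse_colText {k : ℕ} {s : List Bool} {prev rest : List ℕ} {Lo : List ℕ → Prop}
    {τ h d : ℕ} (hk : 3 ≤ k) (hd : h + d = k) (hL : ∀ i, 1 ≤ i → i ≤ 6 * k → Lo [i])
    (hpair : ∀ r, r + 1 < k → Lo [k + r, 2 * k + (r + 1)])
    (hcol : ∀ r h', r < k → h' < h → Lo (col k r h'))
    (hprev : h = 0 ∧ (prev = [6 * k] ∨ prev = [2 * k + 1]) ∨ 0 < h ∧ prev = col k 1 (h - 1))
    (H : LZMWReach s prev (colText k h d ++ rest) Lo (Dict k (colParams k h k)) τ) :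
    ∃ Lo' : List ℕ → Prop, (∀ w, Lo w → Lo' w) ∧ (∀ r h', r < k → h' < k → Lo' (col k r h')) ∧
      LZMWReach s (col k 1 (k - 1)) rest Lo' (Dict k (colParams k k k)) τ := by
  induction d generalizing prev Lo h with
  | zero =>
    obtain rfl : h = k := by omega
    rcases hprev with ⟨h1, -⟩ | ⟨-, rfl⟩
    · omega
    · exact ⟨Lo, fun _ h => h, hcol, H⟩
  | succ d ih =>
    have e1 : colText k h (d + 1) ++ rest = [k + (k - 1)] ++ ([5 * k + h] ++
        (stepText k h (k - 1) ++ (colText k (h + 1) d ++ rest))) := by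
      obtain ⟨j, rfl⟩ : ∃ j, k = j + 1 := ⟨k - 1, by omega⟩
      rw [colText, stepText]
      have := col_last (j + 1) h
      simp only [Nat.add_sub_cancel] at this ⊢
      simp [this]
    rw [e1] at H
    have ⟨Lo1, hLo1, _, H1⟩ := advance 0 (Dict k (colParams k h k)) H
      (hL _ (by omega) (by omega)) (by simp) ?_ (Or.inl rfl) (fun _ h => h) ?_
    · have ⟨Lo2, hLo2, hnew, H2⟩ := advance 0 (Dict k (colParams k h (k - 1))) H1
        (hLo1 _ (hL _ (by omega) (by omega))) (by simp) ?_ (Or.inl rfl) ?_ ?_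
      · have ⟨Lo3, h1, h2, H3⟩ := parse_stepText (by omega) (by omega) (by omega)
          (fun r hr => hLo2 _ (hLo1 _ (hpair r hr))) (fun r hr hr' => ?_)
          (Or.inr ⟨by omega, rfl⟩) H2
        · have ⟨Lo4, h4, h5, H4⟩ := ih (h := h + 1) (by omega)
            (fun i h h' => h1 _ (hLo2 _ (hLo1 _ (hL i h h'))))
            (fun r hr => h1 _ (hLo2 _ (hLo1 _ (hpair r hr))))
            (fun r h' hr hh' => ?_)
            (Or.inr ⟨by omega, rfl⟩)
            (H3.mono (fun _ h => h) ?_ le_rfl)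
          · exact ⟨Lo4, fun w hw => h4 w (h1 w (hLo2 w (hLo1 w hw))), h5, H4⟩
          · rcases Nat.lt_or_ge h' h with h6 | h6
            · exact h1 _ (hLo2 _ (hLo1 _ (hcol r h' hr h6)))
            · obtain rfl : h' = h := by omega
              exact h2 r hr
          · refine Dict.mono (fun r h => h) (fun r h => h) (fun r h' e _ _ => ?_)
              (fun _ _ _ h => h) (fun _ _ _ h => h) (fun _ _ _ h => h) (fun h' => ?_)
            · simp only [colParams]
              rintro (⟨h1, h2⟩ | ⟨h1, h2⟩)
              · exact Or.inl ⟨by omega, h2⟩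
              · exact Or.inr ⟨by omega, h2⟩
            · simp only [colParams]; omega
        · obtain rfl : r = k - 1 := by omega
          rw [col_last]; exact hnew
      · refine greedy_z (by omega) ?_
        simp only [colParams]; omega
      · refine Dict.mono (fun r h => h) (fun r h => h) (fun r h' e _ _ => ?_) (fun _ _ _ h => h)
          (fun _ _ _ h => h) (fun _ _ _ h => h) (fun h' => ?_)
        · simp only [colParams]
          rintro (⟨h1, h2⟩ | ⟨h1, h2⟩)
          · exact Or.inl ⟨by omega, h2⟩
          · exact Or.inr ⟨by omega, h2⟩
        · simp only [colParams]; omega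
      · have : Dict k (colParams k h (k - 1)) (col k (k - 1) h ++ []) :=
          .col _ h [] (by omega) (by omega) (Or.inl ⟨Or.inr ⟨rfl, le_rfl⟩, rfl⟩)
        rw [col_last] at this
        simpa using this
    · refine greedy_c (by omega) (by simp) (fun h _ => by omega) (fun h' e hh' h1 h2 => ?_)
        (fun _ _ _ => False.elim)
      have h3 : col k (k - 1) h' ++ e <+: col k (k - 1) h ++
          (stepText k h (k - 1) ++ (colText k (h + 1) d ++ rest)) := by
        rw [col_last k h]; exact h2
      have h4 := (col_append_prefix (by omega) (by omega)).1 h3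
      rcases h1 with ⟨h1, -⟩ | ⟨h1, -⟩ <;> omega
    · rcases hprev with ⟨rfl, rfl | rfl⟩ | ⟨h1, rfl⟩
      · exact .first _
      -- The first column follows b_1, so the by-product is b_1 c_{k-1}; `3 ≤ k` keeps the two
      -- indices different.
      · exact .cross 1 (k - 1) [] (by omega) (by omega) (by omega) trivial
      · exact .col _ _ _ (by omega) (by omega)
          (Or.inr ⟨Or.inl (by omega), le_rfl, k - 1, [], by omega, rfl⟩)

/-! ### The towers -/

/-- The text that creates the towers with indices below `n`, in decreasing order. -/
def towerText (k : ℕ) : ℕ → List ℕ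
  | 0 => []
  | h + 1 => col k 0 h ++ (tower k (h + 1) ++ ([3 * k + h] ++
      ((col k 0 h ++ tower k (h + 1)) ++ towerText k h)))

/-- The dictionary after the towers with index at least `n` and the words
`col k 0 h ++ tower k (h + 1)` with `h ≥ c`. -/
def towerParams (k n c : ℕ) : Params where
  pair _ := True
  cross _ := True
  col r h e := r = 0 ∧ (e = [] ∨ c ≤ h ∧ e = tower k (h + 1) ∨ c < h) ∨
    1 ≤ r ∧ (e = [] ∨ CHead k e)
  colY _ _ := False
  link _ _ := False
  row h e := n ≤ h ∧ h < k ∧ e = col k 0 h ++ tower k (h + 1) ∨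
    n < h ∧ (h < k → col k 0 h ++ tower k (h + 1) <+: e)
  last _ := True

theorem towerParams_mono {k n c n' c' : ℕ} (hn : n' ≤ n) (hc : c' ≤ c) (w : List ℕ) :
    Dict k (towerParams k n c) w → Dict k (towerParams k n' c') w := by
  refine Dict.mono (P := towerParams k n c) (Q := towerParams k n' c') (fun r h => h)
    (fun r h => h) (fun r h' e _ _ => ?_) (fun _ _ _ h => h) (fun _ _ _ h => h)
    (fun h e _ => ?_) (fun _ h => h) w
  · rintro (⟨h1, h2⟩ | h1)
    · refine Or.inl ⟨h1, ?_⟩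
      rcases h2 with h2 | ⟨h2, h3⟩ | h2
      · exact Or.inl h2
      · exact Or.inr (Or.inl ⟨by omega, h3⟩)
      · exact Or.inr (Or.inr (by omega))
    · exact Or.inr h1
  · rintro (⟨h1, h2⟩ | ⟨h1, h2⟩)
    · exact Or.inl ⟨by omega, h2⟩
    · exact Or.inr ⟨by omega, h2⟩

/-- The phrases are the column, the previous tower, y_h, and the column joined with the previous
tower. The first two create the fourth, and the last two create the new tower. The by-products begin
with y_{h+1} or with a finished column, where no later phrase of this part begins. -/
theorem parse_towerText {k : ℕ} {s : List Bool} {prev rest : List ℕ} {Lo : List ℕ → Prop}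
    {τ n : ℕ} (hk : 3 ≤ k) (hn : n ≤ k) (hL : ∀ i, 1 ≤ i → i ≤ 6 * k → Lo [i])
    (hcol : ∀ h, h < k → Lo (col k 0 h)) (htow : ∀ h, n ≤ h → h < k → Lo (tower k h))
    (hprev : n = k ∧ prev = col k 1 (k - 1) ∨ n < k ∧ prev = col k 0 n ++ tower k (n + 1))
    (H : LZMWReach s prev (towerText k n ++ rest) Lo (Dict k (towerParams k n n)) τ) :
    ∃ Lo' : List ℕ → Prop, (∀ w, Lo w → Lo' w) ∧ (∀ h, h < k → Lo' (tower k h)) ∧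
      LZMWReach s (col k 0 0 ++ tower k 1) rest Lo' (Dict k (towerParams k 0 0)) τ := by
  induction n generalizing prev Lo with
  | zero =>
    rcases hprev with ⟨h1, -⟩ | ⟨-, rfl⟩
    · omega
    · exact ⟨Lo, fun _ h => h, fun h => htow h (Nat.zero_le _), H⟩
  | succ h ih =>
    have e1 : towerText k (h + 1) ++ rest = col k 0 h ++ (tower k (h + 1) ++ ([3 * k + h] ++
        ((col k 0 h ++ tower k (h + 1)) ++ (towerText k h ++ rest)))) := by simp [towerText]
    rw [e1] at H
    obtain ⟨t, ht⟩ := tower_head hn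
    obtain ⟨x, tc, hc, -⟩ := col_eq_cons (show 0 < k by omega) h
    have ⟨Lo1, hLo1, _, H1⟩ := advance 0 (Dict k (towerParams k (h + 1) h)) H
      (hcol h hn) (by simp [col]) ?_ (Or.inl rfl) (towerParams_mono le_rfl (by omega)) ?_
    · have ⟨Lo2, hLo2, hnew2, H2⟩ := advance 0 (Dict k (towerParams k (h + 1) h)) H1
        ?_ (by simp [ht]) ?_ (Or.inl rfl) (fun _ h => h) ?_
      · have ⟨Lo3, hLo3, _, H3⟩ := advance 0 (Dict k (towerParams k h h)) H2
          (hLo2 _ (hLo1 _ (hL _ (by omega) (by omega)))) (by simp) ?_ (Or.inl rfl)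
          (towerParams_mono (by omega) le_rfl) ?_
        · have ⟨Lo4, hLo4, hnew4, H4⟩ := advance 0 (Dict k (towerParams k h h)) H3
            (hLo3 _ hnew2) (by simp [col]) ?_ (Or.inl rfl)
            (fun _ h => h) ?_
          · have hall : ∀ w, Lo w → Lo4 w := fun w hw => hLo4 _ (hLo3 _ (hLo2 _ (hLo1 _ hw)))
            have ⟨Lo5, h1, h2, h3⟩ := ih (by omega) (fun i h h' => hall _ (hL i h h'))
              (fun h hh => hall _ (hcol h hh)) (fun h' hh hh' => ?_) (Or.inr ⟨hn, rfl⟩) H4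
            · exact ⟨Lo5, fun w hw => h1 _ (hall _ hw), h2, h3⟩
            · rcases hh.eq_or_lt with rfl | hh
              · rw [tower_of_lt hh']; exact hnew4
              · exact hall _ (htow h' hh hh')
          · rw [List.append_assoc]
            refine greedy_col (by omega) ?_
            rintro e (⟨-, rfl | ⟨-, rfl⟩ | h1⟩ | ⟨h1, -⟩) -
            · simp
            · exact le_rfl
            · omega
            · omega
          · exact .row h _ (by omega) (Or.inl ⟨le_rfl, hn, rfl⟩)
        · refine greedy_y (by omega) (by omega) ?_
          rintro e (⟨h1, -⟩ | ⟨h1, -⟩) <;> omega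
        · rw [ht]
          refine .row (h + 1) _ hn (Or.inr ⟨Nat.lt_succ_self h, fun hlt => ?_⟩)
          rw [tower_of_lt hlt, List.cons.injEq] at ht
          rw [ht.2]
          exact List.prefix_append _ _
      · rcases hn.eq_or_lt with h1 | h1
        · rw [h1, tower_self]; exact hLo1 _ (hL _ (by omega) (by omega))
        · exact hLo1 _ (htow _ le_rfl h1)
      · rw [ht]
        refine greedy_y hn (by omega) ?_
        rintro e (⟨-, hlt, rfl⟩ | ⟨h1, -⟩) -
        · rw [tower_of_lt hlt, List.cons.injEq] at ht
          rw [ht.2]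
        · omega
      · exact .col _ _ _ (by omega) (by omega) (Or.inl ⟨rfl, Or.inr (Or.inl ⟨le_rfl, rfl⟩)⟩)
    · have := greedy_col (k := k) (P := towerParams k (h + 1) (h + 1)) (r := 0) (h := h) (by omega)
        (e₀ := []) (t := tower k (h + 1) ++ ([3 * k + h] ++
        ((col k 0 h ++ tower k (h + 1)) ++ (towerText k h ++ rest)))) ?_
      · simpa using this
      · rintro e (⟨-, rfl | ⟨h1, -⟩ | h1⟩ | ⟨h1, -⟩) -
        · exact le_rfl
        · omega
        · omega
        · omega
    · rcases hprev with ⟨h1, rfl⟩ | ⟨h1, rfl⟩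
      · exact .col _ _ _ (by omega) (by omega)
          (Or.inr ⟨le_rfl, Or.inr ⟨0, x :: tc, by omega, hc⟩⟩)
      · rw [List.append_assoc]
        exact .col _ _ _ (by omega) (by omega) (Or.inl ⟨rfl, Or.inr (Or.inr (Nat.lt_succ_self h))⟩)

/-! ### The rounds -/

/-- The dictionary during the rounds. -/
def roundParams (k : ℕ) (A A' B C : ℕ → ℕ → Prop) : Params where
  pair _ := True
  cross _ := True
  col r h e := r = 0 ∨ e = [] ∨ CHead k e ∨ YHead k e ∧ A r h
  colY := C
  link := A
  row h e := h = k ∨ col k 0 h ++ tower k (h + 1) <+: e ∨ (∃ r, A' r h ∧ e = pre k r) ∨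
    ∃ r, B r h ∧ e = pre k r ++ [k + r]
  last _ := True

/-- The relations tell for which `(r, h)` words may be present: `A` for b_r `col k r h` and for that
column followed by a y, `A'` for y_h `pre k r`, `B` for y_h `pre k r` c_r, `C` for c_r y_h. Words
beginning with y_k are unrestricted, so comparison for `h < k` suffices. -/
theorem roundParams_mono {k : ℕ} {A A' B C D D' E F : ℕ → ℕ → Prop}
    (hA : ∀ r h, h < k → A r h → D r h) (hA' : ∀ r h, h < k → A' r h → D' r h)
    (hB : ∀ r h, h < k → B r h → E r h) (hC : ∀ r h, h < k → C r h → F r h) (w : List ℕ) :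
    Dict k (roundParams k A A' B C) w → Dict k (roundParams k D D' E F) w := by
  refine Dict.mono (P := roundParams k A A' B C) (Q := roundParams k D D' E F) (fun r h => h)
    (fun r h => h) (fun r h e _ hh => ?_) hC hA (fun h e hh => ?_) (fun _ h => h) w
  · exact Or.imp_right (Or.imp_right (Or.imp_right (And.imp_right (hA r h hh))))
  · rcases hh.eq_or_lt with rfl | hh
    · exact fun _ => Or.inl rfl
    · exact Or.imp_right (Or.imp_right (Or.imp (fun ⟨r, h1, h2⟩ => ⟨r, hA' r h hh h1, h2⟩)
        (fun ⟨r, h1, h2⟩ => ⟨r, hB r h hh h1, h2⟩)))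

/-- The dictionary in round `r` when the words `y_i :: pre k r ++ [c_r]` with `i < h` have been
created. -/
def preParams (k r h : ℕ) : Params :=
  roundParams k (fun r' _ => r' ≤ r) (fun r' _ => r' ≤ r) (fun r' h' => r' < r ∨ r' = r ∧ h' < h)
    (fun r' h' => r' < r ∨ r' = r ∧ 1 ≤ h' ∧ h' ≤ h)

/-- The dictionary in round `r` when the first `h` blocks (in the case of the prefixes, the first
`g` blocks) have been parsed. -/
def blockParams (k r h g : ℕ) : Params :=
  roundParams k (fun r' h' => r' ≤ r ∨ r' = r + 1 ∧ h' < h)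
    (fun r' h' => r' ≤ r ∨ r' = r + 1 ∧ h' < g) (fun r' _ => r' ≤ r) (fun r' _ => r' ≤ r)

/-- The text that creates the words `y_i :: pre k r ++ [c_r]` for `h ≤ i < h + d`. -/
def preText (k r : ℕ) : ℕ → ℕ → List ℕ
  | _, 0 => []
  | h, d + 1 => (3 * k + h) :: pre k r ++ ([k + r] ++ preText k r (h + 1) d)

/-- Following c_r by a y instead of b_{r+1} makes towers and columns fail, so y_h `pre k r` and c_r
become neighbouring phrases and their concatenation is created. -/
theorem parse_preText {k : ℕ} {s : List Bool} {prev rest : List ℕ} {Lo : List ℕ → Prop}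
    {τ r h d : ℕ} (hr : r + 1 < k) (hd : h + d = k) (hL : ∀ i, 1 ≤ i → i ≤ 6 * k → Lo [i])
    (hpre : ∀ h, h < k → Lo ((3 * k + h) :: pre k r))
    (hpre' : ∀ h', h' < h → Lo ((3 * k + h') :: (pre k r ++ [k + r])))
    (hprev : h = 0 → Dict k (preParams k r 0) (prev ++ 3 * k :: pre k r))
    (hprev' : 0 < h → prev = [k + r])
    (H : LZMWReach s prev (preText k r h d ++ 3 * k :: rest) Lo (Dict k (preParams k r h)) τ) :
    ∃ Lo' : List ℕ → Prop, (∀ w, Lo w → Lo' w) ∧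
      (∀ h, h < k → Lo' ((3 * k + h) :: (pre k r ++ [k + r]))) ∧
      LZMWReach s [k + r] (3 * k :: rest) Lo' (Dict k (preParams k r k)) τ := by
  induction d generalizing prev Lo h with
  | zero =>
    obtain rfl : h = k := by omega
    rw [hprev' (by omega)] at H
    exact ⟨Lo, fun _ h => h, hpre', H⟩
  | succ d ih =>
    -- The by-products c_r y_i present for this `r` have `1 ≤ i ≤ h`. The next y has index `h + 1`,
    -- or `0` after the last one, so c_r is still returned alone.
    obtain ⟨x, t, ht, hx⟩ : ∃ x t, preText k r (h + 1) d ++ 3 * k :: rest = (3 * k + x) :: t ∧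
        (x = h + 1 ∨ x = 0) := by
      cases d with
      | zero => exact ⟨0, rest, rfl, Or.inr rfl⟩
      | succ d => exact ⟨h + 1, _, rfl, Or.inl rfl⟩
    have e1 : preText k r h (d + 1) ++ 3 * k :: rest = ((3 * k + h) :: pre k r) ++
        ([k + r] ++ (preText k r (h + 1) d ++ 3 * k :: rest)) := by simp [preText]
    rw [e1] at H
    have ⟨Lo1, hLo1, _, H1⟩ := advance 0 (Dict k (preParams k r h)) H (hpre h (by omega))
      (by simp) ?_ (Or.inl rfl) (fun _ h => h) ?_
    · have ⟨Lo2, hLo2, hnew, H2⟩ := advance 0 (Dict k (preParams k r (h + 1))) H1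
        (hLo1 _ (hL _ (by omega) (by omega))) (by simp) ?_ (Or.inl rfl) ?_ ?_
      · have ⟨Lo3, h1, h2, H3⟩ := ih (h := h + 1) (by omega)
          (fun i h h' => hLo2 _ (hLo1 _ (hL i h h'))) (fun h hh => hLo2 _ (hLo1 _ (hpre h hh)))
          (fun h' hh' => ?_) (by omega) (fun _ => rfl) H2
        · exact ⟨Lo3, fun w hw => h1 w (hLo2 w (hLo1 w hw)), h2, H3⟩
        · rcases Nat.lt_or_ge h' h with h6 | h6
          · exact hLo2 _ (hLo1 _ (hpre' h' h6))
          · obtain rfl : h' = h := by omega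
            simpa using hnew
      · rw [ht]
        refine greedy_c (t := (3 * k + x) :: t) (p := [k + r]) (by omega) (by simp) (fun _ _ h1 => ?_) (fun h' e hh' h1 h2 => ?_)
          (fun h' e hh' h1 h2 => ?_)
        · rw [List.cons_prefix_cons] at h1; omega
        · rw [col_of_lt hr, List.cons_append, List.cons_append, List.cons_prefix_cons,
            List.cons_prefix_cons] at h2
          omega
        · rw [List.cons_prefix_cons] at h2
          simp only [preParams, roundParams] at h1
          omega
      · exact roundParams_mono (fun _ _ _ h => h) (fun _ _ _ h => h) (fun _ _ _ h => by omega)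
          (fun _ _ _ h => by omega)
      · exact .row h _ (by omega)
          (Or.inr (Or.inr (Or.inr ⟨r, Or.inr ⟨rfl, Nat.lt_succ_self h⟩, rfl⟩)))
    · refine greedy_y (t := pre k r ++ _) (by omega) (by omega) ?_
      rintro e (h1 | h1 | ⟨r', h1, rfl⟩ | ⟨r', h1, rfl⟩) he
      · omega
      · have h2 := h1.trans he
        rw [← pre_append_col (show r < k by omega), List.append_assoc,
          List.prefix_append_right_inj, col_of_lt hr, ht] at h2
        simp only [List.cons_append, List.cons_prefix_cons, List.nil_append] at h2
        omega
      · simp only [length_pre]; omega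
      · simp only [List.length_append, length_pre, List.length_singleton]; omega
    · rcases Nat.eq_zero_or_pos h with rfl | h1
      · exact hprev rfl
      · rw [hprev' h1]
        exact .colY r h _ (by omega) (by omega) (Or.inr ⟨rfl, h1, le_rfl⟩)

theorem blocks_append_tower (k h d : ℕ) (hd : h + d = k) :
    tower k h = blocks k h d ++ [4 * k] := by
  rw [tower, show k - h = d by omega]

theorem le_of_mem_col {k r h i : ℕ} (hr : r < k) (hi : i ∈ col k r h) :
    k ≤ i ∧ (i < 3 * k ∨ i = 5 * k + h) := by
  have : ∀ d r, r + d < k → ∀ i ∈ midAux k r d, k ≤ i ∧ i < 3 * k := by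
    intro d
    induction d with
    | zero => intro r hr i hi; rw [midAux, List.mem_singleton] at hi; omega
    | succ d ih =>
      intro r hr i hi
      simp only [midAux, List.mem_cons] at hi
      rcases hi with rfl | rfl | hi
      · omega
      · omega
      · exact ih _ (by omega) i hi
  rcases List.mem_append.1 hi with hi | hi
  · have := this _ _ (by omega) i hi; omega
  · rw [List.mem_singleton.1 hi]; omega

theorem mem_blocks {k h d i : ℕ} (hd : h + d ≤ k) (hi : i ∈ blocks k h d) :
    k ≤ i ∧ i ≤ 6 * k := by
  induction d generalizing h with
  | zero => simp [blocks] at hi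
  | succ d ih =>
    simp only [blocks, List.mem_cons, List.mem_append] at hi
    rcases hi with rfl | hi | hi
    · omega
    · have := le_of_mem_col (by omega) hi; omega
    · exact ih (by omega) hi

/-- A block is parsed as y_h `pre k r` c_r, then b_{r+1}, then `col k (r + 1) h`. The first two
create y_h `pre k (r + 1)`, the word from which the next round starts. The search at y_h reads the
whole tower except its last letter y_k, which the text after the blocks does not supply. -/
theorem parse_blocks {k : ℕ} {s : List Bool} {prev rest : List ℕ} {Lo : List ℕ → Prop}
    {τ r h d : ℕ} (hr : r + 1 < k) (hd : h + d = k) (hL : ∀ i, 1 ≤ i → i ≤ 6 * k → Lo [i])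
    (hcol : ∀ r h, r < k → h < k → Lo (col k r h)) (htow : ∀ h, h < k → Lo (tower k h))
    (hpre' : ∀ h, h < k → Lo ((3 * k + h) :: (pre k r ++ [k + r])))
    (hpre : ∀ h', h' < h → Lo ((3 * k + h') :: pre k (r + 1)))
    (hprev : h = 0 ∧ prev = [k + r] ∨ 0 < h ∧ prev = col k (r + 1) (h - 1))
    (hrest : ∀ x, [x] <+: rest → 2 * k ≤ x ∧ x ≠ 4 * k)
    (H : LZMWReach s prev (blocks k h d ++ rest) Lo (Dict k (blockParams k r h h)) τ) :
    ∃ Lo' : List ℕ → Prop, (∀ w, Lo w → Lo' w) ∧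
      (∀ h, h < k → Lo' ((3 * k + h) :: pre k (r + 1))) ∧
      LZMWReach s (col k (r + 1) (k - 1)) rest Lo' (Dict k (blockParams k r k k))
        (τ + ∑ i ∈ Finset.range d, i * (k + 1) * k) := by
  induction d generalizing prev Lo h τ with
  | zero =>
    obtain rfl : h = k := by omega
    rcases hprev with ⟨h1, -⟩ | ⟨-, rfl⟩
    · omega
    · exact ⟨Lo, fun _ h => h, hpre, H⟩
  | succ d ih =>
    rw [Finset.sum_range_succ, Nat.add_comm (∑ i ∈ Finset.range d, i * (k + 1) * k), ← Nat.add_assoc]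
    have hrest' : ∀ x, [x] <+: blocks k (h + 1) d ++ rest → 2 * k ≤ x := by
      cases d with
      | zero => exact fun x hx => (hrest x hx).1
      | succ d =>
        intro x hx
        rw [blocks, List.cons_append, List.cons_prefix_cons] at hx
        omega
    have e1 : blocks k h (d + 1) ++ rest = ((3 * k + h) :: (pre k r ++ [k + r])) ++
        ([2 * k + (r + 1)] ++ (col k (r + 1) h ++ (blocks k (h + 1) d ++ rest))) := by
      rw [blocks, ← pre_append_col (show r < k by omega), col_of_lt hr]; simp
    have htw := blocks_append_tower k h (d + 1) hd
    rw [e1] at H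
    -- In fact `d + 1` blocks of `2 k + 1` letters are matched. The smaller charge gives the same
    -- sum as for LZD.
    have ⟨Lo1, hLo1, _, H1⟩ := advance (d * (k + 1) * k) (Dict k (blockParams k r h h)) H
      (hpre' h (by omega)) (by simp) ?_ ?_ (fun _ h => h) ?_
    · have ⟨Lo2, hLo2, hnew2, H2⟩ := advance 0 (Dict k (blockParams k r h (h + 1))) H1
        (hLo1 _ (hL _ (by omega) (by omega))) (by simp) ?_ (Or.inl rfl) ?_ ?_
      · have ⟨Lo3, hLo3, hnew3, H3⟩ := advance 0 (Dict k (blockParams k r (h + 1) (h + 1))) H2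
          (hLo2 _ (hLo1 _ (hcol _ _ hr (by omega)))) (by simp [col]) ?_ (Or.inl rfl) ?_ ?_
        · have hall : ∀ w, Lo w → Lo3 w := fun w hw => hLo3 _ (hLo2 _ (hLo1 _ hw))
          have ⟨Lo4, h1, h2, H4⟩ := ih (h := h + 1) (by omega) (fun i h h' => hall _ (hL i h h'))
            (fun r h hr hh => hall _ (hcol r h hr hh)) (fun h hh => hall _ (htow h hh))
            (fun h hh => hall _ (hpre' h hh)) (fun h' hh' => ?_) (Or.inr ⟨by omega, rfl⟩) H3
          · exact ⟨Lo4, fun w hw => h1 w (hall w hw), h2, H4⟩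
          · rcases Nat.lt_or_ge h' h with h6 | h6
            · exact hall _ (hpre h' h6)
            · obtain rfl : h' = h := by omega
              have := hLo3 _ hnew2
              simpa [pre] using this
        · have := greedy_col (k := k) (P := blockParams k r h (h + 1)) (h := h) hr (e₀ := [])
            (t := blocks k (h + 1) d ++ rest) ?_
          · simpa using this
          · rintro e (h1 | rfl | ⟨j, t, hj, rfl⟩ | ⟨-, h1⟩) he
            · omega
            · exact le_rfl
            · have := hrest' (k + j) ((List.prefix_append [k + j] t).trans he)
              omega
            · omega
        · exact roundParams_mono (fun _ _ _ h => by omega) (fun _ _ _ h => h) (fun _ _ _ h => h)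
            (fun _ _ _ h => h)
        · exact .link (r + 1) h hr (by omega) (Or.inr ⟨rfl, Nat.lt_succ_self h⟩)
      -- The words b_{r+1} `col k (r + 1) h'` exist only for earlier blocks, and their last letter z
      -- differs from the one in this block.
      · refine greedy_b hr (fun j e hj hne _ h1 => ?_) fun h' hh' h1 h2 => ?_
        · obtain ⟨x, t, e2, -⟩ := col_eq_cons hr h
          rw [e2, List.cons_append, List.cons_prefix_cons] at h1
          omega
        · rw [← List.append_nil (col k (r + 1) h')] at h2
          have := (col_append_prefix hr hr).1 h2
          simp only [blockParams, roundParams] at h1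
          omega
      · exact roundParams_mono (fun _ _ _ h => h) (fun _ _ _ h => by omega) (fun _ _ _ h => h)
          (fun _ _ _ h => h)
      · have : Dict k (blockParams k r h (h + 1)) ((3 * k + h) :: pre k (r + 1)) :=
          .row h _ (by omega)
            (Or.inr (Or.inr (Or.inl ⟨r + 1, Or.inr ⟨rfl, Nat.lt_succ_self h⟩, rfl⟩)))
        simpa [pre] using this
    · refine greedy_y (t := (pre k r ++ [k + r]) ++ _) (by omega) (by omega) ?_
      rintro e (h1 | h1 | ⟨r', h1, rfl⟩ | ⟨r', h1, rfl⟩) he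
      · omega
      -- A complete match of the tower would require `rest` to begin with y_k, that is, with `4 *
      -- k`.
      · have h2 : tower k h <+: blocks k h (d + 1) ++ rest := by
          rw [e1, tower_of_lt (by omega)]
          exact List.cons_prefix_cons.2 ⟨rfl, h1.trans he⟩
        rw [htw, List.prefix_append_right_inj] at h2
        exact absurd rfl (hrest _ h2).2
      · simp only [List.length_append, length_pre, List.length_singleton]; omega
      · simp only [List.length_append, length_pre, List.length_singleton]; omega
    · refine Or.inr ⟨tower k h, blocks k h (d + 1), htow h (by omega), ?_, ?_, ?_, ?_⟩
      · rw [htw, List.length_append, length_blocks (by omega), List.length_singleton,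
          Nat.add_mul]
        omega
      · rw [htw]; exact List.prefix_append _ _
      · rw [← e1]; exact List.prefix_append _ _
      · refine le_trans (Nat.mul_le_mul_right k ?_)
          (le_length_code fun i hi => (mem_blocks hd.le hi).1)
        rw [length_blocks (by omega)]
        exact Nat.mul_le_mul (Nat.le_succ d) (by omega)
    · rcases hprev with ⟨rfl, rfl⟩ | ⟨h1, rfl⟩
      · exact .colY r 0 _ (by omega) (by omega) le_rfl
      · exact .col _ _ _ hr (by omega) (Or.inr (Or.inr (Or.inr ⟨⟨h, _, by omega, rfl⟩,
          Or.inr ⟨rfl, by omega⟩⟩)))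

/-- The text of the rounds `r, …, r + c - 1`. -/
def roundText (k : ℕ) : ℕ → ℕ → List ℕ
  | _, 0 => []
  | r, c + 1 => preText k r 0 k ++ (blocks k 0 k ++ roundText k (r + 1) c)

theorem parse_roundText {k : ℕ} {s : List Bool} {prev rest : List ℕ} {Lo : List ℕ → Prop}
    {τ r c : ℕ} (hc : r + c + 1 = k) (hL : ∀ i, 1 ≤ i → i ≤ 6 * k → Lo [i])
    (hcol : ∀ r h, r < k → h < k → Lo (col k r h)) (htow : ∀ h, h < k → Lo (tower k h))
    (hpre : ∀ h, h < k → Lo ((3 * k + h) :: pre k r))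
    (hprev : Dict k (preParams k r 0) (prev ++ 3 * k :: pre k r))
    (hrest : ∀ x, [x] <+: rest → 2 * k ≤ x ∧ x ≠ 4 * k)
    (H : LZMWReach s prev (roundText k r c ++ rest) Lo (Dict k (preParams k r 0)) τ) :
    τ + c * ∑ i ∈ Finset.range k, i * (k + 1) * k ≤ lzmwTime s := by
  induction c generalizing prev Lo r τ with
  | zero => simpa using H.le_time
  | succ c ih =>
    have hk : 0 < k := by omega
    have hrest' : ∀ x, [x] <+: roundText k (r + 1) c ++ rest → 2 * k ≤ x ∧ x ≠ 4 * k := by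
      cases c with
      | zero => exact hrest
      | succ c =>
        intro x hx
        obtain ⟨j, rfl⟩ : ∃ j, k = j + 1 := ⟨k - 1, by omega⟩
        rw [roundText, preText] at hx
        simp only [List.cons_append, List.cons_prefix_cons] at hx
        omega
    obtain ⟨t, ht⟩ : ∃ t, blocks k 0 k = 3 * k :: t := by
      obtain ⟨j, hj⟩ : ∃ j, k = j + 1 := ⟨k - 1, by omega⟩
      exact ⟨col k 0 0 ++ blocks k 1 j, by conv_lhs => rw [hj, blocks, ← hj]
                                           simp⟩
    have e1 : roundText k r (c + 1) ++ rest =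
        preText k r 0 k ++ 3 * k :: (t ++ (roundText k (r + 1) c ++ rest)) := by
      simp [roundText, ht]
    rw [e1] at H
    obtain ⟨Lo1, hLo1, hn1, H1⟩ := parse_preText (by omega) (by omega) hL hpre (by omega)
      (fun _ => hprev) (by omega) H
    rw [← List.cons_append, ← ht] at H1
    obtain ⟨Lo2, hLo2, hn2, H2⟩ := parse_blocks (by omega) (by omega)
      (fun i h h' => hLo1 _ (hL i h h')) (fun r h hr hh => hLo1 _ (hcol r h hr hh))
      (fun h hh => hLo1 _ (htow h hh)) hn1 (by omega) (Or.inl ⟨rfl, rfl⟩) hrest'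
      (H1.mono (fun _ h => h) (Up' := Dict k (blockParams k r 0 0))
        (roundParams_mono (fun _ _ _ h => by omega) (fun _ _ _ h => by omega)
          (fun _ _ _ h => by omega) (fun _ _ _ h => by omega)) le_rfl)
    have := ih (r := r + 1) (by omega) (fun i h h' => hLo2 _ (hLo1 _ (hL i h h')))
      (fun r h hr hh => hLo2 _ (hLo1 _ (hcol r h hr hh)))
      (fun h hh => hLo2 _ (hLo1 _ (htow h hh))) hn2
      (.col _ _ _ (by omega) (by omega) (Or.inr (Or.inr (Or.inr ⟨⟨0, _, hk, rfl⟩, le_rfl⟩))))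
      (H2.mono (fun _ h => h) (roundParams_mono (fun _ _ _ h => by omega)
        (fun _ _ _ h => by omega) (fun _ _ _ h => by omega) (fun _ _ _ h => by omega)) le_rfl)
    rw [Nat.add_mul, one_mul]
    omega

/-! ### The whole text -/

/-- The text to be parsed after the creation of the letters. -/
def text (k : ℕ) : List ℕ :=
  pairText k (k - 1) ++ (colText k 0 k ++ (towerText k k ++ roundText k 0 (k - 1)))

/-- A binary string for which the LZMW algorithm is slow, if followed by the code of a large
letter. -/
def bits (k : ℕ) : List Bool := false :: (lzmwIntro (6 * k) ++ code (6 * k :: text k))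

/-- The letter `6 * k` that closes the introduction does not occur in the texts that follow, so
words beginning with it never compete. The padding letter `p` exceeds y_k, which makes the last
round fail as the others do. -/
theorem le_lzmwTime {k p : ℕ} (hk : 3 ≤ k) (hp : 4 * k < p) (hpos : ∀ i ∈ text k, 1 ≤ i) :
    (k - 1) * ∑ i ∈ Finset.range k, i * (k + 1) * k ≤ lzmwTime (bits k ++ code [p]) := by
  have e1 : text k ++ [p] = pairText k (k - 1) ++ (colText k 0 k ++ (towerText k k ++
      (roundText k 0 (k - 1) ++ [p]))) := by
    simp [text]
  have e2 : bits k ++ code [p] = false :: (lzmwIntro (6 * k) ++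
      code (6 * k :: (text k ++ [p]))) := by
    rw [bits, ← List.cons_append (as := text k), code_append]; simp
  have hpos' : ∀ i ∈ text k ++ [p], 1 ≤ i := by
    intro i hi
    rcases List.mem_append.1 hi with h | h
    · exact hpos i h
    · rw [List.mem_singleton.1 h]; omega
  have H0 := lzmw_letters (show 0 < 6 * k by omega) _ hpos'
  rw [← e2, e1] at H0
  have hL0 : ∀ i, 1 ≤ i → i ≤ 6 * k → Letters (6 * k) [i] := fun i h h' => ⟨i, h, h', rfl⟩
  obtain ⟨Lo1, p1, hLo1, hpair, hp1, H1⟩ := parse_pairText (by omega) hL0 (by omega) (Or.inl rfl)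
    (H0.mono (fun _ h => h) (Up' := Dict k (pairParams (k - 1))) (by
      rintro w ⟨i, -, -, rfl⟩; exact .letter i) le_rfl)
  have hL1 : ∀ i, 1 ≤ i → i ≤ 6 * k → Lo1 [i] := fun i h h' => hLo1 _ (hL0 i h h')
  obtain ⟨Lo2, hLo2, hcol, H2⟩ := parse_colText hk (by omega) hL1 hpair (by omega)
    (Or.inl ⟨rfl, hp1⟩) (H1.mono (fun _ h => h) (Up' := Dict k (colParams k 0 k))
      (Dict.mono (fun _ _ => trivial) (fun _ _ => trivial) (fun _ _ _ _ _ => False.elim)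
        (fun _ _ _ => False.elim) (fun _ _ _ => False.elim) (fun _ _ _ => False.elim)
        (fun _ => False.elim)) le_rfl)
  have hL2 : ∀ i, 1 ≤ i → i ≤ 6 * k → Lo2 [i] := fun i h h' => hLo2 _ (hL1 i h h')
  have ⟨Lo3, hLo3, htow, H3⟩ := parse_towerText hk le_rfl hL2 (fun h hh => hcol 0 h (by omega) hh)
    (by omega) (Or.inl ⟨rfl, rfl⟩) (H2.mono (fun _ h => h)
      (Up' := Dict k (towerParams k k k)) ?_ le_rfl)
  · have hL3 : ∀ i, 1 ≤ i → i ≤ 6 * k → Lo3 [i] := fun i h h' => hLo3 _ (hL2 i h h')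
    have := parse_roundText (k := k) (r := 0) (c := k - 1) (rest := [p]) (by omega) hL3
      (fun r h hr hh => hLo3 _ (hcol r h hr hh)) htow
      (fun h hh => hL3 _ (by omega) (by omega)) ?_ ?_
      (H3.mono (fun _ h => h) (Up' := Dict k (preParams k 0 0)) ?_ le_rfl)
    · simpa using this
    · rw [List.append_assoc]
      exact .col _ _ _ (by omega) (by omega) (Or.inl rfl)
    · intro x hx
      rw [List.cons_prefix_cons] at hx
      omega
    · refine Dict.mono (fun _ h => h) (fun _ h => h) (fun r h e _ _ => ?_)
        (fun _ _ _ => False.elim) (fun _ _ _ => False.elim) (fun h e hh => ?_) (fun _ h => h)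
      · rintro (⟨h1, -⟩ | ⟨-, h1 | h1⟩)
        · exact Or.inl h1
        · exact Or.inr (Or.inl h1)
        · exact Or.inr (Or.inr (Or.inl h1))
      · rcases hh.eq_or_lt with rfl | hh
        · exact fun _ => Or.inl rfl
        · rintro (⟨-, -, rfl⟩ | ⟨-, h1⟩)
          · exact Or.inr (Or.inl List.prefix_rfl)
          · exact Or.inr (Or.inl (h1 hh))
  · refine Dict.mono (fun _ h => h) (fun _ h => h) (fun r h e hr hh => ?_) (fun _ _ _ h => h)
      (fun _ _ _ h => h) (fun _ _ _ => False.elim) (fun _ _ => trivial)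
    rintro (⟨-, h1⟩ | ⟨-, h1, h2⟩)
    · rcases Nat.eq_zero_or_pos r with h2 | h2
      · exact Or.inl ⟨h2, Or.inl h1⟩
      · exact Or.inr ⟨h2, Or.inl h1⟩
    · exact Or.inr ⟨h1, Or.inr h2⟩

/-! ### Letters and length of the LZMW text -/

theorem mem_pre {k r i : ℕ} (hi : i ∈ pre k r) : k ≤ i ∧ i ≤ 2 * k + r := by
  induction r with
  | zero => simp [pre] at hi
  | succ r ih =>
    simp only [pre, List.mem_append, List.mem_cons, List.not_mem_nil, or_false] at hi
    rcases hi with hi | rfl | rfl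
    · have := ih hi; omega
    · omega
    · omega

theorem mem_col {k r h i : ℕ} (hr : r < k) (hh : h < k) (hi : i ∈ col k r h) :
    k ≤ i ∧ i ≤ 6 * k := by
  have := le_of_mem_col hr hi; omega

theorem mem_tower {k h i : ℕ} (hh : h ≤ k) (hi : i ∈ tower k h) : k ≤ i ∧ i ≤ 6 * k := by
  rcases List.mem_append.1 hi with hi | hi
  · exact mem_blocks (by omega) hi
  · rw [List.mem_singleton.1 hi]; omega

theorem mem_pairText {k n i : ℕ} (hn : n ≤ k) (hi : i ∈ pairText k n) : k ≤ i ∧ i ≤ 6 * k := by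
  induction n with
  | zero => simp [pairText] at hi
  | succ n ih =>
    simp only [pairText, List.mem_append, List.mem_cons, List.not_mem_nil, or_false] at hi
    rcases hi with (rfl | rfl) | hi
    · omega
    · omega
    · exact ih (by omega) hi

theorem mem_stepText {k h n i : ℕ} (hh : h < k) (hn : n ≤ k) (hi : i ∈ stepText k h n) :
    k ≤ i ∧ i ≤ 6 * k := by
  induction n with
  | zero => simp [stepText] at hi
  | succ n ih =>
    rcases List.mem_append.1 hi with hi | hi
    · exact mem_col (by omega) hh hi
    · exact ih (by omega) hi

theorem mem_colText {k h d i : ℕ} (hd : h + d ≤ k) (hi : i ∈ colText k h d) :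
    k ≤ i ∧ i ≤ 6 * k := by
  induction d generalizing h with
  | zero => simp [colText] at hi
  | succ d ih =>
    rcases List.mem_append.1 hi with hi | hi
    · exact mem_stepText (by omega) le_rfl hi
    · exact ih (by omega) hi

theorem mem_towerText {k n i : ℕ} (hn : n ≤ k) (hi : i ∈ towerText k n) : k ≤ i ∧ i ≤ 6 * k := by
  induction n with
  | zero => simp [towerText] at hi
  | succ n ih =>
    simp only [towerText, List.mem_append, List.mem_singleton] at hi
    rcases hi with hi | hi | rfl | (hi | hi) | hi
    · exact mem_col (by omega) (by omega) hi
    · exact mem_tower hn hi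
    · omega
    · exact mem_col (by omega) (by omega) hi
    · exact mem_tower hn hi
    · exact ih (by omega) hi

theorem mem_preText {k r h d i : ℕ} (hr : r < k) (hd : h + d ≤ k) (hi : i ∈ preText k r h d) :
    k ≤ i ∧ i ≤ 6 * k := by
  induction d generalizing h with
  | zero => simp [preText] at hi
  | succ d ih =>
    simp only [preText, List.mem_append, List.mem_cons, List.not_mem_nil, or_false] at hi
    rcases hi with (rfl | hi) | rfl | hi
    · omega
    · have := mem_pre hi; omega
    · omega
    · exact ih (by omega) hi

theorem mem_roundText {k r c i : ℕ} (hc : r + c ≤ k) (hi : i ∈ roundText k r c) :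
    k ≤ i ∧ i ≤ 6 * k := by
  induction c generalizing r with
  | zero => simp [roundText] at hi
  | succ c ih =>
    simp only [roundText, List.mem_append] at hi
    rcases hi with hi | hi | hi
    · exact mem_preText (by omega) (by omega) hi
    · exact mem_blocks (by omega) hi
    · exact ih (by omega) hi

theorem mem_text {k i : ℕ} (hi : i ∈ text k) : k ≤ i ∧ i ≤ 6 * k := by
  simp only [text, List.mem_append] at hi
  rcases hi with hi | hi | hi | hi
  · exact mem_pairText (by omega) hi
  · exact mem_colText (by omega) hi
  · exact mem_towerText le_rfl hi
  · exact mem_roundText (by omega) hi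

theorem length_pairText (k n : ℕ) : (pairText k n).length = 2 * n := by
  induction n with
  | zero => rfl
  | succ n ih => simp only [pairText, List.length_append, List.length_cons, List.length_nil, ih]; omega

theorem length_stepText_le {k h n : ℕ} (hn : n ≤ k) : (stepText k h n).length ≤ n * (2 * k) := by
  induction n with
  | zero => simp [stepText]
  | succ n ih =>
    have := ih (by omega)
    rw [stepText, List.length_append, length_col (by omega), Nat.add_mul]
    omega

theorem length_colText_le (k h d : ℕ) : (colText k h d).length ≤ d * (k * (2 * k)) := by
  induction d generalizing h with
  | zero => simp [colText]
  | succ d ih =>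
    have := ih (h + 1)
    have := length_stepText_le (h := h) (le_refl k)
    rw [colText, List.length_append, Nat.add_mul]
    omega

theorem length_tower_le {k : ℕ} (hk : 0 < k) (h : ℕ) :
    (tower k h).length ≤ k * (2 * k + 1) + 1 := by
  rw [tower, List.length_append, length_blocks hk, List.length_singleton]
  gcongr
  omega

theorem length_towerText_le {k : ℕ} (hk : 0 < k) (n : ℕ) :
    (towerText k n).length ≤ n * (2 * (2 * k + (k * (2 * k + 1) + 1)) + 1) := by
  induction n with
  | zero => simp [towerText]
  | succ n ih =>
    have := length_tower_le hk (n + 1)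
    simp only [towerText, List.length_append, List.length_singleton, length_col hk, Nat.add_mul n]
    omega

theorem length_preText (k r h d : ℕ) : (preText k r h d).length = d * (2 * r + 2) := by
  induction d generalizing h with
  | zero => simp [preText]
  | succ d ih =>
    simp only [preText, List.length_append, List.length_cons, length_pre, ih, List.length_nil]
    ring

theorem length_roundText_le {k r c : ℕ} (hc : r + c ≤ k) :
    (roundText k r c).length ≤ c * (k * (2 * k) + k * (2 * k + 1)) := by
  induction c generalizing r with
  | zero => simp [roundText]
  | succ c ih =>
    have h1 := ih (r := r + 1) (by omega)
    have h2 : k * (2 * r + 2) ≤ k * (2 * k) := Nat.mul_le_mul_left _ (by omega)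
    simp only [roundText, List.length_append, length_preText,
      length_blocks (show 0 < k by omega), Nat.add_mul c]
    omega

theorem length_text_le {k : ℕ} (hk : 1 ≤ k) : (text k).length ≤ 24 * k ^ 3 := by
  have h1 := length_colText_le k 0 k
  have h2 := length_towerText_le hk k
  have h3 := length_roundText_le (k := k) (r := 0) (c := k - 1) (by omega)
  have h4 : (k - 1) * (k * (2 * k) + k * (2 * k + 1)) ≤ k * (k * (2 * k) + k * (2 * k + 1)) :=
    Nat.mul_le_mul_right _ (by omega)
  have h5 : k * k ≤ k ^ 3 := by
    calc k * k = k ^ 2 := by ring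
      _ ≤ k ^ 3 := Nat.pow_le_pow_right hk (by norm_num)
  have h6 : k ≤ k ^ 3 := Nat.le_self_pow (by norm_num) k
  simp only [text, List.length_append, length_pairText]
  calc _ ≤ 2 * k + (k * (k * (2 * k)) + (k * (2 * (2 * k + (k * (2 * k + 1) + 1)) + 1) +
        k * (k * (2 * k) + k * (2 * k + 1)))) := by omega
    _ = 10 * k ^ 3 + 7 * (k * k) + 5 * k := by ring
    _ ≤ 24 * k ^ 3 := by omega

theorem length_lzmwIntro_le (n : ℕ) : (lzmwIntro n).length ≤ n * (2 * n + 3) := by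
  induction n with
  | zero => simp [lzmwIntro]
  | succ n ih =>
    rw [lzmwIntro_succ]
    simp only [List.length_append, List.length_cons, List.length_replicate, List.length_nil]
    nlinarith

theorem length_bits_le {k : ℕ} (hk : 1 ≤ k) : (bits k).length ≤ 300 * k ^ 4 := by
  have h1 : (code (text k)).length ≤ 168 * k ^ 4 := by
    calc (code (text k)).length ≤ (text k).length * (6 * k + 1) :=
          length_code_le fun i hi => (mem_text hi).2
      _ ≤ 24 * k ^ 3 * (7 * k) := Nat.mul_le_mul (length_text_le hk) (by omega)
      _ = 168 * k ^ 4 := by ring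
  have h2 := length_lzmwIntro_le (6 * k)
  have h3 : 6 * k * (2 * (6 * k) + 3) = 72 * k ^ 2 + 18 * k := by ring
  have h4 : k ≤ k ^ 4 := Nat.le_self_pow (by norm_num) k
  have h5 : k ^ 2 ≤ k ^ 4 := Nat.pow_le_pow_right hk (by norm_num)
  rw [bits, code_cons]
  simp only [List.length_append, List.length_cons, List.length_replicate]
  omega

end LZMW

theorem exists_lzmwTime {k n : ℕ} (hk : 3 ≤ k) (hn : 400 * k ^ 4 ≤ n) :
    ∃ s : List Bool, s.length = n ∧ k ^ 5 ≤ 8 * lzmwTime s := by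
  have h1 := LZMW.length_bits_le (show 1 ≤ k by omega)
  have h2 : k ≤ k ^ 4 := Nat.le_self_pow (by norm_num) k
  refine ⟨LZMW.bits k ++ code [n - (LZMW.bits k).length - 1], ?_, ?_⟩
  · rw [List.length_append, code_cons, code_nil]
    simp only [List.length_append, List.length_replicate, List.length_cons, List.length_nil]
    omega
  · refine (pow_five_le_sum (by omega)).trans (Nat.mul_le_mul_left _ (LZMW.le_lzmwTime hk (by omega)
      fun i hi => ?_))
    have := LZMW.mem_text hi
    omega

/-! ### From the special strings to the asymptotic bound -/

theorem le_worstCaseBinary (time : List Bool → ℕ) (s : List Bool) :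
    time s ≤ worstCaseBinary time s.length := by
  have h := Finset.le_sup (f := fun v : Fin s.length → Bool => time (List.ofFn v))
    (Finset.mem_univ s.get)
  rwa [List.ofFn_get] at h

/-- For given `n` the largest `k` with `C * k ^ 4 ≤ n` satisfies `n ≤ C * (2 * k) ^ 4`, so `k ^ 5`
is of order n^{5/4}. -/
theorem worstCase_lower_bound {time : List Bool → ℕ} {C : ℕ}
    (H : ∀ k n, 3 ≤ k → C * k ^ 4 ≤ n → ∃ s : List Bool, s.length = n ∧ k ^ 5 ≤ 8 * time s) :
    ∃ c : ℝ, 0 < c ∧ ∃ N : ℕ, ∀ n : ℕ, N ≤ n →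
      c * ((n : ℝ) ^ (5 / 4 : ℝ) / Real.log n ^ (1 / 4 : ℝ)) ≤ (worstCaseBinary time n : ℝ) := by
  wlog hC : 1 ≤ C generalizing C
  · exact this (C := 1) (fun k n hk hn => H k n hk (le_trans (by gcongr; omega) hn)) le_rfl
  have hC0 : (0 : ℝ) < C := by exact_mod_cast hC
  set A : ℝ := (C : ℝ) ^ (5 / 4 : ℝ) with hA
  have hA0 : 0 < A := Real.rpow_pos_of_pos hC0 _
  -- Here `256 = 8 * 32`: the `8` comes from the hypothesis on the time, and `32 = 2 ^ 5` from
  -- replacing `k + 1` by `2 * k`. The threshold ensures `3 ≤ k`.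
  refine ⟨1 / (256 * A), by positivity, C * 3 ^ 4, fun n hn => ?_⟩
  have hn3 : 3 ≤ n := by omega
  have hex : ∃ m, n < C * (m + 1) ^ 4 := ⟨n, by
    calc n < n + 1 := Nat.lt_succ_self n
      _ ≤ (n + 1) ^ 4 := Nat.le_self_pow (by norm_num) _
      _ ≤ C * (n + 1) ^ 4 := Nat.le_mul_of_pos_left _ hC⟩
  set k := Nat.find hex with hk
  have hk1 : n < C * (k + 1) ^ 4 := Nat.find_spec hex
  have hk3 : 3 ≤ k := by
    by_contra h
    have : (k + 1) ^ 4 ≤ 3 ^ 4 := Nat.pow_le_pow_left (by omega) 4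
    have := Nat.mul_le_mul_left C this
    omega
  have hk2 : C * k ^ 4 ≤ n := by
    have := Nat.find_min hex (m := k - 1) (by omega)
    rw [show k - 1 + 1 = k by omega] at this
    omega
  obtain ⟨s, hs, hks⟩ := H k n hk3 hk2
  have hT : k ^ 5 ≤ 8 * worstCaseBinary time n :=
    hks.trans (Nat.mul_le_mul_left _ (hs ▸ le_worstCaseBinary time s))
  have hT' : (k : ℝ) ^ 5 ≤ 8 * worstCaseBinary time n := by exact_mod_cast hT
  have hlog : 1 ≤ Real.log n := by
    rw [Real.le_log_iff_exp_le (by positivity)]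
    exact Real.exp_one_lt_three.le.trans (by exact_mod_cast hn3)
  have hn4 : (n : ℝ) ≤ C * (2 * k) ^ 4 := by
    have : n ≤ C * (2 * k) ^ 4 := hk1.le.trans (by gcongr; omega)
    exact_mod_cast this
  have hpow : (n : ℝ) ^ (5 / 4 : ℝ) ≤ A * (32 * (k : ℝ) ^ 5) := by
    calc (n : ℝ) ^ (5 / 4 : ℝ) ≤ (C * (2 * k : ℝ) ^ 4) ^ (5 / 4 : ℝ) := by gcongr
      _ = A * (32 * (k : ℝ) ^ 5) := by
        rw [Real.mul_rpow hC0.le (by positivity), ← Real.rpow_natCast, ← Real.rpow_mul (by positivity),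
          show ((4 : ℕ) : ℝ) * (5 / 4) = (5 : ℕ) by norm_num, Real.rpow_natCast]
        ring
  calc 1 / (256 * A) * ((n : ℝ) ^ (5 / 4 : ℝ) / Real.log n ^ (1 / 4 : ℝ))
      ≤ 1 / (256 * A) * (n : ℝ) ^ (5 / 4 : ℝ) := by
        gcongr
        -- The logarithm is at least `1` because `n ≥ 3 > e`, so dividing by its power only weakens
        -- the bound.
        exact div_le_self (by positivity) (Real.one_le_rpow hlog (by norm_num))
    _ ≤ 1 / (256 * A) * (A * (32 * (k : ℝ) ^ 5)) := by gcongr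
    _ = (k : ℝ) ^ 5 / 8 := by field_simp; norm_num
    _ ≤ worstCaseBinary time n := by linarith

end NaiveParsing

theorem mainTheorem4 :
    (∃ c : ℝ, 0 < c ∧ ∃ N : ℕ, ∀ n : ℕ, N ≤ n →
      c * ((n : ℝ) ^ (5 / 4 : ℝ) / Real.log n ^ (1 / 4 : ℝ)) ≤
        (NaiveParsing.worstCaseBinary NaiveParsing.lzdTime n : ℝ)) ∧
    (∃ c : ℝ, 0 < c ∧ ∃ N : ℕ, ∀ n : ℕ, N ≤ n →
      c * ((n : ℝ) ^ (5 / 4 : ℝ) / Real.log n ^ (1 / 4 : ℝ)) ≤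
        (NaiveParsing.worstCaseBinary NaiveParsing.lzmwTime n : ℝ)) :=
  ⟨NaiveParsing.worstCase_lower_bound fun _ _ hk hn =>
      NaiveParsing.exists_lzdTime (by omega) hn,
    NaiveParsing.worstCase_lower_bound fun _ _ hk hn => NaiveParsing.exists_lzmwTime hk hn⟩
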